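/- Notation. $\|\cdot\|_F$ and $\langle A,B\rangle_F=\operatorname{tr}(A^TB)$ are the Frobenius norm and inner product on $\mathbb R^{n\times n}$, $\odot$ and $\oslash$ are the entrywise product and quotient, $\exp$ of a matrix is entrywise, $[A,B]=AB-BA$, and $\mathbf e$ is the all-ones vector. $\mathbb{DP}_n$ is the set of entrywise positive $n\times n$ matrices with all row and column sums $1$. Data. Let $(\lambda_1,\dots,\lambda_n)$ be the list of eigenvalues, with multiplicities, of some matrix in $\mathbb{DP}_n$, ordered so that $\lambda_{2j-1}=a_j+b_j\mathrm i$, $\lambda_{2j}=a_j-b_j\mathrm i$ with $b_j\ne0$ for $1\le j\le s$, and $\lambda_j\in\mathbb R$ for $j>2s$. Put $\Lambda=\operatorname{diag}(\operatorname{Re}\lambda_1,\dots,\operatorname{Re}\lambda_n)$ and $\mathcal I=\{(2k-1,2k):1\le k\le s\}$. Let $O(n)$ be the orthogonal group, $\mathcal W$ the set of matrices that are positive at the positions in $\mathcal I$ and zero elsewhere, and $\mathcal V$ the space of matrices $V$ with $V_{ij}=0$ whenever $i\ge j$ or $(i,j)\in\mathcal I$. For $W\in\mathcal W$ let $\mathcal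 A(W)_{2k,2k-1}=-b_k^2/W_{2k-1,2k}$ for $1\le k\le s$, all other entries being $0$. On $\mathcal Z=\mathbb{DP}_n\times O(n)\times\mathcal W\times\mathcal V$ define $$F(C,Q,W,V)=C-Q(\Lambda+\mathcal A(W)+W+V)Q^T\in\mathbb R^{n\times n},\qquad f(Z)=\tfrac12\|F(Z)\|_F^2 .$$ $\mathcal Z$ carries the Riemannian metric $$\langle\xi,\zeta\rangle_Z=\sum_{i,j}\frac{(\xi_C)_{ij}(\zeta_C)_{ij}}{C_{ij}}+\langle\xi_Q,\zeta_Q\rangle_F+\sum_{(i,j)\in\mathcal I}\frac{(\xi_W)_{ij}(\zeta_W)_{ij}}{W_{ij}}+\langle\xi_V,\zeta_V\rangle_F ,$$ $\operatorname{dist}$ is its Riemannian distance, $\mathrm DF(Z):T_Z\mathcal Z\to\mathbb R^{n\times n}$ is the differential of $F$, $(\mathrm DF(Z))^*$ its adjoint with respect to this metric and $\langle\cdot,\cdot\rangle_F$, and $\operatorname{grad}f(Z)=(\mathrm DF(Z))^*[F(Z)]$. The retraction is $$R_Z(\xi)=\big(\mathcal P(C\odot\exp(\xi_C\oslash C)),\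 \operatorname{qf}(Q+\xi_Q),\ R_W(\xi_W),\ V+\xi_V\big),$$ where $\mathcal P(X)$ is the doubly stochastic matrix $D_1XD_2$ obtained from the positive matrix $X$ by scaling with positive diagonal matrices (Sinkhorn), $\operatorname{qf}$ is the orthogonal factor of the QR decomposition whose triangular factor has positive diagonal, and $R_W(\xi_W)$ has the entries $W_{ij}\exp((\xi_W)_{ij}/W_{ij})$ for $(i,j)\in\mathcal I$ and $0$ elsewhere. Method. Let $\tau,\rho,\sigma_{\max}\in(0,1)$, $\delta\in(0,\frac12)$, let $\eta_k>0$ with $\eta_k\to0$, and $\gamma_k>0$ with $\sum_k\gamma_k<\infty$. An infinite sequence $(Z_k)_{k\ge0}$ in $\mathcal Z$ is generated by the nonmonotone Riemannian inexact Newton-CG method if for every $k$ there are $\Delta Y_k\in\mathbb R^{n\times n}$ and $\alpha_k$ such that, with $\sigma_k=\min\{\sigma_{\max},\|F(Z_k)\|_F\}$ and $\bar\eta_k=\min\{\eta_k,\|F(Z_k)\|_F\}$, $$\big\|\mathrm DF(Z_k)(\mathrm DF(Z_k))^*[\Delta Y_k]+\sigma_k\Delta Y_k+F(Z_k)\big\|_F\le\bar\eta_k\|F(Z_k)\|_F,\qquad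 \Delta Z_k=(\mathrm DF(Z_k))^*[\Delta Y_k],$$ $\alpha_k=1$ if $\|F(R_{Z_k}(\Delta Z_k))\|_F\le\tau\|F(Z_k)\|_F$, and otherwise $\alpha_k$ is the largest $\alpha\in\{\rho^l:l=0,1,2,\dots\}$ with $$\|F(R_{Z_k}(\alpha\Delta Z_k))\|_F^2-\|F(Z_k)\|_F^2\le-\delta\alpha^2|\langle\operatorname{grad}f(Z_k),\Delta Z_k\rangle|+\gamma_k\|F(Z_k)\|_F^2,$$ and $Z_{k+1}=R_{Z_k}(\alpha_k\Delta Z_k)$. (There is no stopping test.) Theorem. Let $Z_*\in\mathcal Z$ be an accumulation point of such a sequence $(Z_k)$, and suppose that the range of $\mathrm DF(Z_*)$ contains every $Y\in\mathbb R^{n\times n}$ with $\mathbf e^TY\mathbf e=0$ (in particular, this is so if $\mathrm DF(Z_*)$ is surjective onto $\mathbb R^{n\times n}$). Then $(Z_k)$ converges to $Z_*$ quadratically: $Z_k\to Z_*$, and there is a constant $c$ with $\operatorname{dist}(Z_{k+1},Z_*)\le c\,\operatorname{dist}(Z_k,Z_*)^2$ for all sufficiently large $k$. -/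

import Mathlib

open scoped Matrix Matrix.Norms.Frobenius ENNReal NNReal Topology

/-!
In what follows `‖·‖` on real matrices is the Frobenius norm.  Indices are 0-based, so the pairs
`(2k-1, 2k)`, `k = 1, …, s`, become `(2k, 2k+1)`, `k = 0, …, s-1`.
-/

namespace PDStIEP

/-- Real `n × n` matrices. -/
abbrev Mat (n : ℕ) : Type := Matrix (Fin n) (Fin n) ℝ

/-- Quadruples `(C, Q, W, V)` of real `n × n` matrices. -/
abbrev Quad (n : ℕ) : Type := Mat n × Mat n × Mat n × Mat n

variable {n : ℕ}

/-- The `C`-component of `(C, Q, W, V)`. -/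
abbrev cPart (Z : Quad n) : Mat n := Z.1
/-- The `Q`-component of `(C, Q, W, V)`. -/
abbrev qPart (Z : Quad n) : Mat n := Z.2.1
/-- The `W`-component of `(C, Q, W, V)`. -/
abbrev wPart (Z : Quad n) : Mat n := Z.2.2.1
/-- The `V`-component of `(C, Q, W, V)`. -/
abbrev vPart (Z : Quad n) : Mat n := Z.2.2.2

/-! ### Spectral data -/

/-- `(i, j)` is the position of the upper right corner of one of the `s` leading `2 × 2` diagonal
blocks. -/
def InI2 (s : ℕ) (i j : Fin n) : Prop :=
  ∃ k : ℕ, k < s ∧ (i : ℕ) = 2 * k ∧ (j : ℕ) = 2 * k + 1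

/-- Positive doubly stochastic matrices. -/
def DP (n : ℕ) : Set (Mat n) :=
  {A | (∀ i j, 0 < A i j) ∧ (∀ i, ∑ j, A i j = 1) ∧ (∀ j, ∑ i, A i j = 1)}

/-- The list `lam` consists of `s` conjugate pairs `a ± b i` with `b ≠ 0`, in the leading `2 s`
positions, followed by real numbers. -/
structure IsOrderedSpectrum (s : ℕ) (lam : Fin n → ℂ) : Prop where
  two_mul_le : 2 * s ≤ n
  pair : ∀ i j, InI2 s i j → (lam i).im ≠ 0 ∧ lam j = (starRingEnd ℂ) (lam i)
  real : ∀ i : Fin n, 2 * s ≤ (i : ℕ) → (lam i).im = 0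

/-- The list `lam` is, with multiplicities, the spectrum of some positive doubly stochastic
matrix. -/
def IsRealizable (lam : Fin n → ℂ) : Prop :=
  ∃ C ∈ DP n, (C.map Complex.ofReal).charpoly.roots = Finset.univ.val.map lam

/-! ### The matrix product manifold -/

/-- The set `𝒲`. -/
def setW (n s : ℕ) : Set (Mat n) :=
  {W | (∀ i j, ¬ InI2 s i j → W i j = 0) ∧ ∀ i j, InI2 s i j → 0 < W i j}

/-- The set `𝒱`. -/
def setV (n s : ℕ) : Set (Mat n) :=
  {V | ∀ i j, (j ≤ i ∨ InI2 s i j) → V i j = 0}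

/-- `𝒵 = DP_n × O(n) × 𝒲 × 𝒱` as a set of quadruples. -/
def setZ (n s : ℕ) : Set (Quad n) :=
  {Z | cPart Z ∈ DP n ∧ (qPart Z)ᵀ * qPart Z = 1 ∧ wPart Z ∈ setW n s ∧ vPart Z ∈ setV n s}

/-- The manifold `𝒵`, with the subspace topology. -/
abbrev Pt (n s : ℕ) : Type := ↥(setZ n s)

/-- The tangent space `T_Z 𝒵`; a vector `ξ` is tangent to `O(n)` at `Q` iff `ξ = Q K` for a
skew-symmetric `K`. -/
def tangent (s : ℕ) (Z : Quad n) : Submodule ℝ (Quad n) where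
  carrier := {ξ |
    ((∀ i, ∑ j, cPart ξ i j = 0) ∧ (∀ j, ∑ i, cPart ξ i j = 0)) ∧
    (∃ K : Mat n, Kᵀ = -K ∧ qPart ξ = qPart Z * K) ∧
    (∀ i j, ¬ InI2 s i j → wPart ξ i j = 0) ∧
    vPart ξ ∈ setV n s}
  zero_mem' := by
    refine ⟨⟨fun i => Finset.sum_const_zero, fun j => Finset.sum_const_zero⟩, ⟨0, by simp, ?_⟩,
      fun i j _ => rfl, fun i j _ => rfl⟩
    rw [mul_zero]
    rfl
  add_mem' := by
    rintro ξ ζ ⟨⟨h1, h2⟩, ⟨K, hK, h3⟩, h4, h5⟩ ⟨⟨g1, g2⟩, ⟨L, hL, g3⟩, g4, g5⟩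
    refine ⟨⟨fun i => ?_, fun j => ?_⟩, ⟨K + L, ?_, ?_⟩, fun i j h => ?_, fun i j h => ?_⟩
    · simpa [Finset.sum_add_distrib, h1 i] using g1 i
    · simpa [Finset.sum_add_distrib, h2 j] using g2 j
    · rw [Matrix.transpose_add, hK, hL, neg_add]
    · change qPart ξ + qPart ζ = _
      rw [h3, g3, mul_add]
    · change wPart ξ i j + wPart ζ i j = 0
      rw [h4 i j h, g4 i j h, add_zero]
    · change vPart ξ i j + vPart ζ i j = 0
      rw [h5 i j h, g5 i j h, add_zero]
  smul_mem' := by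
    rintro c ξ ⟨⟨h1, h2⟩, ⟨K, hK, h3⟩, h4, h5⟩
    refine ⟨⟨fun i => ?_, fun j => ?_⟩, ⟨c • K, ?_, ?_⟩, fun i j h => ?_, fun i j h => ?_⟩
    · change ∑ j, c * cPart ξ i j = 0
      rw [← Finset.mul_sum, h1 i, mul_zero]
    · change ∑ i, c * cPart ξ i j = 0
      rw [← Finset.mul_sum, h2 j, mul_zero]
    · rw [Matrix.transpose_smul, hK, smul_neg]
    · change c • qPart ξ = _
      rw [h3, Matrix.mul_smul]
    · change c * wPart ξ i j = 0
      rw [h4 i j h, mul_zero]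
    · change c * vPart ξ i j = 0
      rw [h5 i j h, mul_zero]

/-- The Frobenius inner product `tr (Aᵀ B)`. -/
def frob (A B : Mat n) : ℝ := (Aᵀ * B).trace

open Classical in
/-- The Riemannian metric of `𝒵` at `Z`: the sum of the Fisher metric on `DP_n`, the Frobenius
inner product on `O(n)`, the Fisher metric on `𝒲` and the Frobenius inner product on `𝒱`. -/
noncomputable def metric (s : ℕ) (Z ξ ζ : Quad n) : ℝ :=
  (∑ i, ∑ j, cPart ξ i j * cPart ζ i j / cPart Z i j) +
  frob (qPart ξ) (qPart ζ) +
  (∑ i, ∑ j, if InI2 s i j then wPart ξ i j * wPart ζ i j / wPart Z i j else 0) +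
  frob (vPart ξ) (vPart ζ)

lemma frob_eq_sum (A B : Mat n) : frob A B = ∑ i, ∑ j, A i j * B i j := by
  unfold frob
  rw [Matrix.trace, Finset.sum_comm]
  simp [Matrix.mul_apply]

/-- The metric at `Z` as a bilinear form on `T_Z 𝒵`. -/
noncomputable def metricForm (s : ℕ) (Z : Quad n) : LinearMap.BilinForm ℝ (tangent s Z) :=
  LinearMap.mk₂ ℝ (fun ξ ζ => metric s Z ξ ζ)
    (by
      intro ξ ξ' ζ
      simp only [metric, frob_eq_sum, ← Finset.sum_add_distrib]
      refine Finset.sum_congr rfl fun i _ => Finset.sum_congr rfl fun j _ => ?_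
      simp only [cPart, qPart, wPart, vPart, Submodule.coe_add, Prod.fst_add, Prod.snd_add,
        Matrix.add_apply]
      split_ifs <;> ring)
    (by
      intro c ξ ζ
      simp only [metric, frob_eq_sum, ← Finset.sum_add_distrib, smul_eq_mul, Finset.mul_sum]
      refine Finset.sum_congr rfl fun i _ => Finset.sum_congr rfl fun j _ => ?_
      simp only [cPart, qPart, wPart, vPart, Submodule.coe_smul, Prod.smul_fst, Prod.smul_snd,
        Matrix.smul_apply, smul_eq_mul]
      split_ifs <;> ring)
    (by
      intro ξ ζ ζ'
      simp only [metric, frob_eq_sum, ← Finset.sum_add_distrib]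
      refine Finset.sum_congr rfl fun i _ => Finset.sum_congr rfl fun j _ => ?_
      simp only [cPart, qPart, wPart, vPart, Submodule.coe_add, Prod.fst_add, Prod.snd_add,
        Matrix.add_apply]
      split_ifs <;> ring)
    (by
      intro c ξ ζ
      simp only [metric, frob_eq_sum, ← Finset.sum_add_distrib, smul_eq_mul, Finset.mul_sum]
      refine Finset.sum_congr rfl fun i _ => Finset.sum_congr rfl fun j _ => ?_
      simp only [cPart, qPart, wPart, vPart, Submodule.coe_smul, Prod.smul_fst, Prod.smul_snd,
        Matrix.smul_apply, smul_eq_mul]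
      split_ifs <;> ring)

lemma metricForm_apply (s : ℕ) (Z : Quad n) (ξ ζ : tangent s Z) :
    metricForm s Z ξ ζ = metric s Z ξ ζ := rfl

lemma metricForm_isSymm (s : ℕ) (Z : Quad n) (ξ ζ : tangent s Z) :
    metricForm s Z ξ ζ = metricForm s Z ζ ξ := by
  simp only [metricForm_apply, metric, frob_eq_sum, mul_comm]

lemma eq_zero_of_metric_self {s : ℕ} (Z : Pt n s) (ξ : tangent s (Z : Quad n))
    (h : metricForm s (Z : Quad n) ξ ξ = 0) : ξ = 0 := by
  classical
  obtain ⟨⟨Z, hC, hQ, hW, hV⟩, ⟨ξ, h1, h2, h3, h4⟩⟩ := Z, ξ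
  simp only [metricForm_apply, metric, frob_eq_sum, ← Finset.sum_add_distrib] at h
  have nn : ∀ i j : Fin n, 0 ≤ cPart ξ i j * cPart ξ i j / cPart Z i j ∧
      0 ≤ qPart ξ i j * qPart ξ i j ∧
      0 ≤ (if InI2 s i j then wPart ξ i j * wPart ξ i j / wPart Z i j else 0) ∧
      0 ≤ vPart ξ i j * vPart ξ i j := by
    intro i j
    refine ⟨div_nonneg (mul_self_nonneg _) (hC.1 i j).le, mul_self_nonneg _, ?_,
      mul_self_nonneg _⟩
    split_ifs with hij
    · exact div_nonneg (mul_self_nonneg _) (hW.2 i j hij).le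
    · exact le_rfl
  rw [Finset.sum_eq_zero_iff_of_nonneg] at h
  · have key : ∀ i j : Fin n, ξ.1 i j = 0 ∧ ξ.2.1 i j = 0 ∧ ξ.2.2.1 i j = 0 ∧ ξ.2.2.2 i j = 0 := by
      intro i j
      have hi := h i (Finset.mem_univ i)
      rw [Finset.sum_eq_zero_iff_of_nonneg] at hi
      · have hij := hi j (Finset.mem_univ j)
        obtain ⟨n1, n2, n3, n4⟩ := nn i j
        have e1 : cPart ξ i j * cPart ξ i j / cPart Z i j = 0 := by linarith
        have e2 : qPart ξ i j * qPart ξ i j = 0 := by linarith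
        have e3 : (if InI2 s i j then wPart ξ i j * wPart ξ i j / wPart Z i j else 0) = 0 := by
          linarith
        have e4 : vPart ξ i j * vPart ξ i j = 0 := by linarith
        refine ⟨?_, mul_self_eq_zero.mp e2, ?_, mul_self_eq_zero.mp e4⟩
        · rcases div_eq_zero_iff.mp e1 with e | e
          · exact mul_self_eq_zero.mp e
          · exact absurd e (hC.1 i j).ne'
        · by_cases hI : InI2 s i j
          · rw [if_pos hI] at e3
            rcases div_eq_zero_iff.mp e3 with e | e
            · exact mul_self_eq_zero.mp e
            · exact absurd e (hW.2 i j hI).ne'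
          · exact h3 i j hI
      · intro j _
        obtain ⟨n1, n2, n3, n4⟩ := nn i j
        linarith
    apply Subtype.ext
    refine Prod.ext ?_ (Prod.ext ?_ (Prod.ext ?_ ?_))
    · ext i j
      exact (key i j).1
    · ext i j
      exact (key i j).2.1
    · ext i j
      exact (key i j).2.2.1
    · ext i j
      exact (key i j).2.2.2
  · intro i _
    refine Finset.sum_nonneg fun j _ => ?_
    obtain ⟨n1, n2, n3, n4⟩ := nn i j
    linarith

lemma metricForm_nondegenerate {s : ℕ} (Z : Pt n s) :
    (metricForm s (Z : Quad n)).Nondegenerate :=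
  ⟨fun ξ h => eq_zero_of_metric_self Z ξ (h ξ), fun ξ h => eq_zero_of_metric_self Z ξ (h ξ)⟩

/-- The length of the curve `γ` on `[0, 1]` with respect to the Riemannian metric of `𝒵`. -/
noncomputable def curveLength (s : ℕ) (γ : ℝ → Quad n) : ℝ≥0∞ :=
  ∫⁻ t in Set.Icc (0 : ℝ) 1, ENNReal.ofReal (√(metric s (γ t) (deriv γ t) (deriv γ t)))

/-- The Riemannian distance on `𝒵`: the infimum of the lengths of the `C¹` curves in `𝒵` that
join the two points (and `∞` if there is none). -/
noncomputable def riemDist {s : ℕ} (Z Z' : Pt n s) : ℝ≥0∞ :=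
  ⨅ (γ : ℝ → Quad n) (_ : ContDiff ℝ 1 γ) (_ : ∀ t ∈ Set.Icc (0 : ℝ) 1, γ t ∈ setZ n s)
    (_ : γ 0 = Z) (_ : γ 1 = Z'), curveLength s γ

/-! ### The nonlinear equation and its differential -/

open Classical in
/-- The operator `𝒜`; the number `b` of a conjugate pair `a ± b i` is read off from `lam`. -/
noncomputable def opA (s : ℕ) (lam : Fin n → ℂ) (W : Mat n) : Mat n :=
  Matrix.of fun i j => if InI2 s j i then -(lam i).im ^ 2 / W j i else 0

/-- The block diagonal matrix `Λ`, which is diagonal with the real parts of the prescribed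
eigenvalues as its entries. -/
noncomputable def matLam (lam : Fin n → ℂ) : Mat n := Matrix.diagonal fun i => (lam i).re

/-- The middle factor `Λ + 𝒜(W) + W + V`. -/
noncomputable def schurT (s : ℕ) (lam : Fin n → ℂ) (Z : Quad n) : Mat n :=
  matLam lam + opA s lam (wPart Z) + wPart Z + vPart Z

/-- `F (C, Q, W, V) = C - Q (Λ + 𝒜(W) + W + V) Qᵀ`. -/
noncomputable def mapF (s : ℕ) (lam : Fin n → ℂ) (Z : Quad n) : Mat n :=
  cPart Z - qPart Z * schurT s lam Z * (qPart Z)ᵀ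

open Classical in
/-- The matrix `B_W`. -/
noncomputable def matB (s : ℕ) (lam : Fin n → ℂ) (W : Mat n) : Mat n :=
  Matrix.of fun i j => if InI2 s i j then (lam j).im ^ 2 / W i j ^ 2 else 0

/-- The differential `DF(Z) : T_Z 𝒵 → ℝ^{n × n}`. -/
noncomputable def diffF (s : ℕ) (lam : Fin n → ℂ) (Z : Quad n) : tangent s Z →ₗ[ℝ] Mat n where
  toFun ξ :=
    cPart ξ.1 + ⁅qPart Z * schurT s lam Z * (qPart Z)ᵀ, qPart ξ.1 * (qPart Z)ᵀ⁆
      - qPart Z * ((matB s lam (wPart Z) ⊙ wPart ξ.1)ᵀ + wPart ξ.1 + vPart ξ.1) * (qPart Z)ᵀ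
  map_add' ξ ζ := by
    simp only [cPart, qPart, wPart, vPart, Submodule.coe_add, Prod.fst_add, Prod.snd_add,
      Matrix.hadamard_add, Matrix.transpose_add, Matrix.mul_add, Matrix.add_mul, Ring.lie_def]
    abel
  map_smul' c ξ := by
    simp only [cPart, qPart, wPart, vPart, Submodule.coe_smul, Prod.smul_fst, Prod.smul_snd,
      Matrix.hadamard_smul, Matrix.transpose_smul, Ring.lie_def, Matrix.smul_mul,
      Matrix.mul_smul, RingHom.id_apply, smul_add, smul_sub, Matrix.mul_add, Matrix.add_mul]

/-- The linear functional `ξ ↦ ⟨Y, DF(Z)[ξ]⟩_F` on `T_Z 𝒵`, linear in `Y` as well. -/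
noncomputable def pairing (s : ℕ) (lam : Fin n → ℂ) (Z : Quad n) :
    Mat n →ₗ[ℝ] Module.Dual ℝ (tangent s Z) :=
  LinearMap.mk₂ ℝ (fun Y ξ => frob Y (diffF s lam Z ξ))
    (by intro Y Y' ξ; simp [frob, Matrix.transpose_add, Matrix.add_mul])
    (by intro c Y ξ; simp [frob])
    (by intro Y ξ ξ'; simp [frob, Matrix.mul_add])
    (by intro c Y ξ; simp [frob])

/-- The adjoint `(DF(Z))^* : ℝ^{n × n} → T_Z 𝒵` with respect to the Riemannian metric of `𝒵` and
the Frobenius inner product. -/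
noncomputable def adjF {s : ℕ} (lam : Fin n → ℂ) (Z : Pt n s) :
    Mat n →ₗ[ℝ] tangent s (Z : Quad n) :=
  ((metricForm s (Z : Quad n)).toDual (metricForm_nondegenerate Z)).symm.toLinearMap ∘ₗ
    pairing s lam (Z : Quad n)

lemma metricForm_adjF {s : ℕ} (lam : Fin n → ℂ) (Z : Pt n s) (Y : Mat n)
    (ξ : tangent s (Z : Quad n)) :
    metricForm s (Z : Quad n) (adjF lam Z Y) ξ = frob Y (diffF s lam (Z : Quad n) ξ) :=
  LinearMap.BilinForm.apply_toDual_symm_apply (hB := metricForm_nondegenerate Z) _ _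

/-- The Riemannian gradient `(DF(Z))^*[F(Z)]` of the merit function `½ ‖F(Z)‖²`. -/
noncomputable def gradf {s : ℕ} (lam : Fin n → ℂ) (Z : Pt n s) : tangent s (Z : Quad n) :=
  adjF lam Z (mapF s lam (Z : Quad n))

/-! ### The retraction -/

/-- `P` is the doubly stochastic matrix `D₁ X D₂` obtained from the positive matrix `X` by scaling
with positive diagonal matrices; by Sinkhorn's theorem, it exists and is unique, and it is the
limit of the Sinkhorn-Knopp iteration. -/
def IsSinkhornScaling (X P : Mat n) : Prop :=
  P ∈ DP n ∧ ∃ x y : Fin n → ℝ, (∀ i, 0 < x i) ∧ (∀ j, 0 < y j) ∧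
    P = Matrix.diagonal x * X * Matrix.diagonal y

open Classical in
/-- The mapping `𝒫` from positive matrices to positive doubly stochastic matrices. -/
noncomputable def sinkhorn (X : Mat n) : Mat n :=
  if h : ∃ P, IsSinkhornScaling X P then h.choose else X

/-- `Q` is the orthogonal factor of a QR decomposition of `M` whose upper triangular factor has
positive diagonal entries; it exists and is unique if `M` is nonsingular. -/
def IsQFactor (M Q : Mat n) : Prop :=
  Qᵀ * Q = 1 ∧ ∃ R : Mat n, (∀ i j, j < i → R i j = 0) ∧ (∀ i, 0 < R i i) ∧ M = Q * R

open Classical in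
/-- The `Q` factor `qf` of the QR decomposition of a nonsingular matrix. -/
noncomputable def qf (M : Mat n) : Mat n :=
  if h : ∃ Q, IsQFactor M Q then h.choose else 1

open Classical in
/-- The retraction `R_Z(ξ)` on `𝒵`. -/
noncomputable def retr (s : ℕ) (Z ξ : Quad n) : Quad n :=
  (sinkhorn (Matrix.of fun i j => cPart Z i j * Real.exp (cPart ξ i j / cPart Z i j)),
   qf (qPart Z + qPart ξ),
   Matrix.of fun i j =>
     if InI2 s i j then wPart Z i j * Real.exp (wPart ξ i j / wPart Z i j) else 0,
   vPart Z + vPart ξ)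

/-! ### The nonmonotone Riemannian inexact Newton-CG method -/

/-- Admissible parameters of the method: `τ, ρ, σmax ∈ (0, 1)`, `δ ∈ (0, 1/2)`, and positive
sequences `η → 0` and `γ` with `∑ γ_k < ∞`. -/
structure IsAdmissible (τ ρ σmax δ : ℝ) (η γ : ℕ → ℝ) : Prop where
  tau_mem : τ ∈ Set.Ioo (0 : ℝ) 1
  rho_mem : ρ ∈ Set.Ioo (0 : ℝ) 1
  sigma_mem : σmax ∈ Set.Ioo (0 : ℝ) 1
  delta_mem : δ ∈ Set.Ioo (0 : ℝ) (1 / 2)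
  eta_pos : ∀ k, 0 < η k
  eta_tendsto : Filter.Tendsto η Filter.atTop (𝓝 0)
  gamma_pos : ∀ k, 0 < γ k
  gamma_summable : Summable γ

/-- `Y` solves `(DF(Z) ∘ DF(Z)^* + σ id)[Y] = -F(Z)` with residual at most `η' ‖F(Z)‖`, where
`σ = min {σmax, ‖F(Z)‖}` and `η' = min {ηk, ‖F(Z)‖}`. -/
def IsInexactSolution {s : ℕ} (lam : Fin n → ℂ) (σmax ηk : ℝ) (Z : Pt n s) (Y : Mat n) : Prop :=
  ‖diffF s lam (Z : Quad n) (adjF lam Z Y) + min σmax ‖mapF s lam (Z : Quad n)‖ • Y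
      + mapF s lam (Z : Quad n)‖
    ≤ min ηk ‖mapF s lam (Z : Quad n)‖ * ‖mapF s lam (Z : Quad n)‖

/-- The nonmonotone line search condition for the step size `α` along `ξ`. -/
def LineSearch {s : ℕ} (lam : Fin n → ℂ) (δ γk : ℝ) (Z : Pt n s) (ξ : tangent s (Z : Quad n))
    (α : ℝ) : Prop :=
  ‖mapF s lam (retr s (Z : Quad n) (α • ξ : tangent s (Z : Quad n)))‖ ^ 2
      - ‖mapF s lam (Z : Quad n)‖ ^ 2
    ≤ -δ * α ^ 2 * |metric s (Z : Quad n) (gradf lam Z) ξ|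
      + γk * ‖mapF s lam (Z : Quad n)‖ ^ 2

/-- The step size rule: `α = 1` if the full step reduces `‖F‖` by the factor `τ`; otherwise `α` is
the largest `ρ ^ l`, `l = 0, 1, 2, …`, that satisfies the line search condition. -/
def IsStepSize {s : ℕ} (lam : Fin n → ℂ) (τ ρ δ γk : ℝ) (Z : Pt n s)
    (ξ : tangent s (Z : Quad n)) (α : ℝ) : Prop :=
  (‖mapF s lam (retr s (Z : Quad n) ξ)‖ ≤ τ * ‖mapF s lam (Z : Quad n)‖ ∧ α = 1) ∨
  (¬ ‖mapF s lam (retr s (Z : Quad n) ξ)‖ ≤ τ * ‖mapF s lam (Z : Quad n)‖ ∧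
    IsGreatest {a : ℝ | (∃ l : ℕ, a = ρ ^ l) ∧ LineSearch lam δ γk Z ξ a} α)

/-- `Z` is an infinite sequence of iterates of the method (the stopping test, which only serves to
truncate the sequence, is left out). -/
def IsIterates {s : ℕ} (lam : Fin n → ℂ) (τ ρ σmax δ : ℝ) (η γ : ℕ → ℝ) (Z : ℕ → Pt n s) : Prop :=
  ∀ k, ∃ (Y : Mat n) (α : ℝ), IsInexactSolution lam σmax (η k) (Z k) Y ∧
    IsStepSize lam τ ρ δ (γ k) (Z k) (adjF lam (Z k) Y) α ∧
    (Z (k + 1) : Quad n) =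
      retr s (Z k : Quad n) (α • adjF lam (Z k) Y : tangent s (Z k : Quad n))

/-- The sequence `Z` converges to `Zstar` quadratically: it converges to `Zstar`, and
`dist (Z (k+1), Zstar) ≤ c * dist (Z k, Zstar) ^ 2` for some constant `c` and all large `k`, where
`dist` is the Riemannian distance. -/
def ConvergesQuadratically {s : ℕ} (Z : ℕ → Pt n s) (Zstar : Pt n s) : Prop :=
  Filter.Tendsto Z Filter.atTop (𝓝 Zstar) ∧
  ∃ c : ℝ≥0, ∀ᶠ k in Filter.atTop,
    riemDist (Z (k + 1)) Zstar ≤ c * riemDist (Z k) Zstar ^ 2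

end PDStIEP

/-! For `n > 0` the number `1` is a prescribed eigenvalue, because the all-ones vector `e` is a
right and left eigenvector of every doubly stochastic matrix. This makes the problem degenerate: at
a zero of `F` the range of `DF` lies in the hyperplane `eᵀYe = 0`. Hence `M = DF ∘ DF*` annihilates
the all-ones matrix `J` there, while the shift `σ_k` tends to `0` as fast as `‖F(Z_k)‖`, so `M +
σ_k` has no uniformly bounded inverse near the limit. The hypothesis asks for the largest range that
is possible at a zero.

The degenerate direction is harmless because nearly everything is orthogonal to it. Write `C - F = Q
T Qᵀ`, where `T` has the eigenvalue `1` at a diagonal position `p` outside the `2 × 2` blocks. Its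
right and left eigenvectors `y`, `x` live on the indices `≤ p` and `≥ p`, and after scaling `Qy` and
`Qx` are `e + O(‖F‖)`, by a spectral gap for positive doubly stochastic matrices. Two consequences
carry the proof: `⟨J, F⟩ = O(‖F‖²)` (`abs_sum_mapF_le`), and `⟨J, DF[ξ]⟩ = O(‖F‖ ‖ξ‖)`, so that `DF*
J = O(‖F‖)` (`abs_sum_diffF_le`). On the complement of `J`, `DF*` is bounded below near `Z_*`
(`exists_adjF_coercive`). Splitting `Y = y + tJ` and testing the regularized equation with `Y` and
with `J` gives `‖DF* Y‖ = O(‖F‖)` and `‖F‖ ‖Y‖ = O(‖F‖²)`. So the shift costs only second order, and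
the step `ξ` satisfies `DF[ξ] + F = O(‖F‖²)` (`exists_newton_step`).

The retraction agrees with `Z + ξ` to second order (`norm_retr_sub_le`), hence `‖F(R_Z(ξ))‖ =
O(‖F(Z)‖²)`; near `Z_*` the full step passes the `τ` test. Step lengths are `O(‖F‖)`, so one visit
close enough to `Z_*` traps the sequence, and summing the later steps gives `dist(Z_k, Z_*) =
O(‖F(Z_k)‖)`, although the zero need not be isolated (`quadratic_convergence_of_local`).

It remains to see `F(Z_*) = 0`. Since `∑ γ_k < ∞`, the squared residuals converge, whereas near a
noncritical point each late step would lower them by a fixed amount; so `F(Z_*)` is orthogonal to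
the range of `DF(Z_*)`, hence a multiple of `J`, and the eigenvalue `1` forces that multiple to
vanish (`mapF_eq_zero_of_const`). Finally, the Riemannian distance and the norm are equivalent near
`Z_*`. -/

namespace PDStIEP

variable {n s : ℕ}

/-! ### The Frobenius norm -/

lemma norm_sq_eq_sum (A : Mat n) : ‖A‖ ^ 2 = ∑ i, ∑ j, A i j ^ 2 := by
  rw [Matrix.frobenius_norm_def, ← Real.sqrt_eq_rpow, Real.sq_sqrt]
  · simp
  · positivity

lemma frob_self (A : Mat n) : frob A A = ‖A‖ ^ 2 := by
  rw [norm_sq_eq_sum, frob_eq_sum]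
  simp only [sq]

lemma frob_comm (A B : Mat n) : frob A B = frob B A := by
  simp only [frob_eq_sum, mul_comm]

lemma frob_add_right (A B C : Mat n) : frob A (B + C) = frob A B + frob A C := by
  simp [frob, mul_add]

lemma frob_smul_right (c : ℝ) (A B : Mat n) : frob A (c • B) = c * frob A B := by
  simp [frob]

lemma frob_sub_right (A B C : Mat n) : frob A (B - C) = frob A B - frob A C := by
  simp [frob, mul_sub]

lemma frob_add_left (A B C : Mat n) : frob (A + B) C = frob A C + frob B C := by
  simp [frob, add_mul]

lemma frob_smul_left (c : ℝ) (A B : Mat n) : frob (c • A) B = c * frob A B := by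
  simp [frob]

lemma frob_sub_left (A B C : Mat n) : frob (A - B) C = frob A C - frob B C := by
  simp [frob, sub_mul]

lemma abs_frob_le (A B : Mat n) : |frob A B| ≤ ‖A‖ * ‖B‖ := by
  refine abs_le_of_sq_le_sq ?_ (by positivity)
  rw [mul_pow, norm_sq_eq_sum, norm_sq_eq_sum, frob_eq_sum, ← Finset.sum_product',
    ← Finset.sum_product', ← Finset.sum_product']
  exact Finset.sum_mul_sq_le_sq_mul_sq _ _ _

lemma abs_apply_le (A : Mat n) (i j : Fin n) : |A i j| ≤ ‖A‖ := by
  refine abs_le_of_sq_le_sq ?_ (norm_nonneg _)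
  rw [norm_sq_eq_sum]
  refine (Finset.single_le_sum (f := fun j => A i j ^ 2) (fun j _ => sq_nonneg _)
    (Finset.mem_univ j)).trans ?_
  exact Finset.single_le_sum (f := fun i => ∑ j, A i j ^ 2)
    (fun i _ => Finset.sum_nonneg fun j _ => sq_nonneg _) (Finset.mem_univ i)

lemma norm_le_of_abs_apply_le {A : Mat n} {ε : ℝ} (hε : 0 ≤ ε) (h : ∀ i j, |A i j| ≤ ε) :
    ‖A‖ ≤ n * ε := by
  refine le_of_sq_le_sq ?_ (by positivity)
  rw [norm_sq_eq_sum]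
  calc ∑ i, ∑ j, A i j ^ 2 ≤ ∑ _i : Fin n, ∑ _j : Fin n, ε ^ 2 := by
        refine Finset.sum_le_sum fun i _ => Finset.sum_le_sum fun j _ => ?_
        exact sq_le_sq' (abs_le.1 (h i j)).1 (abs_le.1 (h i j)).2
    _ = (n * ε) ^ 2 := by simp; ring

lemma norm_of_orthogonal {Q : Mat n} (hQ : Qᵀ * Q = 1) : ‖Q‖ ≤ n := by
  refine le_of_sq_le_sq ?_ (by positivity)
  rw [← frob_self, frob, hQ]
  simp only [Matrix.trace_one, Fintype.card_fin]
  exact_mod_cast Nat.le_self_pow two_ne_zero n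

lemma continuous_apply_apply (i j : Fin n) : Continuous fun A : Mat n => A i j :=
  Continuous.matrix_elem continuous_id i j

/-! ### Tangent vectors and the metric -/

lemma norm_cPart_le (Z : Quad n) : ‖cPart Z‖ ≤ ‖Z‖ := norm_fst_le _
lemma norm_qPart_le (Z : Quad n) : ‖qPart Z‖ ≤ ‖Z‖ :=
  (norm_fst_le _).trans (norm_snd_le _)
lemma norm_wPart_le (Z : Quad n) : ‖wPart Z‖ ≤ ‖Z‖ :=
  (norm_fst_le _).trans ((norm_snd_le _).trans (norm_snd_le _))
lemma norm_vPart_le (Z : Quad n) : ‖vPart Z‖ ≤ ‖Z‖ :=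
  (norm_snd_le _).trans ((norm_snd_le _).trans (norm_snd_le _))

lemma norm_quad_le {Z : Quad n} {r : ℝ} (h1 : ‖cPart Z‖ ≤ r) (h2 : ‖qPart Z‖ ≤ r)
    (h3 : ‖wPart Z‖ ≤ r) (h4 : ‖vPart Z‖ ≤ r) : ‖Z‖ ≤ r :=
  norm_prod_le_iff.2 ⟨h1, norm_prod_le_iff.2 ⟨h2, norm_prod_le_iff.2 ⟨h3, h4⟩⟩⟩

/-- Points of `𝒵` whose positive entries are at least `m` and whose norm is at most `B`. -/
structure InRegion (s : ℕ) (m B : ℝ) (Z : Quad n) : Prop where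
  mem : Z ∈ setZ n s
  c_ge : ∀ i j, m ≤ cPart Z i j
  w_ge : ∀ i j, InI2 s i j → m ≤ wPart Z i j
  norm_le : ‖Z‖ ≤ B

/-- Source of uniformity: estimates for the metric, the retraction and the perturbed eigenvectors
take their constants from `m` and `B`, not from the individual point. -/
lemma exists_inRegion {Zs : Quad n} (hZ : Zs ∈ setZ n s) :
    ∃ m : ℝ, 0 < m ∧ ∃ B : ℝ, 1 ≤ B ∧
      ∀ᶠ Z in 𝓝 Zs, Z ∈ setZ n s → InRegion s m B Z := by
  obtain ⟨hC, hQ, hW, hV⟩ := hZ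
  have hpos : ∃ m : ℝ, 0 < m ∧ ∀ i j, m < cPart Zs i j ∧ (InI2 s i j → m < wPart Zs i j) := by
    have h : ∀ p : Fin n × Fin n, ∃ m : ℝ, 0 < m ∧ m < cPart Zs p.1 p.2 ∧
        (InI2 s p.1 p.2 → m < wPart Zs p.1 p.2) := by
      rintro ⟨i, j⟩
      by_cases hI : InI2 s i j
      · obtain ⟨m, h0, h1⟩ := exists_between (lt_min (hC.1 i j) (hW.2 i j hI))
        exact ⟨m, h0, h1.trans_le (min_le_left _ _), fun _ => h1.trans_le (min_le_right _ _)⟩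
      · obtain ⟨m, h0, h1⟩ := exists_between (hC.1 i j)
        exact ⟨m, h0, h1, fun h => absurd h hI⟩
    choose f h0 h1 h2 using h
    rcases isEmpty_or_nonempty (Fin n × Fin n) with he | he
    · exact ⟨1, one_pos, fun i j => (he.false (i, j)).elim⟩
    · obtain ⟨p, hp⟩ := Finite.exists_min f
      exact ⟨f p, h0 p, fun i j => ⟨(hp (i, j)).trans_lt (h1 (i, j)),
        fun h => (hp (i, j)).trans_lt (h2 (i, j) h)⟩⟩
  obtain ⟨m, hm, hmZ⟩ := hpos
  refine ⟨m, hm, ‖Zs‖ + 1, by linarith [norm_nonneg Zs], ?_⟩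
  have e1 : ∀ᶠ Z in 𝓝 Zs, ∀ i j, m < cPart Z i j := by
    refine Filter.eventually_all.2 fun i => Filter.eventually_all.2 fun j => ?_
    exact ((continuous_apply_apply i j).comp continuous_fst).continuousAt.eventually_const_lt
      (hmZ i j).1
  have e2 : ∀ᶠ Z in 𝓝 Zs, ∀ i j, InI2 s i j → m < wPart Z i j := by
    refine Filter.eventually_all.2 fun i => Filter.eventually_all.2 fun j => ?_
    refine Filter.eventually_imp_distrib_left.2 fun h => ?_
    exact ((continuous_apply_apply i j).comp (continuous_fst.comp
      (continuous_snd.comp continuous_snd))).continuousAt.eventually_const_lt ((hmZ i j).2 h)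
  have e3 : ∀ᶠ Z in 𝓝 Zs, ‖Z‖ < ‖Zs‖ + 1 :=
    continuous_norm.continuousAt.eventually_lt_const (by linarith)
  filter_upwards [e1, e2, e3] with Z h1 h2 h3 hZ
  exact ⟨hZ, fun i j => (h1 i j).le, fun i j h => (h2 i j h).le, h3.le⟩

lemma metric_self_nonneg {Z : Quad n} (hZ : Z ∈ setZ n s) (ξ : Quad n) :
    0 ≤ metric s Z ξ ξ := by
  obtain ⟨hC, hQ, hW, hV⟩ := hZ
  have h1 : 0 ≤ ∑ i, ∑ j, cPart ξ i j * cPart ξ i j / cPart Z i j :=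
    Finset.sum_nonneg fun i _ => Finset.sum_nonneg fun j _ =>
      div_nonneg (mul_self_nonneg _) (hC.1 i j).le
  have h2 : 0 ≤ frob (qPart ξ) (qPart ξ) := by rw [frob_self]; positivity
  have h4 : 0 ≤ frob (vPart ξ) (vPart ξ) := by rw [frob_self]; positivity
  unfold metric
  refine add_nonneg (add_nonneg (add_nonneg h1 h2) ?_) h4
  refine Finset.sum_nonneg fun i _ => Finset.sum_nonneg fun j _ => ?_
  split_ifs with h
  · exact div_nonneg (mul_self_nonneg _) (hW.2 i j h).le
  · exact le_rfl

open Classical in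
lemma metric_self_le {m B : ℝ} (hm : 0 < m) {Z : Quad n} (hZ : InRegion s m B Z) (ξ : Quad n) :
    metric s Z ξ ξ ≤ (2 / m + 2) * ‖ξ‖ ^ 2 := by
  have h1 : ∑ i, ∑ j, cPart ξ i j * cPart ξ i j / cPart Z i j ≤ ‖ξ‖ ^ 2 / m := by
    calc _ ≤ ∑ i, ∑ j, cPart ξ i j ^ 2 / m := by
          refine Finset.sum_le_sum fun i _ => Finset.sum_le_sum fun j _ => ?_
          rw [← sq]
          exact div_le_div_of_nonneg_left (sq_nonneg _) hm (hZ.c_ge i j)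
      _ = ‖cPart ξ‖ ^ 2 / m := by simp only [norm_sq_eq_sum, Finset.sum_div]
      _ ≤ _ := by gcongr; exact norm_cPart_le ξ
  have h3 : (∑ i, ∑ j, if InI2 s i j then wPart ξ i j * wPart ξ i j / wPart Z i j else 0)
      ≤ ‖ξ‖ ^ 2 / m := by
    calc _ ≤ ∑ i, ∑ j, wPart ξ i j ^ 2 / m := by
          refine Finset.sum_le_sum fun i _ => Finset.sum_le_sum fun j _ => ?_
          split_ifs with h
          · rw [← sq]
            exact div_le_div_of_nonneg_left (sq_nonneg _) hm (hZ.w_ge i j h)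
          · positivity
      _ = ‖wPart ξ‖ ^ 2 / m := by simp only [norm_sq_eq_sum, Finset.sum_div]
      _ ≤ _ := by gcongr; exact norm_wPart_le ξ
  have h2 : frob (qPart ξ) (qPart ξ) ≤ ‖ξ‖ ^ 2 := by
    rw [frob_self]; gcongr; exact norm_qPart_le ξ
  have h4 : frob (vPart ξ) (vPart ξ) ≤ ‖ξ‖ ^ 2 := by
    rw [frob_self]; gcongr; exact norm_vPart_le ξ
  calc metric s Z ξ ξ ≤ ‖ξ‖ ^ 2 / m + ‖ξ‖ ^ 2 + ‖ξ‖ ^ 2 / m + ‖ξ‖ ^ 2 := by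
        unfold metric
        exact add_le_add (add_le_add (add_le_add h1 h2) h3) h4
    _ = _ := by ring

-- The metric ignores entries of the `W`-component outside `ℐ`; tangency makes them vanish. The
-- Fisher weights are at least `1 / B`, and `1 ≤ B` covers the unweighted components.
open Classical in
lemma norm_sq_le_metric {m B : ℝ} (hm : 0 < m) (hB : 1 ≤ B) {Z : Quad n}
    (hZ : InRegion s m B Z) {ξ : Quad n} (hξ : ξ ∈ tangent s Z) :
    ‖ξ‖ ^ 2 ≤ B * metric s Z ξ ξ := by
  have hB0 : 0 < B := by linarith
  have h1 : ‖cPart ξ‖ ^ 2 ≤ B * ∑ i, ∑ j, cPart ξ i j * cPart ξ i j / cPart Z i j := by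
    rw [norm_sq_eq_sum, Finset.mul_sum]
    refine Finset.sum_le_sum fun i _ => ?_
    rw [Finset.mul_sum]
    refine Finset.sum_le_sum fun j _ => ?_
    have hc := hm.trans_le (hZ.c_ge i j)
    have hcB : cPart Z i j ≤ B :=
      (le_abs_self _).trans ((abs_apply_le _ i j).trans ((norm_cPart_le Z).trans hZ.norm_le))
    rw [mul_div_assoc', le_div_iff₀ hc, ← sq, mul_comm]
    gcongr
  have h3 : ‖wPart ξ‖ ^ 2 ≤
      B * ∑ i, ∑ j, if InI2 s i j then wPart ξ i j * wPart ξ i j / wPart Z i j else 0 := by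
    rw [norm_sq_eq_sum, Finset.mul_sum]
    refine Finset.sum_le_sum fun i _ => ?_
    rw [Finset.mul_sum]
    refine Finset.sum_le_sum fun j _ => ?_
    split_ifs with h
    · have hc := hm.trans_le (hZ.w_ge i j h)
      have hcB : wPart Z i j ≤ B :=
        (le_abs_self _).trans ((abs_apply_le _ i j).trans ((norm_wPart_le Z).trans hZ.norm_le))
      rw [mul_div_assoc', le_div_iff₀ hc, ← sq, mul_comm]
      gcongr
    · rw [hξ.2.2.1 i j h]
      simp
  have h2 : ‖qPart ξ‖ ^ 2 ≤ B * frob (qPart ξ) (qPart ξ) := by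
    rw [frob_self]; exact le_mul_of_one_le_left (sq_nonneg _) hB
  have h4 : ‖vPart ξ‖ ^ 2 ≤ B * frob (vPart ξ) (vPart ξ) := by
    rw [frob_self]; exact le_mul_of_one_le_left (sq_nonneg _) hB
  have n1 := (sq_nonneg _).trans h1
  have n2 := (sq_nonneg _).trans h2
  have n3 := (sq_nonneg _).trans h3
  have n4 := (sq_nonneg _).trans h4
  have hsum : ∀ {x : Mat n}, ‖x‖ ^ 2 ≤ B * metric s Z ξ ξ → ‖x‖ ≤ √(B * metric s Z ξ ξ) :=
    fun h => Real.le_sqrt_of_sq_le h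
  have hM : B * metric s Z ξ ξ = B * (∑ i, ∑ j, cPart ξ i j * cPart ξ i j / cPart Z i j) +
      B * frob (qPart ξ) (qPart ξ) +
      B * (∑ i, ∑ j, if InI2 s i j then wPart ξ i j * wPart ξ i j / wPart Z i j else 0) +
      B * frob (vPart ξ) (vPart ξ) := by simp only [metric, mul_add]
  have := norm_quad_le (Z := ξ) (hsum (by linarith)) (hsum (by linarith)) (hsum (by linarith))
    (hsum (by linarith))
  calc ‖ξ‖ ^ 2 ≤ √(B * metric s Z ξ ξ) ^ 2 := by gcongr
    _ = _ := Real.sq_sqrt (mul_nonneg hB0.le (metric_self_nonneg hZ.mem ξ))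

/-- The norm on the tangent space given by the metric. -/
noncomputable def mnorm (s : ℕ) (Z ξ : Quad n) : ℝ := √(metric s Z ξ ξ)

lemma mnorm_nonneg (Z ξ : Quad n) : 0 ≤ mnorm s Z ξ := Real.sqrt_nonneg _

lemma mnorm_sq {Z : Quad n} (hZ : Z ∈ setZ n s) (ξ : Quad n) :
    mnorm s Z ξ ^ 2 = metric s Z ξ ξ := Real.sq_sqrt (metric_self_nonneg hZ ξ)

lemma abs_metric_le (Z : Pt n s) (ξ ζ : tangent s (Z : Quad n)) :
    |metric s (Z : Quad n) ξ ζ| ≤ mnorm s (Z : Quad n) ξ * mnorm s (Z : Quad n) ζ := by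
  refine abs_le_of_sq_le_sq ?_ (mul_nonneg (mnorm_nonneg _ _) (mnorm_nonneg _ _))
  rw [mul_pow, mnorm_sq Z.2, mnorm_sq Z.2]
  exact LinearMap.BilinForm.apply_sq_le_of_symm (metricForm s (Z : Quad n))
    (fun x => metric_self_nonneg Z.2 x)
    ⟨fun x y => metricForm_isSymm s (Z : Quad n) x y⟩ ξ ζ

lemma mnorm_le {m B : ℝ} (hm : 0 < m) {Z : Quad n} (hZ : InRegion s m B Z) (ξ : Quad n) :
    mnorm s Z ξ ≤ √(2 / m + 2) * ‖ξ‖ := by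
  refine (Real.sqrt_le_sqrt (metric_self_le hm hZ ξ)).trans_eq ?_
  rw [Real.sqrt_mul (by positivity), Real.sqrt_sq (norm_nonneg _)]

lemma norm_le_mnorm {m B : ℝ} (hm : 0 < m) (hB : 1 ≤ B) {Z : Quad n}
    (hZ : InRegion s m B Z) {ξ : Quad n} (hξ : ξ ∈ tangent s Z) :
    ‖ξ‖ ≤ √B * mnorm s Z ξ := by
  rw [mnorm, ← Real.sqrt_mul (by linarith)]
  exact Real.le_sqrt_of_sq_le (norm_sq_le_metric hm hB hZ hξ)

lemma metric_adjF (lam : Fin n → ℂ) (Z : Pt n s) (Y : Mat n) (ξ : tangent s (Z : Quad n)) :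
    metric s (Z : Quad n) (adjF lam Z Y) ξ = frob Y (diffF s lam (Z : Quad n) ξ) :=
  metricForm_adjF lam Z Y ξ

/-! ### The QR decomposition -/

/-- Gram–Schmidt on the columns; a diagonal entry of `R` is the norm of an orthogonalized column,
hence positive. -/
lemma exists_isQFactor {M : Mat n} (hM : M.det ≠ 0) : ∃ Q, IsQFactor M Q := by
  let f : Fin n → EuclideanSpace ℝ (Fin n) := fun j => WithLp.toLp 2 (M.col j)
  have hf : LinearIndependent ℝ f := by
    have h := Matrix.linearIndependent_cols_of_det_ne_zero hM
    exact h.map' (WithLp.linearEquiv 2 ℝ (Fin n → ℝ)).symm.toLinearMap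
      (LinearMap.ker_eq_bot.2 (WithLp.linearEquiv 2 ℝ (Fin n → ℝ)).symm.injective)
  have hc : Module.finrank ℝ (EuclideanSpace ℝ (Fin n)) = Fintype.card (Fin n) := by simp
  let b := InnerProductSpace.gramSchmidtOrthonormalBasis hc f
  have hb : ∀ i, b i = InnerProductSpace.gramSchmidtNormed ℝ f i := fun i =>
    InnerProductSpace.gramSchmidtOrthonormalBasis_apply hc
      (norm_ne_zero_iff.1 (by rw [InnerProductSpace.gramSchmidtNormed_unit_length i hf]; simp))
  refine ⟨Matrix.of fun i j => b j i, ?_, Matrix.of fun i j => inner ℝ (b i) (f j), ?_, ?_, ?_⟩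
  · ext i j
    have h := b.inner_eq_ite i j
    simp only [PiLp.inner_apply, RCLike.inner_apply, conj_trivial] at h
    simp only [Matrix.mul_apply, Matrix.transpose_apply, Matrix.of_apply, Matrix.one_apply, ← h]
    exact Finset.sum_congr rfl fun k _ => mul_comm _ _
  · intro i j hij
    exact InnerProductSpace.gramSchmidtOrthonormalBasis_inv_triangular hc f hij
  · intro i
    have h0 := InnerProductSpace.gramSchmidt_ne_zero (𝕜 := ℝ) i hf
    have h1 : inner ℝ (InnerProductSpace.gramSchmidt ℝ f i) (f i)
        = ‖InnerProductSpace.gramSchmidt ℝ f i‖ ^ 2 := by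
      conv_lhs => rw [InnerProductSpace.gramSchmidt_def'' ℝ f i]
      rw [inner_add_right, inner_sum, real_inner_self_eq_norm_sq, Finset.sum_eq_zero, add_zero]
      intro k hk
      rw [inner_smul_right, InnerProductSpace.gramSchmidt_orthogonal ℝ f
        (Finset.mem_Iio.1 hk).ne', mul_zero]
    change 0 < inner ℝ (b i) (f i)
    have h2 : 0 < ‖InnerProductSpace.gramSchmidt ℝ f i‖ := norm_pos_iff.2 h0
    rw [hb, InnerProductSpace.gramSchmidtNormed, inner_smul_left, h1]
    simp only [RCLike.ofReal_real_eq_id, id_eq, map_inv₀, conj_trivial]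
    positivity
  · ext i j
    have h := congrArg (fun v : EuclideanSpace ℝ (Fin n) => v i) (b.sum_repr' (f j))
    simp only [WithLp.ofLp_sum, WithLp.ofLp_smul, Finset.sum_apply, Pi.smul_apply,
      smul_eq_mul] at h
    simp only [Matrix.mul_apply, Matrix.of_apply]
    rw [show M i j = f j i from rfl, ← h]
    exact Finset.sum_congr rfl fun k _ => mul_comm _ _

/-- Here `L = R⁻ᵀ` is lower triangular with reciprocal diagonal. Above the diagonal `R - 1` and `R -
L` coincide, below it `R - 1` vanishes, and on it `r - 1/r = (r - 1)(1 + 1/r)` dominates `r - 1`. -/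
lemma norm_upper_sub_one_le {R L : Mat n} (hR : ∀ i j, j < i → R i j = 0)
    (hpos : ∀ i, 0 < R i i) (hL : Rᵀ * L = 1) : ‖R - 1‖ ≤ n * ‖R - L‖ := by
  have hdet : R.det ≠ 0 := by
    rw [Matrix.det_of_isUpperTriangular (fun i j h => hR i j h)]
    exact (Finset.prod_pos fun i _ => hpos i).ne'
  have hLR : Lᵀ * R = 1 := by
    rw [← Matrix.transpose_transpose R, ← Matrix.transpose_mul, hL, Matrix.transpose_one]
  have hinv : R⁻¹ = Lᵀ := Matrix.inv_eq_left_inv hLR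
  let _ := Matrix.invertibleOfIsUnitDet R (Ne.isUnit hdet)
  have hlow : ∀ i j, i < j → L i j = 0 := by
    have h : Matrix.BlockTriangular R⁻¹ (id : Fin n → Fin n) :=
      Matrix.blockTriangular_inv_of_blockTriangular fun i j h => hR i j h
    intro i j hij
    have := h (i := j) (j := i) hij
    rwa [hinv] at this
  have hdiag : ∀ i, R i i * L i i = 1 := by
    intro i
    have h := congrFun (congrFun hL i) i
    rw [Matrix.mul_apply, Finset.sum_eq_single i] at h
    · simpa using h
    · intro k _ hk
      rcases lt_or_gt_of_ne hk with hk | hk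
      · rw [hlow k i hk, mul_zero]
      · rw [Matrix.transpose_apply, hR k i hk, zero_mul]
    · simp
  refine norm_le_of_abs_apply_le (norm_nonneg _) fun i j => le_trans ?_ (abs_apply_le (R - L) i j)
  simp only [Matrix.sub_apply]
  rcases lt_trichotomy i j with h | h | h
  · rw [hlow i j h, Matrix.one_apply_ne h.ne]
  · subst h
    rw [Matrix.one_apply_eq]
    have h0 := hpos i
    have h1 : L i i = 1 / R i i := by rw [eq_div_iff h0.ne', mul_comm]; exact hdiag i
    have h2 : R i i - L i i = (R i i - 1) * (1 + 1 / R i i) := by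
      rw [h1]; field_simp; ring
    rw [h2, abs_mul]
    refine le_mul_of_one_le_right (abs_nonneg _) ((le_abs_self _).trans' ?_)
    have : 0 < 1 / R i i := by positivity
    linarith
  · rw [hR i j h, Matrix.one_apply_ne h.ne']
    simp

/-- For skew `K` the Gram matrix of `Q + QK` is `1 - K²`, without a linear term. With `L = R⁻ᵀ` this
reads `R - L = -L K²`, so the triangular factor is `1` up to second order. -/
lemma norm_isQFactor_sub_le {Q K Q' : Mat n} (hQ : Qᵀ * Q = 1) (hK : Kᵀ = -K) (hK1 : ‖K‖ ≤ 1 / 2)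
    (h : IsQFactor (Q + Q * K) Q') :
    ‖Q' - (Q + Q * K)‖ ≤ 2 * (n : ℝ) ^ 4 * (n + 1) * ‖K‖ ^ 2 := by
  obtain ⟨hQ', R, hR, hpos, hM⟩ := h
  have hdet : R.det ≠ 0 := by
    rw [Matrix.det_of_isUpperTriangular (fun i j h => hR i j h)]
    exact (Finset.prod_pos fun i _ => hpos i).ne'
  set L : Mat n := (Rᵀ)⁻¹
  have hdetT : IsUnit Rᵀ.det := by rw [Matrix.det_transpose]; exact hdet.isUnit
  have hL : Rᵀ * L = 1 := Matrix.mul_nonsing_inv _ hdetT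
  have hL' : L * Rᵀ = 1 := Matrix.nonsing_inv_mul _ hdetT
  have hRR : Rᵀ * R = 1 - K * K := by
    calc Rᵀ * R = Rᵀ * (Q'ᵀ * Q') * R := by rw [hQ', mul_one]
      _ = (Q' * R)ᵀ * (Q' * R) := by simp only [Matrix.transpose_mul, mul_assoc]
      _ = (Q + Q * K)ᵀ * (Q + Q * K) := by rw [hM]
      _ = (1 - K) * (Qᵀ * Q) * (1 + K) := by
          simp only [Matrix.transpose_add, Matrix.transpose_mul, hK]; noncomm_ring
      _ = _ := by rw [hQ]; noncomm_ring
  have hG : R - L = -(L * (K * K)) := by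
    have : L * (Rᵀ * R - 1) = -(L * (K * K)) := by rw [hRR]; noncomm_ring
    rw [← this, mul_sub, ← mul_assoc, hL', one_mul, mul_one]
  have h1 : ‖(1 : Mat n)‖ ≤ n := norm_of_orthogonal (by simp)
  have hRn : ‖R‖ ≤ n * (n * (n + 1)) := by
    have : R = Q'ᵀ * (Q * (1 + K)) := by
      rw [mul_add, mul_one, hM, ← mul_assoc, hQ', one_mul]
    rw [this]
    refine (norm_mul_le _ _).trans ?_
    rw [Matrix.frobenius_norm_transpose]
    gcongr
    · exact norm_of_orthogonal hQ'
    · refine (norm_mul_le _ _).trans ?_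
      gcongr
      · exact norm_of_orthogonal hQ
      · exact (norm_add_le _ _).trans (add_le_add h1 (by linarith))
  have hGn : ‖R - L‖ ≤ ‖L‖ * ‖K‖ ^ 2 := by
    rw [hG, norm_neg, sq]
    exact (norm_mul_le _ _).trans (by gcongr; exact norm_mul_le _ _)
  -- The bound for `R - L` involves `‖L‖` itself; it is absorbed because `‖K‖² ≤ 1/4`.
  have hLn : ‖L‖ ≤ 2 * (n * (n * (n + 1))) := by
    have e : ‖L‖ ≤ ‖R‖ + ‖R - L‖ := by
      calc ‖L‖ = ‖R - (R - L)‖ := by congr 1; abel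
        _ ≤ _ := norm_sub_le _ _
    have e2 : ‖K‖ ^ 2 ≤ 1 / 4 := by nlinarith [norm_nonneg K]
    nlinarith [norm_nonneg L, mul_le_mul_of_nonneg_left e2 (norm_nonneg L)]
  have hS := norm_upper_sub_one_le hR hpos hL
  rw [hM, show Q' - Q' * R = -(Q' * (R - 1)) by noncomm_ring, norm_neg]
  calc ‖Q' * (R - 1)‖ ≤ n * (n * (2 * (n * (n * (n + 1))) * ‖K‖ ^ 2)) := by
        refine (norm_mul_le _ _).trans ?_
        gcongr
        · exact norm_of_orthogonal hQ'
        · refine hS.trans ?_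
          gcongr
          exact hGn.trans (by gcongr)
    _ = _ := by ring

/-! ### Sinkhorn scaling -/

/-- The potential whose critical points `(u, v)` give the scalings `e^u, e^v` of `X`. -/
noncomputable def sinkPot (X : Mat n) (p : (Fin n → ℝ) × (Fin n → ℝ)) : ℝ :=
  (∑ i, ∑ j, X i j * Real.exp (p.1 i + p.2 j)) - ∑ i, p.1 i - ∑ j, p.2 j

lemma continuous_sinkPot (X : Mat n) : Continuous (sinkPot X) := by
  unfold sinkPot
  fun_prop

/-- The scaling pair is determined only up to `(c x, c⁻¹ y)`; this symmetry obstructs coercivity and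
is divided out by a normalization. -/
lemma sinkPot_shift (X : Mat n) (p : (Fin n → ℝ) × (Fin n → ℝ)) (c : ℝ) :
    sinkPot X (fun i => p.1 i + c, fun j => p.2 j - c) = sinkPot X p := by
  have h : ∀ i j, p.1 i + c + (p.2 j - c) = p.1 i + p.2 j := fun i j => by ring
  simp only [sinkPot, h, Finset.sum_add_distrib, Finset.sum_sub_distrib]
  ring

/-- Spreading the linear terms evenly over rows and columns leaves one function of `p.1 i + p.2 j`
per entry, so coercivity can be checked entry by entry. -/
lemma sinkPot_eq_sum (X : Mat n) (hn : 0 < n) (p : (Fin n → ℝ) × (Fin n → ℝ)) :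
    sinkPot X p
      = ∑ i, ∑ j, (X i j * Real.exp (p.1 i + p.2 j) - (p.1 i + p.2 j) / n) := by
  have hn' : (n : ℝ) ≠ 0 := by exact_mod_cast hn.ne'
  simp only [sinkPot, Finset.sum_sub_distrib, add_div, Finset.sum_add_distrib, Finset.sum_const,
    Finset.card_univ, Fintype.card_fin, nsmul_eq_mul, ← Finset.mul_sum, ← Finset.sum_div]
  field_simp
  ring

/-- For `w ≥ 0`, `m e^w` lies above its tangent line of slope `2 / n`, which touches at `w = log (2
/ (n m))`; subtracting `w / n` leaves slope `1 / n`. For `w < 0` the linear term suffices. -/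
lemma mul_exp_sub_ge {n : ℕ} (hn : 0 < n) {m x : ℝ} (hm : 0 < m) (hx : m ≤ x) (w : ℝ) :
    |w| / n - 2 / n * |1 - Real.log (2 / (n * m))| ≤ x * Real.exp w - w / n := by
  have hn' : (0 : ℝ) < n := by exact_mod_cast hn
  set a := Real.log (2 / (n * m))
  have hc : 0 ≤ 2 / (n : ℝ) * |1 - a| := by positivity
  have h1 : m * Real.exp w ≤ x * Real.exp w := by gcongr
  rcases abs_cases w with ⟨h, _⟩ | ⟨h, _⟩
  · have h2 : 2 / (n : ℝ) * (1 + (w - a)) ≤ m * Real.exp w := by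
      have h3 : Real.exp w = 2 / (n * m) * Real.exp (w - a) := by
        rw [Real.exp_sub, Real.exp_log (by positivity)]
        field_simp
      have h4 := Real.add_one_le_exp (w - a)
      rw [h3, ← mul_assoc, show m * (2 / (n * m)) = 2 / (n : ℝ) by field_simp]
      gcongr
      linarith
    have h5 : 2 / (n : ℝ) * -|1 - a| ≤ 2 / (n : ℝ) * (1 - a) := by
      gcongr; exact neg_abs_le _
    have h6 : 2 / (n : ℝ) * (1 + (w - a)) = 2 / (n : ℝ) * (1 - a) + 2 * (w / n) := by ring
    rw [h]
    linarith
  · have h2 : 0 ≤ x * Real.exp w := mul_nonneg (hm.le.trans hx) (Real.exp_pos _).le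
    rw [h, neg_div]
    linarith

lemma exists_min_sinkPot {X : Mat n} (hn : 0 < n) (hX : ∀ i j, 0 < X i j) :
    ∃ p, ∀ q, sinkPot X p ≤ sinkPot X q := by
  have hn' : (0 : ℝ) < n := by exact_mod_cast hn
  let i0 : Fin n := ⟨0, hn⟩
  obtain ⟨m, hm, hmX⟩ : ∃ m : ℝ, 0 < m ∧ ∀ i j, m ≤ X i j := by
    have : Nonempty (Fin n × Fin n) := ⟨(i0, i0)⟩
    obtain ⟨p, hp⟩ := Finite.exists_min fun p : Fin n × Fin n => X p.1 p.2
    exact ⟨X p.1 p.2, hX _ _, fun i j => hp (i, j)⟩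
  set c := 2 / (n : ℝ) * |1 - Real.log (2 / (n * m))|
  set R := n * (sinkPot X 0 + n * (n * c))
  have hw : ∀ p, sinkPot X p ≤ sinkPot X 0 → ∀ i j, |p.1 i + p.2 j| ≤ R := by
    intro p hp i j
    have h1 : ∑ i, ∑ j, (|p.1 i + p.2 j| / n - c) ≤ sinkPot X 0 := by
      refine le_trans ?_ hp
      rw [sinkPot_eq_sum X hn]
      exact Finset.sum_le_sum fun i _ => Finset.sum_le_sum fun j _ =>
        mul_exp_sub_ge hn hm (hmX i j) _
    have h2 : |p.1 i + p.2 j| / n ≤ ∑ i, ∑ j, |p.1 i + p.2 j| / n := by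
      refine (Finset.single_le_sum (f := fun j => |p.1 i + p.2 j| / n) (fun j _ => by positivity)
        (Finset.mem_univ j)).trans ?_
      exact Finset.single_le_sum (f := fun i => ∑ j, |p.1 i + p.2 j| / n)
        (fun i _ => by positivity) (Finset.mem_univ i)
    simp only [Finset.sum_sub_distrib, Finset.sum_const, Finset.card_univ, Fintype.card_fin,
      nsmul_eq_mul] at h1
    rw [div_le_iff₀ hn'] at h2
    calc _ ≤ _ := h2
      _ ≤ (sinkPot X 0 + n * (n * c)) * n := by gcongr; linarith
      _ = R := mul_comm _ _
  -- A slice transversal to the shift symmetry: bounds on all sums `p.1 i + p.2 j` become bounds on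
  -- the coordinates.
  let S : Set ((Fin n → ℝ) × (Fin n → ℝ)) := {p | p.2 i0 = 0 ∧ sinkPot X p ≤ sinkPot X 0}
  have hS : IsCompact S := by
    refine Metric.isCompact_of_isClosed_isBounded ?_ ?_
    · exact (isClosed_eq (by fun_prop) continuous_const).inter
        (isClosed_le (continuous_sinkPot X) continuous_const)
    · refine (Metric.isBounded_iff_subset_closedBall 0).2 ⟨2 * R, fun p hp => ?_⟩
      have hR : 0 ≤ R := (abs_nonneg _).trans (hw p hp.2 i0 i0)
      have h1 : ∀ i, |p.1 i| ≤ R := fun i => by simpa [hp.1] using hw p hp.2 i i0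
      rw [mem_closedBall_zero_iff, norm_prod_le_iff, pi_norm_le_iff_of_nonneg (by positivity),
        pi_norm_le_iff_of_nonneg (by positivity)]
      refine ⟨fun i => (h1 i).trans (by linarith), fun j => ?_⟩
      calc |p.2 j| = |(p.1 i0 + p.2 j) - p.1 i0| := by congr 1; ring
        _ ≤ |p.1 i0 + p.2 j| + |p.1 i0| := abs_sub _ _
        _ ≤ 2 * R := by linarith [hw p hp.2 i0 j, h1 i0]
  obtain ⟨p, hp, hmin⟩ := hS.exists_isMinOn ⟨0, rfl, le_rfl⟩ (continuous_sinkPot X).continuousOn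
  refine ⟨p, fun q => ?_⟩
  rcases le_total (sinkPot X q) (sinkPot X 0) with h | h
  · have hs := sinkPot_shift X q (q.2 i0)
    rw [← hs]
    exact hmin ⟨sub_self _, hs.trans_le h⟩
  · exact hp.2.trans h

/-- First-order condition at `t = 0`. Moving one coordinate of a minimizer of `sinkPot` by `t` gives
exactly this inequality, with `r` the corresponding row or column sum. -/
lemma eq_one_of_forall_exp {r : ℝ} (h : ∀ t : ℝ, 0 ≤ (Real.exp t - 1) * r - t) : r = 1 := by
  have hd : HasDerivAt (fun t : ℝ => (Real.exp t - 1) * r - t) (Real.exp 0 * r - 1) 0 :=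
    (((Real.hasDerivAt_exp 0).sub_const 1).mul_const r).sub (hasDerivAt_id 0)
  have hm : IsLocalMin (fun t : ℝ => (Real.exp t - 1) * r - t) 0 :=
    Filter.Eventually.of_forall fun t => by simpa using h t
  have := hm.hasDerivAt_eq_zero hd
  simp at this
  linarith

lemma exists_isSinkhornScaling {X : Mat n} (hX : ∀ i j, 0 < X i j) :
    ∃ P, IsSinkhornScaling X P := by
  rcases Nat.eq_zero_or_pos n with rfl | hn
  · exact ⟨1, ⟨fun i => i.elim0, fun i => i.elim0, fun i => i.elim0⟩, 1, 1, fun i => i.elim0,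
      fun i => i.elim0, by ext i; exact i.elim0⟩
  obtain ⟨p, hp⟩ := exists_min_sinkPot hn hX
  have key : ∀ a b, (Matrix.diagonal (fun i => Real.exp (p.1 i)) * X *
      Matrix.diagonal (fun j => Real.exp (p.2 j))) a b = X a b * Real.exp (p.1 a + p.2 b) := by
    intro a b
    rw [Matrix.mul_diagonal, Matrix.diagonal_mul, Real.exp_add]
    ring
  refine ⟨_, ⟨fun i j => ?_, fun i => ?_, fun j => ?_⟩, fun i => Real.exp (p.1 i),
    fun j => Real.exp (p.2 j), fun i => Real.exp_pos _, fun j => Real.exp_pos _, rfl⟩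
  · rw [key]
    exact mul_pos (hX i j) (Real.exp_pos _)
  · simp only [key]
    refine eq_one_of_forall_exp fun t => ?_
    have h := hp (Function.update p.1 i (p.1 i + t), p.2)
    have e1 : ∑ k, Function.update p.1 i (p.1 i + t) k = ∑ k, p.1 k + t := by
      rw [Finset.sum_update_of_mem (Finset.mem_univ i),
        ← Finset.add_sum_erase _ _ (Finset.mem_univ i), Finset.sdiff_singleton_eq_erase]
      ring
    have e2 : ∑ k, ∑ j, X k j * Real.exp (Function.update p.1 i (p.1 i + t) k + p.2 j)
        = ∑ k, ∑ j, X k j * Real.exp (p.1 k + p.2 j)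
          + (Real.exp t - 1) * ∑ j, X i j * Real.exp (p.1 i + p.2 j) := by
      rw [← Finset.add_sum_erase _ _ (Finset.mem_univ i),
        ← Finset.add_sum_erase (a := i) (f := fun k => ∑ j, X k j * Real.exp (p.1 k + p.2 j)) _
          (Finset.mem_univ i)]
      have e3 : ∑ k ∈ Finset.univ.erase i,
            ∑ j, X k j * Real.exp (Function.update p.1 i (p.1 i + t) k + p.2 j)
          = ∑ k ∈ Finset.univ.erase i, ∑ j, X k j * Real.exp (p.1 k + p.2 j) :=
        Finset.sum_congr rfl fun k hk => by
          rw [Function.update_of_ne (Finset.ne_of_mem_erase hk)]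
      have e4 : ∀ j, X i j * Real.exp (Function.update p.1 i (p.1 i + t) i + p.2 j)
          = Real.exp t * (X i j * Real.exp (p.1 i + p.2 j)) := fun j => by
        rw [Function.update_self, show p.1 i + t + p.2 j = t + (p.1 i + p.2 j) by ring,
          Real.exp_add]
        ring
      simp only [e3, e4, ← Finset.mul_sum]
      ring
    simp only [sinkPot, e1, e2] at h
    linarith
  · simp only [key]
    refine eq_one_of_forall_exp fun t => ?_
    have h := hp (p.1, Function.update p.2 j (p.2 j + t))
    have e1 : ∑ k, Function.update p.2 j (p.2 j + t) k = ∑ k, p.2 k + t := by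
      rw [Finset.sum_update_of_mem (Finset.mem_univ j),
        ← Finset.add_sum_erase _ _ (Finset.mem_univ j), Finset.sdiff_singleton_eq_erase]
      ring
    have e2 : ∑ i, ∑ k, X i k * Real.exp (p.1 i + Function.update p.2 j (p.2 j + t) k)
        = ∑ i, ∑ k, X i k * Real.exp (p.1 i + p.2 k)
          + (Real.exp t - 1) * ∑ i, X i j * Real.exp (p.1 i + p.2 j) := by
      rw [Finset.mul_sum, ← Finset.sum_add_distrib]
      refine Finset.sum_congr rfl fun i _ => ?_
      rw [← Finset.add_sum_erase _ _ (Finset.mem_univ j),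
        ← Finset.add_sum_erase (a := j) (f := fun k => X i k * Real.exp (p.1 i + p.2 k)) _
          (Finset.mem_univ j)]
      rw [Finset.sum_congr rfl fun k hk => ?_]
      · rw [Function.update_self, show p.1 i + (p.2 j + t) = t + (p.1 i + p.2 j) by ring,
            Real.exp_add]
        ring
      · rw [Function.update_of_ne (Finset.ne_of_mem_erase hk)]
    simp only [sinkPot, e1, e2] at h
    linarith

/-- Strong monotonicity of `exp`, quadratic near `0` and linear at infinity, so no a priori bound on
`w` is needed. -/
lemma sq_div_le_exp_sub_one_mul (w : ℝ) : w ^ 2 / (1 + |w|) ≤ (Real.exp w - 1) * w := by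
  rcases abs_cases w with ⟨h, h0⟩ | ⟨h, h0⟩ <;> rw [h]
  · rw [div_le_iff₀ (by linarith)]
    nlinarith [Real.add_one_le_exp w, mul_nonneg h0 (by linarith [Real.add_one_le_exp w] :
      0 ≤ Real.exp w - 1 - w), mul_nonneg h0 (mul_nonneg h0 (by linarith [Real.add_one_le_exp w] :
      0 ≤ Real.exp w - 1))]
  · rw [div_le_iff₀ (by linarith)]
    have h1 : Real.exp w * (1 - w) ≤ 1 := by
      have h2 := Real.add_one_le_exp (-w)
      calc Real.exp w * (1 - w) ≤ Real.exp w * Real.exp (-w) := by gcongr; linarith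
        _ = 1 := by rw [← Real.exp_add]; simp
    nlinarith

/-- Write `P = X e^w` entrywise with `w a b = log x_a + log y_b`. As `w` splits into a row and a
column part, `∑ (P - X) w` sees only the marginal defects of `X` and is at most `3 n ε max |w|`;
each term is also at least `m w² / (1 + |w|)`. Comparing bounds `max |w|`. The argument applies to
any scaling, so uniqueness is not needed. -/
lemma abs_sinkhornScaling_sub_le {X P : Mat n} (h : IsSinkhornScaling X P) {m ε : ℝ} (hm : 0 < m)
    (hX : ∀ i j, m ≤ X i j) (hr : ∀ i, |∑ j, X i j - 1| ≤ ε) (hc : ∀ j, |∑ i, X i j - 1| ≤ ε)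
    (hε : 3 * n * ε / m ≤ 1 / 2) (i j : Fin n) :
    |P i j - X i j| ≤ X i j * (4 * (3 * n * ε / m)) := by
  obtain ⟨⟨hP0, hPr, hPc⟩, x, y, hx, hy, hP⟩ := h
  have hε0 : 0 ≤ ε := (abs_nonneg _).trans (hr i)
  set κ := 3 * n * ε / m
  let w : Fin n → Fin n → ℝ := fun a b => Real.log (x a) + Real.log (y b)
  have hPw : ∀ a b, P a b = X a b * Real.exp (w a b) := by
    intro a b
    rw [hP, Matrix.mul_diagonal, Matrix.diagonal_mul, Real.exp_add, Real.exp_log (hx a),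
      Real.exp_log (hy b)]
    ring
  obtain ⟨⟨a0, b0⟩, hmax⟩ : ∃ p : Fin n × Fin n, ∀ q : Fin n × Fin n, |w q.1 q.2| ≤ |w p.1 p.2| :=
    have : Nonempty (Fin n × Fin n) := ⟨(i, j)⟩
    Finite.exists_max fun p : Fin n × Fin n => |w p.1 p.2|
  set W := |w a0 b0|
  have hW : ∀ a b, |w a b| ≤ W := fun a b => hmax (a, b)
  -- Splitting relative to the base index `i`, so that `|u| ≤ W` and `|v| ≤ 2 W`; together they give
  -- the factor `3`.
  let u : Fin n → ℝ := fun a => w a i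
  let v : Fin n → ℝ := fun b => w i b - w i i
  have hwuv : ∀ a b, w a b = u a + v b := fun a b => by simp only [w, u, v]; ring
  have hsum : ∑ a, ∑ b, (P a b - X a b) * w a b
      = ∑ a, u a * (1 - ∑ b, X a b) + ∑ b, v b * (1 - ∑ a, X a b) := by
    have e1 : ∀ a, u a * (1 - ∑ b, X a b) = ∑ b, (P a b - X a b) * u a := fun a => by
      rw [← Finset.sum_mul, Finset.sum_sub_distrib, hPr, mul_comm]
    have e2 : ∀ b, v b * (1 - ∑ a, X a b) = ∑ a, (P a b - X a b) * v b := fun b => by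
      rw [← Finset.sum_mul, Finset.sum_sub_distrib, hPc, mul_comm]
    simp only [e1, e2]
    rw [Finset.sum_comm (f := fun b a => (P a b - X a b) * v b)]
    simp only [← Finset.sum_add_distrib, hwuv, mul_add]
  have hW0 : 0 ≤ W := abs_nonneg _
  have hup : ∑ a, ∑ b, (P a b - X a b) * w a b ≤ 3 * n * ε * W := by
    rw [hsum]
    have b1 : ∑ a, u a * (1 - ∑ b, X a b) ≤ ∑ _a : Fin n, W * ε := by
      refine Finset.sum_le_sum fun a _ => (le_abs_self _).trans ?_
      rw [abs_mul, abs_sub_comm]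
      exact mul_le_mul (hW a i) (hr a) (abs_nonneg _) hW0
    have b2 : ∑ b, v b * (1 - ∑ a, X a b) ≤ ∑ _b : Fin n, (2 * W) * ε := by
      refine Finset.sum_le_sum fun b _ => (le_abs_self _).trans ?_
      rw [abs_mul, abs_sub_comm 1]
      refine mul_le_mul ((abs_sub _ _).trans ?_) (hc b) (abs_nonneg _) (by positivity)
      linarith [hW i b, hW i i]
    simp only [Finset.sum_const, Finset.card_univ, Fintype.card_fin, nsmul_eq_mul] at b1 b2
    linarith
  have hlow : m * (W ^ 2 / (1 + W)) ≤ ∑ a, ∑ b, (P a b - X a b) * w a b := by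
    have hterm : ∀ a b, m * (w a b ^ 2 / (1 + |w a b|)) ≤ (P a b - X a b) * w a b := fun a b => by
      rw [hPw, show (X a b * Real.exp (w a b) - X a b) * w a b
        = X a b * ((Real.exp (w a b) - 1) * w a b) by ring]
      exact mul_le_mul (hX a b) (sq_div_le_exp_sub_one_mul _) (by positivity)
        (hm.le.trans (hX a b))
    have hnn : ∀ a b, 0 ≤ (P a b - X a b) * w a b := fun a b =>
      (hterm a b).trans' (by positivity)
    calc m * (W ^ 2 / (1 + W)) = m * (w a0 b0 ^ 2 / (1 + |w a0 b0|)) := by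
          simp only [W, sq_abs]
      _ ≤ _ := hterm a0 b0
      _ ≤ ∑ b, (P a0 b - X a0 b) * w a0 b :=
          Finset.single_le_sum (f := fun b => (P a0 b - X a0 b) * w a0 b)
            (fun b _ => hnn a0 b) (Finset.mem_univ b0)
      _ ≤ _ := Finset.single_le_sum (f := fun a => ∑ b, (P a b - X a b) * w a b)
            (fun a _ => Finset.sum_nonneg fun b _ => hnn a b) (Finset.mem_univ a0)
  have hWκ : W ≤ 2 * κ := by
    have h1 : m * (W ^ 2 / (1 + W)) ≤ (m * κ) * W := by
      rw [show m * κ = 3 * n * ε by simp only [κ]; field_simp]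
      exact hlow.trans hup
    rcases hW0.eq_or_lt with h0 | h0
    · rw [← h0]; positivity
    have h2 : W ≤ κ * (1 + W) := by
      rw [mul_assoc] at h1
      have h3 := le_of_mul_le_mul_left h1 hm
      rw [div_le_iff₀ (by linarith)] at h3
      nlinarith
    nlinarith
  have h1 : |w i j| ≤ 2 * κ := (hW i j).trans hWκ
  have h2 : |Real.exp (w i j) - 1| ≤ 2 * |w i j| := Real.abs_exp_sub_one_le (by linarith)
  rw [hPw, show X i j * Real.exp (w i j) - X i j = X i j * (Real.exp (w i j) - 1) by ring, abs_mul,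
    abs_of_pos (hm.trans_le (hX i j))]
  have := hm.trans_le (hX i j)
  gcongr
  linarith

/-! ### Second order estimates for the retraction -/

lemma abs_mul_exp_div_sub_le {m c x r : ℝ} (hm : 0 < m) (hc : m ≤ c) (hx : |x| ≤ r) (hr : r ≤ m) :
    |c * Real.exp (x / c) - c - x| ≤ r ^ 2 / m := by
  have hc0 : 0 < c := hm.trans_le hc
  have h1 : |x / c| ≤ 1 := by
    rw [abs_div, abs_of_pos hc0, div_le_one hc0]
    linarith
  have h2 := Real.abs_exp_sub_one_sub_id_le h1
  calc |c * Real.exp (x / c) - c - x| = |c * (Real.exp (x / c) - 1 - x / c)| := by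
        congr 1; field_simp
    _ = c * |Real.exp (x / c) - 1 - x / c| := by rw [abs_mul, abs_of_pos hc0]
    _ ≤ c * (x / c) ^ 2 := by gcongr
    _ = x ^ 2 / c := by field_simp
    _ ≤ r ^ 2 / m := by
        have : x ^ 2 ≤ r ^ 2 := sq_le_sq' (abs_le.1 hx).1 (abs_le.1 hx).2
        gcongr

lemma apply_le_one_of_mem_DP {C : Mat n} (hC : C ∈ DP n) (i j : Fin n) : C i j ≤ 1 := by
  rw [← hC.2.1 i]
  exact Finset.single_le_sum (f := fun j => C i j) (fun j _ => (hC.1 i j).le) (Finset.mem_univ j)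

/-- The matrix `C ⊙ exp(ξ ⊘ C)` equals `C + ξ` up to `r² / m` per entry, and `C + ξ` has unit row
and column sums. So the marginal defects are of second order, and Sinkhorn scaling moves the matrix
by no more than that order. -/
lemma norm_cPart_retr_sub_le {C ξ : Mat n} {m : ℝ} (hm : 0 < m) (hC : C ∈ DP n)
    (hCm : ∀ i j, m ≤ C i j) (hr : ∀ i, ∑ j, ξ i j = 0) (hc : ∀ j, ∑ i, ξ i j = 0)
    {r : ℝ} (hξ : ‖ξ‖ ≤ r) (hrm : r ≤ m / (4 * (n + 1))) :
    ‖sinkhorn (Matrix.of fun i j => C i j * Real.exp (ξ i j / C i j)) - C - ξ‖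
      ≤ n * (1 / m + 48 * (n : ℝ) ^ 2 / m ^ 2) * r ^ 2 := by
  have hr0 : 0 ≤ r := (norm_nonneg _).trans hξ
  set X : Mat n := Matrix.of fun i j => C i j * Real.exp (ξ i j / C i j)
  have hn0 : (0 : ℝ) ≤ n := by positivity
  have hrm2 : r ≤ m / 2 := by
    refine hrm.trans ?_
    gcongr
    linarith
  have hE : ∀ i j, |X i j - C i j - ξ i j| ≤ r ^ 2 / m := fun i j =>
    abs_mul_exp_div_sub_le hm (hCm i j) ((abs_apply_le ξ i j).trans hξ) (by linarith)
  have hXm : ∀ i j, m / 2 ≤ X i j := by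
    intro i j
    have hc0 := hm.trans_le (hCm i j)
    have h1 : -(1 / 2) ≤ ξ i j / C i j := by
      rw [le_div_iff₀ hc0]
      have := (abs_le.1 ((abs_apply_le ξ i j).trans hξ)).1
      linarith [hCm i j]
    have h2 := Real.add_one_le_exp (ξ i j / C i j)
    calc m / 2 = m * (1 / 2) := by ring
      _ ≤ C i j * Real.exp (ξ i j / C i j) := by
        gcongr
        · exact hCm i j
        · linarith
  have hXr : ∀ i, |∑ j, X i j - 1| ≤ n * (r ^ 2 / m) := by
    intro i
    have : ∑ j, X i j - 1 = ∑ j, (X i j - C i j - ξ i j) := by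
      rw [Finset.sum_sub_distrib, Finset.sum_sub_distrib, hC.2.1 i, hr i, sub_zero]
    rw [this]
    refine (Finset.abs_sum_le_sum_abs _ _).trans ((Finset.sum_le_sum fun j _ => hE i j).trans ?_)
    simp
  have hXc : ∀ j, |∑ i, X i j - 1| ≤ n * (r ^ 2 / m) := by
    intro j
    have : ∑ i, X i j - 1 = ∑ i, (X i j - C i j - ξ i j) := by
      rw [Finset.sum_sub_distrib, Finset.sum_sub_distrib, hC.2.2 j, hc j, sub_zero]
    rw [this]
    refine (Finset.abs_sum_le_sum_abs _ _).trans ((Finset.sum_le_sum fun i _ => hE i j).trans ?_)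
    simp
  have hr2 : r ^ 2 ≤ m ^ 2 / (16 * (n + 1) ^ 2) := by
    calc r ^ 2 ≤ (m / (4 * (n + 1))) ^ 2 := by gcongr
      _ = _ := by field_simp; ring
  have hκ : 3 * n * (n * (r ^ 2 / m)) / (m / 2) ≤ 1 / 2 := by
    rw [le_div_iff₀ (by positivity)] at hr2
    have : 3 * n * (n * (r ^ 2 / m)) / (m / 2) = 6 * n ^ 2 * r ^ 2 / m ^ 2 := by
      field_simp; ring
    rw [this, div_le_iff₀ (by positivity)]
    nlinarith [sq_nonneg r, mul_nonneg (sq_nonneg r) hn0]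
  have hex : ∃ P, IsSinkhornScaling X P :=
    exists_isSinkhornScaling fun i j => (half_pos hm).trans_le (hXm i j)
  have hP : IsSinkhornScaling X (sinkhorn X) := by
    rw [sinkhorn, dif_pos hex]
    exact hex.choose_spec
  rw [mul_assoc]
  refine norm_le_of_abs_apply_le (by positivity) fun i j => ?_
  have h1 := abs_sinkhornScaling_sub_le hP (half_pos hm) hXm hXr hXc hκ i j
  have hm1 : m ≤ 1 := (hCm i j).trans (apply_le_one_of_mem_DP hC i j)
  have hX2 : X i j ≤ 2 := by
    have h2 : X i j ≤ ∑ j, X i j := Finset.single_le_sum (f := fun j => X i j)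
      (fun j _ => (half_pos hm).le.trans (hXm i j)) (Finset.mem_univ j)
    have h3 := (abs_le.1 (hXr i)).2
    have h4 : n * (r ^ 2 / m) ≤ 1 := by
      rw [le_div_iff₀ (by positivity)] at hr2
      rw [mul_div_assoc', div_le_iff₀ hm]
      nlinarith [sq_nonneg r, mul_nonneg (sq_nonneg r) hn0]
    linarith
  calc |(sinkhorn X - C - ξ) i j| = |(sinkhorn X i j - X i j) + (X i j - C i j - ξ i j)| := by
        congr 1; simp only [Matrix.sub_apply]; ring
    _ ≤ 2 * (4 * (3 * n * (n * (r ^ 2 / m)) / (m / 2))) + r ^ 2 / m := by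
        refine (abs_add_le _ _).trans (add_le_add (h1.trans ?_) (hE i j))
        gcongr
    _ = _ := by field_simp; ring

lemma norm_qPart_retr_sub_le {Q ξ : Mat n} (hQ : Qᵀ * Q = 1)
    (hξ : ∃ K : Mat n, Kᵀ = -K ∧ ξ = Q * K) {r : ℝ} (hr : ‖ξ‖ ≤ r) (hrn : n * r ≤ 1 / 2) :
    ‖qf (Q + ξ) - Q - ξ‖ ≤ 2 * (n : ℝ) ^ 6 * (n + 1) * r ^ 2 := by
  obtain ⟨K, hK, rfl⟩ := hξ
  have hKn : ‖K‖ ≤ n * r := by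
    calc ‖K‖ = ‖Qᵀ * (Q * K)‖ := by rw [← mul_assoc, hQ, one_mul]
      _ ≤ ‖Qᵀ‖ * ‖Q * K‖ := norm_mul_le _ _
      _ ≤ n * r := by
        rw [Matrix.frobenius_norm_transpose]
        gcongr
        exact norm_of_orthogonal hQ
  have hdet : (Q + Q * K).det ≠ 0 := by
    have h1 : IsUnit (1 + K) := by
      have h := isUnit_one_sub_of_norm_lt_one (x := -K) (by rw [norm_neg]; linarith)
      rwa [sub_neg_eq_add] at h
    have h2 : IsUnit Q := IsUnit.of_mul_eq_one Qᵀ (mul_eq_one_comm.1 hQ)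
    have h3 : IsUnit (Q + Q * K) := by
      have := h2.mul h1
      rwa [mul_add, mul_one] at this
    exact ((Matrix.isUnit_iff_isUnit_det _).1 h3).ne_zero
  have hex := exists_isQFactor hdet
  have hq : IsQFactor (Q + Q * K) (qf (Q + Q * K)) := by
    rw [qf, dif_pos hex]
    exact hex.choose_spec
  rw [sub_sub]
  refine (norm_isQFactor_sub_le hQ hK (hKn.trans hrn) hq).trans ?_
  calc _ ≤ 2 * (n : ℝ) ^ 4 * (n + 1) * (n * r) ^ 2 := by gcongr
    _ = _ := by ring

lemma norm_retr_sub_le {m B : ℝ} (hm : 0 < m) :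
    ∃ r > 0, ∃ K > 0, ∀ Z ξ : Quad n, InRegion s m B Z → ξ ∈ tangent s Z → ‖ξ‖ ≤ r →
      ‖retr s Z ξ - Z - ξ‖ ≤ K * ‖ξ‖ ^ 2 := by
  have hn0 : (0 : ℝ) ≤ n := by positivity
  refine ⟨min (m / (4 * (n + 1))) (1 / (2 * (n + 1))), by positivity,
    n * (1 / m + 48 * (n : ℝ) ^ 2 / m ^ 2) + 2 * (n : ℝ) ^ 6 * (n + 1) + n * (1 / m) + 1,
    by positivity, fun Z ξ hZ hξ hr => ?_⟩
  have hr1 := hr.trans (min_le_left _ _)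
  have hr2 := hr.trans (min_le_right _ _)
  have hC := norm_cPart_retr_sub_le hm hZ.mem.1 hZ.c_ge hξ.1.1 hξ.1.2 (norm_cPart_le ξ) hr1
  have hQ := norm_qPart_retr_sub_le hZ.mem.2.1 hξ.2.1 (norm_qPart_le ξ) (by
    calc n * ‖ξ‖ ≤ (n + 1) * (1 / (2 * (n + 1))) := by gcongr; linarith
      _ = 1 / 2 := by field_simp)
  have hW : ‖wPart (retr s Z ξ) - wPart Z - wPart ξ‖ ≤ n * (‖ξ‖ ^ 2 / m) := by
    refine norm_le_of_abs_apply_le (by positivity) fun i j => ?_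
    by_cases h : InI2 s i j
    · simp only [Matrix.sub_apply, wPart, retr, Matrix.of_apply, if_pos h]
      refine abs_mul_exp_div_sub_le hm (hZ.w_ge i j h)
        ((abs_apply_le _ i j).trans (norm_wPart_le ξ)) (hr1.trans ?_)
      exact div_le_self hm.le (by linarith)
    · have h1 := hZ.mem.2.2.1.1 i j h
      have h2 := hξ.2.2.1 i j h
      simp only [wPart] at h1 h2
      simp only [Matrix.sub_apply, wPart, retr, Matrix.of_apply, if_neg h, h1, h2, sub_zero,
        abs_zero]
      positivity
  have hV : ‖vPart (retr s Z ξ) - vPart Z - vPart ξ‖ ≤ 0 := by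
    have : vPart (retr s Z ξ) - vPart Z - vPart ξ = 0 := by
      change vPart Z + vPart ξ - vPart Z - vPart ξ = 0
      abel
    rw [this, norm_zero]
  have k1 : 0 ≤ n * (1 / m + 48 * (n : ℝ) ^ 2 / m ^ 2) * ‖ξ‖ ^ 2 := by positivity
  have k2 : 0 ≤ 2 * (n : ℝ) ^ 6 * (n + 1) * ‖ξ‖ ^ 2 := by positivity
  have k3 : 0 ≤ n * (1 / m) * ‖ξ‖ ^ 2 := by positivity
  have k4 : 0 ≤ ‖ξ‖ ^ 2 := by positivity
  have k5 : n * (‖ξ‖ ^ 2 / m) = n * (1 / m) * ‖ξ‖ ^ 2 := by ring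
  rw [add_mul, add_mul, add_mul, one_mul]
  exact norm_quad_le (hC.trans (by linarith)) (hQ.trans (by linarith)) (hW.trans (by linarith))
    (hV.trans (by linarith))

/-! ### Smoothness of `F` -/

/-- Matrices as functions of two indices. -/
noncomputable def ofCLM (n : ℕ) : (Fin n → Fin n → ℝ) →L[ℝ] Mat n :=
  LinearMap.toContinuousLinearMap (Matrix.ofLinearEquiv ℝ).toLinearMap

lemma ofCLM_apply (f : Fin n → Fin n → ℝ) : ofCLM n f = Matrix.of f := rfl

/-- The transpose as a continuous linear map. -/
noncomputable def transposeCLM (n : ℕ) : Mat n →L[ℝ] Mat n :=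
  LinearMap.toContinuousLinearMap (Matrix.transposeLinearEquiv (Fin n) (Fin n) ℝ ℝ).toLinearMap

/-- An entry of a matrix as a continuous linear map. -/
noncomputable def entryCLM (i j : Fin n) : Mat n →L[ℝ] ℝ :=
  LinearMap.toContinuousLinearMap (Matrix.entryLinearMap ℝ ℝ i j)

lemma entryCLM_apply (i j : Fin n) (A : Mat n) : entryCLM i j A = A i j := rfl

lemma contDiffAt_opA (lam : Fin n → ℂ) {W : Mat n} (hW : W ∈ setW n s) :
    ContDiffAt ℝ 2 (opA s lam) W := by
  classical
  have h : opA s lam = fun W : Mat n => ofCLM n fun i j =>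
      if InI2 s j i then -(lam i).im ^ 2 / entryCLM j i W else 0 := by
    ext W i j
    simp only [opA, ofCLM_apply, entryCLM_apply, Matrix.of_apply]
  rw [h]
  refine (ofCLM n).contDiff.contDiffAt.comp W ?_
  refine contDiffAt_pi.2 fun i => contDiffAt_pi.2 fun j => ?_
  by_cases hI : InI2 s j i
  · simp only [if_pos hI]
    exact contDiffAt_const.div (entryCLM j i).contDiff.contDiffAt (hW.2 j i hI).ne'
  · simp only [if_neg hI]
    exact contDiffAt_const

lemma contDiffAt_mapF (lam : Fin n → ℂ) {Z : Quad n} (hZ : Z ∈ setZ n s) :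
    ContDiffAt ℝ 2 (mapF s lam) Z := by
  have h2 : ContDiffAt ℝ 2 (fun Z : Quad n => Z.2) Z := contDiffAt_snd
  have hQ : ContDiffAt ℝ 2 (fun Z : Quad n => qPart Z) Z := h2.fst
  have hW : ContDiffAt ℝ 2 (fun Z : Quad n => wPart Z) Z := h2.snd.fst
  have hV : ContDiffAt ℝ 2 (fun Z : Quad n => vPart Z) Z := h2.snd.snd
  have hT : ContDiffAt ℝ 2 (fun Z : Quad n => schurT s lam Z) Z :=
    ((contDiffAt_const.add ((contDiffAt_opA lam hZ.2.2.1).comp Z hW)).add hW).add hV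
  have hQt : ContDiffAt ℝ 2 (fun Z : Quad n => (qPart Z)ᵀ) Z :=
    (transposeCLM n).contDiff.contDiffAt.comp Z hQ
  exact contDiffAt_fst.sub ((hQ.mul hT).mul hQt)

/-- The differential of `schurT`. -/
noncomputable def diffT (s : ℕ) (lam : Fin n → ℂ) (Z ζ : Quad n) : Mat n :=
  (matB s lam (wPart Z) ⊙ wPart ζ)ᵀ + wPart ζ + vPart ζ

lemma hasDerivAt_opA (lam : Fin n → ℂ) {W : Mat n} (hW : W ∈ setW n s) (w : Mat n) :
    HasDerivAt (fun t : ℝ => opA s lam (W + t • w)) (matB s lam W ⊙ w)ᵀ 0 := by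
  classical
  have h : (fun t : ℝ => opA s lam (W + t • w)) = fun t : ℝ => ofCLM n fun i j =>
      if InI2 s j i then -(lam i).im ^ 2 / (W j i + t * w j i) else 0 := by
    ext t i j
    simp only [opA, ofCLM_apply, Matrix.of_apply, Matrix.add_apply, Matrix.smul_apply, smul_eq_mul]
  have h' : (matB s lam W ⊙ w)ᵀ = ofCLM n fun i j =>
      if InI2 s j i then (lam i).im ^ 2 / W j i ^ 2 * w j i else 0 := by
    ext i j
    simp only [matB, ofCLM_apply, Matrix.of_apply, Matrix.transpose_apply, Matrix.hadamard_apply]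
    split_ifs <;> simp
  rw [h, h']
  refine (ofCLM n).hasFDerivAt.comp_hasDerivAt (0 : ℝ) ?_
  refine hasDerivAt_pi.2 fun i => hasDerivAt_pi.2 fun j => ?_
  by_cases hI : InI2 s j i
  · simp only [if_pos hI]
    have h0 : W j i + 0 * w j i ≠ 0 := by simpa using (hW.2 j i hI).ne'
    have h1 : HasDerivAt (fun t : ℝ => W j i + t * w j i) (w j i) 0 := by
      simpa using ((hasDerivAt_id (0 : ℝ)).mul_const (w j i)).const_add (W j i)
    have h2 := (hasDerivAt_const (0 : ℝ) (-(lam i).im ^ 2)).div h1 h0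
    convert! h2 using 1
    simp only [zero_mul, add_zero]
    ring
  · simp only [if_neg hI]
    exact hasDerivAt_const _ _

/-- Ambient product rule, computed along the line `Z + t ζ`; `ζ` need not be tangent. -/
lemma fderiv_mapF_apply (lam : Fin n → ℂ) {Z : Quad n} (hZ : Z ∈ setZ n s) (ζ : Quad n) :
    fderiv ℝ (mapF s lam) Z ζ = cPart ζ - (qPart ζ * schurT s lam Z * (qPart Z)ᵀ
      + qPart Z * diffT s lam Z ζ * (qPart Z)ᵀ + qPart Z * schurT s lam Z * (qPart ζ)ᵀ) := by
  have hline : ∀ {E : Type} [NormedAddCommGroup E] [NormedSpace ℝ E] (a b : E),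
      HasDerivAt (fun t : ℝ => a + t • b) b 0 := fun a b => by
    simpa using ((hasDerivAt_id (0 : ℝ)).smul_const b).const_add a
  have h1 : HasDerivAt (fun t : ℝ => mapF s lam (Z + t • ζ)) (fderiv ℝ (mapF s lam) Z ζ) 0 := by
    have hd : HasFDerivAt (mapF s lam) (fderiv ℝ (mapF s lam) Z) (Z + (0 : ℝ) • ζ) := by
      rw [zero_smul, add_zero]
      exact ((contDiffAt_mapF lam hZ).differentiableAt (by simp)).hasFDerivAt
    exact hd.comp_hasDerivAt (0 : ℝ) (hline Z ζ)
  refine h1.unique ?_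
  have hT : HasDerivAt (fun t : ℝ => schurT s lam (Z + t • ζ)) (diffT s lam Z ζ) 0 := by
    have h := (((hasDerivAt_opA lam hZ.2.2.1 (wPart ζ)).const_add (matLam lam)).add
      (hline (wPart Z) (wPart ζ))).add (hline (vPart Z) (vPart ζ))
    exact h
  have hQ := hline (qPart Z) (qPart ζ)
  have hQt : HasDerivAt (fun t : ℝ => (qPart Z + t • qPart ζ)ᵀ) (qPart ζ)ᵀ 0 := by
    simp only [Matrix.transpose_add, Matrix.transpose_smul]
    exact hline (qPart Z)ᵀ (qPart ζ)ᵀ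
  have h := (hline (cPart Z) (cPart ζ)).sub ((hQ.mul hT).mul hQt)
  convert! h using 1
  simp only [Pi.mul_apply, zero_smul, add_zero, add_mul]

/-- Tangency to `O(n)` gives `Qᵀ ξ_Q Qᵀ = -ξ_Qᵀ`, which merges the two product-rule terms in `ξ_Q`
into the commutator. -/
lemma diffF_eq_fderiv (lam : Fin n → ℂ) {Z : Quad n} (hZ : Z ∈ setZ n s) (ξ : tangent s Z) :
    diffF s lam Z ξ = fderiv ℝ (mapF s lam) Z ξ := by
  rw [fderiv_mapF_apply lam hZ]
  obtain ⟨ξ, h1, ⟨K, hK, hQ⟩, h3, h4⟩ := ξ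
  change cPart ξ + ⁅qPart Z * schurT s lam Z * (qPart Z)ᵀ, qPart ξ * (qPart Z)ᵀ⁆
      - qPart Z * diffT s lam Z ξ * (qPart Z)ᵀ = _
  have e1 : (qPart Z)ᵀ * (qPart ξ * (qPart Z)ᵀ) = -(qPart ξ)ᵀ := by
    rw [hQ, Matrix.transpose_mul, hK, ← mul_assoc, ← mul_assoc, hZ.2.1]
    simp
  have e2 : qPart ξ * (qPart Z)ᵀ * (qPart Z * schurT s lam Z * (qPart Z)ᵀ)
      = qPart ξ * schurT s lam Z * (qPart Z)ᵀ := by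
    calc _ = qPart ξ * ((qPart Z)ᵀ * qPart Z) * schurT s lam Z * (qPart Z)ᵀ := by
          simp only [mul_assoc]
      _ = _ := by rw [hZ.2.1, mul_one]
  rw [Ring.lie_def, e2, mul_assoc _ (qPart Z)ᵀ, e1]
  noncomm_ring

/-- Uniform first order estimates for a `C²` function. -/
lemma exists_quadratic_remainder {E G : Type*} [NormedAddCommGroup E] [NormedSpace ℝ E]
    [NormedAddCommGroup G] [NormedSpace ℝ G] {f : E → G} {x : E} (hf : ContDiffAt ℝ 2 f x) :
    ∃ r > 0, ∃ K > 0, ∀ y ∈ Metric.ball x r, ∀ z ∈ Metric.ball x r,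
      ‖f z - f y - fderiv ℝ f y (z - y)‖ ≤ K * ‖z - y‖ ^ 2 ∧
      ‖f z - f y‖ ≤ K * ‖z - y‖ ∧
      (∀ v, ‖fderiv ℝ f y v‖ ≤ K * ‖v‖) ∧
      ∀ v, ‖fderiv ℝ f z v - fderiv ℝ f y v‖ ≤ K * ‖z - y‖ * ‖v‖ := by
  have h1 : ContDiffAt ℝ 1 (fderiv ℝ f) x := hf.fderiv_right (by norm_num)
  obtain ⟨K, t, ht, hK⟩ := h1.exists_lipschitzOnWith
  have hd : ∀ᶠ y in 𝓝 x, DifferentiableAt ℝ f y := by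
    filter_upwards [hf.eventually (by simp)] with y hy
    exact hy.differentiableAt (by simp)
  have hb : ∀ᶠ y in 𝓝 x, ‖fderiv ℝ f y‖ < ‖fderiv ℝ f x‖ + 1 :=
    h1.continuousAt.norm.eventually_lt_const (by linarith)
  obtain ⟨r, hr, hball⟩ := Metric.eventually_nhds_iff_ball.1 (hd.and (hb.and ht))
  set L := ‖fderiv ℝ f x‖ + 1
  have hL : 0 < L := by positivity
  have hKL : (K : ℝ) ≤ K + L := by linarith
  have hLK : L ≤ K + L := by linarith [K.2]
  have hbd : ∀ y ∈ Metric.ball x r, ∀ v, ‖fderiv ℝ f y v‖ ≤ L * ‖v‖ := fun y hy v =>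
    ((fderiv ℝ f y).le_opNorm v).trans (by gcongr; exact (hball y hy).2.1.le)
  refine ⟨r, hr, K + L, by positivity, fun y hy z hz => ?_⟩
  have hseg : segment ℝ y z ⊆ Metric.ball x r := (convex_ball x r).segment_subset hy hz
  refine ⟨?_, ?_, fun v => (hbd y hy v).trans (by gcongr), fun v => ?_⟩
  · have h := (convex_segment y z).norm_image_sub_le_of_norm_hasFDerivWithin_le'
      (f := f) (f' := fderiv ℝ f) (φ := fderiv ℝ f y) (C := K * ‖z - y‖)
      (fun w hw => (hball w (hseg hw)).1.hasFDerivAt.hasFDerivWithinAt) (fun w hw => ?_)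
      (left_mem_segment ℝ y z) (right_mem_segment ℝ y z)
    · refine h.trans ?_
      rw [mul_assoc, ← sq]
      gcongr
    · rw [← dist_eq_norm]
      refine (hK.dist_le_mul w (hball w (hseg hw)).2.2 y (hball y hy).2.2).trans ?_
      gcongr
      rw [dist_eq_norm]
      obtain ⟨a, b, ha, hb, hab, rfl⟩ := hw
      have : a • y + b • z - y = b • (z - y) := by
        rw [show a = 1 - b by linarith]; module
      rw [this, norm_smul, Real.norm_of_nonneg hb]
      exact mul_le_of_le_one_left (norm_nonneg _) (by linarith)
  · refine ((convex_segment y z).norm_image_sub_le_of_norm_hasFDerivWithin_le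
      (f := f) (f' := fderiv ℝ f) (C := L)
      (fun w hw => (hball w (hseg hw)).1.hasFDerivAt.hasFDerivWithinAt)
      (fun w hw => (hball w (hseg hw)).2.1.le)
      (left_mem_segment ℝ y z) (right_mem_segment ℝ y z)).trans ?_
    gcongr
  · rw [← sub_apply]
    refine (ContinuousLinearMap.le_opNorm _ v).trans ?_
    gcongr
    rw [← dist_eq_norm, ← dist_eq_norm]
    exact (hK.dist_le_mul z (hball z hz).2.2 y (hball y hy).2.2).trans (by gcongr)

/-- First order expansions along the retraction, uniformly near a point of `𝒵`. -/
lemma exists_retr_expansion (lam : Fin n → ℂ) {Zs : Quad n} (hZs : Zs ∈ setZ n s) :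
    ∃ r > 0, ∃ K ≥ 1, ∀ᶠ Z in 𝓝 Zs, Z ∈ setZ n s → ∀ ξ : tangent s Z, ‖(ξ : Quad n)‖ ≤ r →
      ‖retr s Z ξ - Z‖ ≤ K * ‖(ξ : Quad n)‖ ∧
      ‖mapF s lam (retr s Z ξ) - mapF s lam Z - diffF s lam Z ξ‖ ≤ K * ‖(ξ : Quad n)‖ ^ 2 := by
  obtain ⟨m, hm, B, hB, hreg⟩ := exists_inRegion hZs
  obtain ⟨r1, hr1, K1, hK1, hretr⟩ := norm_retr_sub_le (n := n) (s := s) (B := B) hm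
  obtain ⟨r2, hr2, K2, hK2, hquad⟩ := exists_quadratic_remainder (contDiffAt_mapF lam hZs)
  -- The bound `1` turns `‖ξ‖²` into `‖ξ‖`; the last radius keeps `R_Z(ξ)` within `r2 / 2` of `Z`,
  -- hence in the ball where the quadratic remainder is controlled.
  refine ⟨min r1 (min 1 (r2 / (2 * (1 + K1)))), by positivity,
    1 + K1 + K2 * K1 + K2 * (1 + K1) ^ 2, by
      have : 0 ≤ K2 * K1 + K2 * (1 + K1) ^ 2 := by positivity
      linarith, ?_⟩
  filter_upwards [hreg, Metric.ball_mem_nhds Zs (half_pos hr2)] with Z hZr hZb hZ ξ hξ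
  have h1 := hretr Z ξ (hZr hZ) ξ.2 (hξ.trans (min_le_left _ _))
  have hx1 : ‖(ξ : Quad n)‖ ≤ 1 := hξ.trans ((min_le_right _ _).trans (min_le_left _ _))
  have hx2 : ‖(ξ : Quad n)‖ ≤ r2 / (2 * (1 + K1)) :=
    hξ.trans ((min_le_right _ _).trans (min_le_right _ _))
  set x := ‖(ξ : Quad n)‖ with hx
  have hx0 : 0 ≤ x := norm_nonneg _
  have h2 : ‖retr s Z ξ - Z‖ ≤ (1 + K1) * x := by
    calc ‖retr s Z ξ - Z‖ = ‖(ξ : Quad n) + (retr s Z ξ - Z - ξ)‖ := by congr 1; abel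
      _ ≤ x + K1 * x ^ 2 := (norm_add_le _ _).trans (by gcongr)
      _ ≤ x + K1 * (x * 1) := by gcongr; rw [sq]; gcongr
      _ = _ := by ring
  refine ⟨h2.trans (mul_le_mul_of_nonneg_right ?_ hx0), ?_⟩
  · have : 0 ≤ K2 * K1 + K2 * (1 + K1) ^ 2 := by positivity
    linarith
  have hball : retr s Z ξ ∈ Metric.ball Zs r2 := by
    have : ‖retr s Z ξ - Z‖ ≤ r2 / 2 := by
      rw [le_div_iff₀ (by positivity)] at hx2
      linarith
    rw [Metric.mem_ball] at hZb ⊢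
    rw [← dist_eq_norm] at this
    linarith [dist_triangle (retr s Z ξ) Z Zs]
  obtain ⟨h3, -, h4, -⟩ := hquad Z (Metric.ball_subset_ball (by linarith) hZb) _ hball
  rw [diffF_eq_fderiv lam hZ]
  set D := fderiv ℝ (mapF s lam) Z
  calc ‖mapF s lam (retr s Z ξ) - mapF s lam Z - D ξ‖
      = ‖(mapF s lam (retr s Z ξ) - mapF s lam Z - D (retr s Z ξ - Z))
          + D (retr s Z ξ - Z - ξ)‖ := by
        congr 1; rw [map_sub D (retr s Z ξ - Z)]; abel
    _ ≤ K2 * ((1 + K1) * x) ^ 2 + K2 * (K1 * x ^ 2) := by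
        refine (norm_add_le _ _).trans (add_le_add (h3.trans (by gcongr)) ?_)
        exact (h4 _).trans (by gcongr)
    _ = (K2 * K1 + K2 * (1 + K1) ^ 2) * x ^ 2 := by ring
    _ ≤ _ := by gcongr; linarith

/-! ### The eigenvalue `1` -/

lemma exists_lam_eq_one {lam : Fin n → ℂ} (hn : 0 < n) (h : IsRealizable lam) :
    ∃ p, lam p = 1 := by
  obtain ⟨C, hC, hroots⟩ := h
  have hmem : (1 : ℂ) ∈ (C.map Complex.ofReal).charpoly.roots := by
    rw [Polynomial.mem_roots (Matrix.charpoly_monic _).ne_zero, Polynomial.IsRoot,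
      Matrix.eval_charpoly, ← Matrix.exists_mulVec_eq_zero_iff]
    refine ⟨fun _ => 1, fun h0 => ?_, ?_⟩
    · simpa using congrFun h0 ⟨0, hn⟩
    · ext i
      rw [Matrix.sub_mulVec, Pi.sub_apply, map_one, Matrix.one_mulVec]
      simp only [Matrix.mulVec, dotProduct, Matrix.map_apply, mul_one]
      rw [← Complex.ofReal_sum, hC.2.1 i]
      simp
  rw [hroots, Multiset.mem_map] at hmem
  obtain ⟨p, -, hp⟩ := hmem
  exact ⟨p, hp⟩

/-- Entries of conjugate pairs are nonreal, so the eigenvalue `1` sits in the truly triangular part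
of the Schur factor. -/
lemma two_mul_le_of_lam_eq_one {lam : Fin n → ℂ} (h : IsOrderedSpectrum s lam) {p : Fin n}
    (hp : lam p = 1) : 2 * s ≤ (p : ℕ) := by
  by_contra! hlt
  have hle := h.two_mul_le
  rcases Nat.even_or_odd' (p : ℕ) with ⟨k, hk | hk⟩
  · have := (h.pair p ⟨2 * k + 1, by omega⟩ ⟨k, by omega, hk, rfl⟩).1
    rw [hp] at this
    simp at this
  · have := h.pair ⟨2 * k, by omega⟩ p ⟨k, by omega, rfl, hk⟩
    rw [hp] at this
    apply this.1
    have h2 := congrArg Complex.im this.2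
    rw [Complex.conj_im] at h2
    simp only [Complex.one_im] at h2
    linarith

lemma schurT_sub_one_apply {lam : Fin n → ℂ} {Z : Quad n} (hZ : Z ∈ setZ n s) {p : Fin n}
    (hp : lam p = 1) (hps : 2 * s ≤ (p : ℕ)) {i j : Fin n} (hi : p ≤ i) (hj : j ≤ p) :
    (schurT s lam Z - 1) i j = 0 := by
  have hji : j ≤ i := hj.trans hi
  have hji' : (j : ℕ) ≤ i := hji
  have hpi : (p : ℕ) ≤ i := hi
  have h1 : ¬ InI2 s i j := by rintro ⟨k, _, h, h'⟩; omega
  have h2 : ¬ InI2 s j i := by rintro ⟨k, _, h, h'⟩; omega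
  have hV := hZ.2.2.2 i j (Or.inl hji)
  have hW := hZ.2.2.1.1 i j h1
  simp only [wPart, vPart] at hV hW
  simp only [schurT, Matrix.sub_apply, Matrix.add_apply, opA, Matrix.of_apply, if_neg h2, hV, hW,
    matLam, Matrix.diagonal_apply, Matrix.one_apply, wPart, vPart]
  split_ifs with h
  · subst h
    have : i = p := le_antisymm hj hi
    rw [this, hp]
    simp
  · simp

/-- The corner where `T - 1` vanishes also vanishes in every admissible variation of `T`: the
eigenvalue `1` is not moved to first order. -/
lemma diffT_apply_eq_zero {lam : Fin n → ℂ} {Z ξ : Quad n} (hξ : ξ ∈ tangent s Z) {p : Fin n}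
    (hps : 2 * s ≤ (p : ℕ)) {i j : Fin n} (hi : p ≤ i) (hj : j ≤ p) :
    diffT s lam Z ξ i j = 0 := by
  have hji : j ≤ i := hj.trans hi
  have hji' : (j : ℕ) ≤ i := hji
  have hpi : (p : ℕ) ≤ i := hi
  have h1 : ¬ InI2 s i j := by rintro ⟨k, _, h, h'⟩; omega
  have h2 : ¬ InI2 s j i := by rintro ⟨k, _, h, h'⟩; omega
  have hV := hξ.2.2.2 i j (Or.inl hji)
  have hW := hξ.2.2.1 i j h1
  have hW' := hξ.2.2.1 j i h2
  simp only [wPart, vPart] at hV hW hW'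
  simp only [diffT, Matrix.add_apply, Matrix.transpose_apply, Matrix.hadamard_apply, hV, hW, hW',
    wPart, vPart, mul_zero, add_zero]

/-- The columns in `S` are supported on fewer rows than their number, hence are dependent. -/
lemma exists_mulVec_eq_zero_of_card_lt (M : Mat n) (R S : Finset (Fin n)) (hRS : R.card < S.card)
    (hM : ∀ i ∉ R, ∀ j ∈ S, M i j = 0) : ∃ y : Fin n → ℝ, y ≠ 0 ∧ (∀ j ∉ S, y j = 0) ∧
      M *ᵥ y = 0 := by
  let f : (S → ℝ) →ₗ[ℝ] (R → ℝ) :=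
    (M.submatrix (fun i : R => (i : Fin n)) (fun j : S => (j : Fin n))).mulVecLin
  have hker : LinearMap.ker f ≠ ⊥ := LinearMap.ker_ne_bot_of_finrank_lt (by simpa using hRS)
  obtain ⟨g, hg, hg0⟩ := Submodule.exists_mem_ne_zero_of_ne_bot hker
  have hsum : ∀ i, (M *ᵥ fun j => if h : j ∈ S then g ⟨j, h⟩ else 0) i
      = ∑ j : S, M i j * g j := by
    intro i
    simp only [Matrix.mulVec, dotProduct]
    rw [← Finset.sum_subset (Finset.subset_univ S) (by
      intro j _ hj; rw [dif_neg hj, mul_zero]), ← Finset.sum_coe_sort S]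
    exact Finset.sum_congr rfl fun j _ => by rw [dif_pos j.2]
  refine ⟨fun j => if h : j ∈ S then g ⟨j, h⟩ else 0, fun h => hg0 ?_, fun j hj => dif_neg hj, ?_⟩
  · ext ⟨j, hj⟩
    have := congrFun h j
    simpa [hj] using this
  · ext i
    rw [hsum]
    by_cases hi : i ∈ R
    · exact congrFun (LinearMap.mem_ker.1 hg) ⟨i, hi⟩
    · exact Finset.sum_eq_zero fun j _ => by rw [hM i hi j j.2, zero_mul]

/-- The columns `≤ p` of `T - 1` occupy only the rows `< p`. The support of the eigenvector matters:
it and the left eigenvector supported on indices `≥ p` pair to zero through every variation of `T`.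
-/
lemma exists_schurT_mulVec_eq {lam : Fin n → ℂ} {Z : Quad n} (hZ : Z ∈ setZ n s) {p : Fin n}
    (hp : lam p = 1) (hps : 2 * s ≤ (p : ℕ)) :
    ∃ y : Fin n → ℝ, y ≠ 0 ∧ (∀ j, p < j → y j = 0) ∧ schurT s lam Z *ᵥ y = y := by
  obtain ⟨y, h0, hS, hy⟩ := exists_mulVec_eq_zero_of_card_lt (schurT s lam Z - 1)
    (Finset.Iio p) (Finset.Iic p) (by simp) (fun i hi j hj =>
      schurT_sub_one_apply hZ hp hps (by simpa using hi) (by simpa using hj))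
  refine ⟨y, h0, fun j hj => hS j (by simpa using hj), ?_⟩
  rw [Matrix.sub_mulVec, Matrix.one_mulVec] at hy
  exact sub_eq_zero.1 hy

lemma exists_schurT_transpose_mulVec_eq {lam : Fin n → ℂ} {Z : Quad n} (hZ : Z ∈ setZ n s)
    {p : Fin n} (hp : lam p = 1) (hps : 2 * s ≤ (p : ℕ)) :
    ∃ x : Fin n → ℝ, x ≠ 0 ∧ (∀ i, i < p → x i = 0) ∧ (schurT s lam Z)ᵀ *ᵥ x = x := by
  obtain ⟨x, h0, hS, hx⟩ := exists_mulVec_eq_zero_of_card_lt (schurT s lam Z - 1)ᵀ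
    (Finset.Ioi p) (Finset.Ici p) (by have := p.2; simp; omega) (fun i hi j hj => by
      rw [Matrix.transpose_apply]
      exact schurT_sub_one_apply hZ hp hps (by simpa using hj) (by simpa using hi))
  refine ⟨x, h0, fun j hj => hS j (by simpa using hj), ?_⟩
  rw [Matrix.transpose_sub, Matrix.transpose_one, Matrix.sub_mulVec, Matrix.one_mulVec] at hx
  exact sub_eq_zero.1 hx

/-! ### Perturbation of the Perron vector -/

lemma abs_dotProduct_mulVec_le (a b : Fin n → ℝ) (A : Mat n) :
    |a ⬝ᵥ (A *ᵥ b)| ≤ (n : ℝ) ^ 2 * (‖a‖ * ‖A‖ * ‖b‖) := by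
  simp only [dotProduct, Matrix.mulVec, Finset.mul_sum]
  calc |∑ i, ∑ j, a i * (A i j * b j)| ≤ ∑ _i : Fin n, ∑ _j : Fin n, ‖a‖ * ‖A‖ * ‖b‖ := by
        refine (Finset.abs_sum_le_sum_abs _ _).trans (Finset.sum_le_sum fun i _ =>
          (Finset.abs_sum_le_sum_abs _ _).trans (Finset.sum_le_sum fun j _ => ?_))
        rw [abs_mul, abs_mul, ← mul_assoc]
        have h1 : |a i| ≤ ‖a‖ := norm_le_pi_norm a i
        have h2 : |b j| ≤ ‖b‖ := norm_le_pi_norm b j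
        have h3 := abs_apply_le A i j
        gcongr
    _ = _ := by simp; ring

lemma norm_mulVec_le (A : Mat n) (b : Fin n → ℝ) : ‖A *ᵥ b‖ ≤ n * (‖A‖ * ‖b‖) := by
  refine (pi_norm_le_iff_of_nonneg (by positivity)).2 fun i => ?_
  simp only [Matrix.mulVec, dotProduct]
  calc |∑ j, A i j * b j| ≤ ∑ _j : Fin n, ‖A‖ * ‖b‖ := by
        refine (Finset.abs_sum_le_sum_abs _ _).trans (Finset.sum_le_sum fun j _ => ?_)
        rw [abs_mul]
        have h2 : |b j| ≤ ‖b‖ := norm_le_pi_norm b j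
        have h3 := abs_apply_le A i j
        gcongr
    _ = _ := by simp

/-- Doeblin's argument: on zero-sum vectors `C` acts like `C - m J`, a nonnegative matrix with row
sums `1 - n m`, so it contracts the sup norm. -/
lemma norm_le_norm_mulVec_sub {C : Mat n} (hC : C ∈ DP n) {m : ℝ} (hm : ∀ i j, m ≤ C i j)
    {w : Fin n → ℝ} (hw : ∑ i, w i = 0) : n * m * ‖w‖ ≤ ‖C *ᵥ w - w‖ := by
  have h1 : ∀ i, ‖w i‖ ≤ (1 - n * m) * ‖w‖ + ‖C *ᵥ w - w‖ := by
    intro i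
    have e : (C *ᵥ w) i = ∑ j, (C i j - m) * w j := by
      simp only [sub_mul, Finset.sum_sub_distrib, ← Finset.mul_sum, hw, mul_zero, sub_zero]
      rfl
    have e2 : |(C *ᵥ w) i| ≤ (1 - n * m) * ‖w‖ := by
      rw [e]
      calc |∑ j, (C i j - m) * w j| ≤ ∑ j, (C i j - m) * ‖w‖ := by
            refine (Finset.abs_sum_le_sum_abs _ _).trans (Finset.sum_le_sum fun j _ => ?_)
            rw [abs_mul, abs_of_nonneg (sub_nonneg.2 (hm i j))]
            exact mul_le_mul_of_nonneg_left (norm_le_pi_norm w j) (sub_nonneg.2 (hm i j))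
        _ = (1 - n * m) * ‖w‖ := by
            rw [← Finset.sum_mul, Finset.sum_sub_distrib, hC.2.1 i]
            simp
    have e3 : |(C *ᵥ w - w) i| ≤ ‖C *ᵥ w - w‖ := norm_le_pi_norm (C *ᵥ w - w) i
    rw [Real.norm_eq_abs]
    calc |w i| = |(C *ᵥ w) i - (C *ᵥ w - w) i| := by simp
      _ ≤ _ := (abs_sub _ _).trans (add_le_add e2 e3)
  rcases isEmpty_or_nonempty (Fin n) with he | he
  · rw [Subsingleton.elim w 0]
    simp
  · have := (pi_norm_le_iff_of_nonempty (f := w)).2 h1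
    linarith

/-- Split `v` into its mean and a zero-sum part `w`. Then `C w - w = F v`, and the gap of `C` gives
`m ‖w‖ ≤ ‖F‖ ‖v‖`. As `‖F‖ ≤ m / 2`, the mean cannot vanish and can be scaled to `1`. -/
lemma exists_perturbed_eigenvector {C F : Mat n} (hC : C ∈ DP n) {m : ℝ} (hm0 : 0 < m)
    (hm : ∀ i j, m ≤ C i j) (hF : ‖F‖ ≤ m / 2) {v : Fin n → ℝ} (hv0 : v ≠ 0)
    (hv : (C - F) *ᵥ v = v) :
    ∃ (t : ℝ) (w : Fin n → ℝ), ‖w‖ ≤ 2 / m * ‖F‖ ∧ t • v = 1 + w := by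
  have hn : 0 < n := by
    rcases Nat.eq_zero_or_pos n with rfl | h
    · exact absurd (Subsingleton.elim v 0) hv0
    · exact h
  have : Nonempty (Fin n) := ⟨⟨0, hn⟩⟩
  have hn' : (0 : ℝ) < n := by exact_mod_cast hn
  set t : ℝ := (∑ i, v i) / n
  set w : Fin n → ℝ := v - t • 1
  have hw : ∑ i, w i = 0 := by
    simp only [w, t, Pi.sub_apply, Pi.smul_apply, Pi.one_apply, smul_eq_mul, mul_one,
      Finset.sum_sub_distrib, Finset.sum_const, Finset.card_univ, Fintype.card_fin, nsmul_eq_mul]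
    field_simp
    ring
  have hC1 : C *ᵥ (1 : Fin n → ℝ) = 1 := by
    ext i
    simpa [Matrix.mulVec, dotProduct] using hC.2.1 i
  have hCw : C *ᵥ w - w = F *ᵥ v := by
    rw [Matrix.sub_mulVec] at hv
    have hv' : C *ᵥ v = v + F *ᵥ v := by rw [← sub_eq_iff_eq_add]; exact hv
    simp only [w]
    rw [Matrix.mulVec_sub, Matrix.mulVec_smul, hC1, hv']
    abel
  have h1 : n * m * ‖w‖ ≤ n * (‖F‖ * ‖v‖) := by
    refine (norm_le_norm_mulVec_sub hC hm hw).trans ?_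
    rw [hCw]
    exact norm_mulVec_le F v
  have h2 : m * ‖w‖ ≤ ‖F‖ * ‖v‖ := by
    rw [mul_assoc] at h1
    exact le_of_mul_le_mul_left h1 hn'
  have hvn : ‖v‖ ≤ |t| + ‖w‖ := by
    calc ‖v‖ = ‖t • (1 : Fin n → ℝ) + w‖ := by congr 1; simp only [w]; abel
      _ ≤ ‖t • (1 : Fin n → ℝ)‖ + ‖w‖ := norm_add_le _ _
      _ = _ := by rw [norm_smul, norm_one, mul_one, Real.norm_eq_abs]
  have hv2 : ‖v‖ ≤ 2 * |t| := by
    have h3 : m * ‖w‖ ≤ m * (‖v‖ / 2) := by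
      refine h2.trans ?_
      nlinarith [norm_nonneg v]
    have h4 := le_of_mul_le_mul_left h3 hm0
    linarith
  have ht : 0 < |t| := by
    have := norm_pos_iff.2 hv0
    linarith
  have ht0 : t ≠ 0 := abs_pos.1 ht
  refine ⟨t⁻¹, t⁻¹ • w, ?_, ?_⟩
  · rw [norm_smul, norm_inv, Real.norm_eq_abs, inv_mul_le_iff₀ ht, div_mul_eq_mul_div,
      mul_div_assoc', le_div_iff₀ hm0]
    nlinarith [mul_le_mul_of_nonneg_left hv2 (norm_nonneg F)]
  · simp only [w]
    rw [smul_sub, inv_smul_smul₀ ht0]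
    abel

lemma sum_sum_eq_dotProduct (A : Mat n) : ∑ i, ∑ j, A i j = (1 : Fin n → ℝ) ⬝ᵥ (A *ᵥ 1) := by
  simp [dotProduct, Matrix.mulVec]

lemma transpose_mem_DP {C : Mat n} (hC : C ∈ DP n) : Cᵀ ∈ DP n :=
  ⟨fun i j => hC.1 j i, hC.2.2, hC.2.1⟩

lemma DP_mulVec_one {C : Mat n} (hC : C ∈ DP n) : C *ᵥ (1 : Fin n → ℝ) = 1 := by
  ext i
  simpa [Matrix.mulVec, dotProduct] using hC.2.1 i

lemma one_dotProduct_DP_mulVec {C : Mat n} (hC : C ∈ DP n) (v : Fin n → ℝ) :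
    (1 : Fin n → ℝ) ⬝ᵥ (C *ᵥ v) = 1 ⬝ᵥ v := by
  rw [Matrix.dotProduct_mulVec, ← Matrix.mulVec_transpose, DP_mulVec_one (transpose_mem_DP hC)]

lemma mulVec_ne_zero_of_orthogonal {Q : Mat n} (hQ : Qᵀ * Q = 1) {y : Fin n → ℝ} (hy : y ≠ 0) :
    Q *ᵥ y ≠ 0 := fun h => hy <| by
  rw [← Matrix.one_mulVec y, ← hQ, ← Matrix.mulVec_mulVec, h, Matrix.mulVec_zero]

/-- Near a doubly stochastic matrix the vectors `Q y` and `Q x`, with `y` and `x` right and left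
eigenvectors of the Schur factor for the eigenvalue `1`, are close to the all-ones vector. -/
lemma exists_schur_vectors {lam : Fin n → ℂ} {Z : Quad n} {m B : ℝ} (hm : 0 < m)
    (hZ : InRegion s m B Z) {p : Fin n} (hp : lam p = 1) (hps : 2 * s ≤ (p : ℕ))
    (hF : ‖mapF s lam Z‖ ≤ m / 2) :
    ∃ x y w w' : Fin n → ℝ, ‖w‖ ≤ 2 / m * ‖mapF s lam Z‖ ∧ ‖w'‖ ≤ 2 / m * ‖mapF s lam Z‖ ∧
      (∀ j, p < j → y j = 0) ∧ (∀ i, i < p → x i = 0) ∧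
      qPart Z *ᵥ y = 1 + w ∧ qPart Z *ᵥ x = 1 + w' ∧
      (cPart Z - mapF s lam Z) *ᵥ (1 + w) = 1 + w := by
  have hQ := hZ.mem.2.1
  have hCF : cPart Z - mapF s lam Z = qPart Z * schurT s lam Z * (qPart Z)ᵀ := by
    simp [mapF]
  obtain ⟨y, hy0, hys, hy⟩ := exists_schurT_mulVec_eq hZ.mem hp hps
  obtain ⟨x, hx0, hxs, hx⟩ := exists_schurT_transpose_mulVec_eq hZ.mem hp hps
  have hyv : (cPart Z - mapF s lam Z) *ᵥ (qPart Z *ᵥ y) = qPart Z *ᵥ y := by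
    rw [hCF, Matrix.mulVec_mulVec, mul_assoc, hQ, mul_one, ← Matrix.mulVec_mulVec, hy]
  have hxv : ((cPart Z)ᵀ - (mapF s lam Z)ᵀ) *ᵥ (qPart Z *ᵥ x) = qPart Z *ᵥ x := by
    rw [← Matrix.transpose_sub, hCF, Matrix.transpose_mul, Matrix.transpose_mul,
      Matrix.transpose_transpose, Matrix.mulVec_mulVec, mul_assoc, mul_assoc, hQ, mul_one,
      ← Matrix.mulVec_mulVec, hx]
  obtain ⟨t, w, hw, htw⟩ := exists_perturbed_eigenvector hZ.mem.1 hm hZ.c_ge hF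
    (mulVec_ne_zero_of_orthogonal hQ hy0) hyv
  obtain ⟨t', w', hw', htw'⟩ := exists_perturbed_eigenvector (F := (mapF s lam Z)ᵀ)
    (transpose_mem_DP hZ.mem.1) hm (fun i j => hZ.c_ge j i)
    (by rwa [Matrix.frobenius_norm_transpose]) (mulVec_ne_zero_of_orthogonal hQ hx0) hxv
  rw [Matrix.frobenius_norm_transpose] at hw'
  refine ⟨t' • x, t • y, w, w', hw, hw', fun j hj => ?_, fun i hi => ?_, ?_, ?_, ?_⟩
  · simp [hys j hj]
  · simp [hxs i hi]
  · rw [Matrix.mulVec_smul, htw]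
  · rw [Matrix.mulVec_smul, htw']
  · rw [← htw, Matrix.mulVec_smul, hyv]

lemma norm_one_le : ‖(1 : Fin n → ℝ)‖ ≤ 1 :=
  (pi_norm_le_iff_of_nonneg zero_le_one).2 fun i => by simp

/-- Pairing `(C - F)(e + w) = e + w` with `e` cancels `C` and leaves `eᵀFe = -eᵀFw`, where `w =
O(‖F‖)`. -/
lemma abs_sum_mapF_le {lam : Fin n → ℂ} {Z : Quad n} {m B : ℝ} (hm : 0 < m)
    (hZ : InRegion s m B Z) {p : Fin n} (hp : lam p = 1) (hps : 2 * s ≤ (p : ℕ))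
    (hF : ‖mapF s lam Z‖ ≤ m / 2) :
    |∑ i, ∑ j, mapF s lam Z i j| ≤ 2 * (n : ℝ) ^ 2 / m * ‖mapF s lam Z‖ ^ 2 := by
  obtain ⟨x, y, w, w', hw, -, -, -, -, -, h⟩ := exists_schur_vectors hm hZ hp hps hF
  have h1 : (1 : Fin n → ℝ) ⬝ᵥ ((cPart Z - mapF s lam Z) *ᵥ (1 + w)) = 1 ⬝ᵥ (1 + w) := by rw [h]
  rw [Matrix.sub_mulVec, dotProduct_sub, one_dotProduct_DP_mulVec hZ.mem.1, sub_eq_self,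
    Matrix.mulVec_add, dotProduct_add] at h1
  rw [sum_sum_eq_dotProduct, eq_neg_of_add_eq_zero_left h1, abs_neg]
  refine (abs_dotProduct_mulVec_le _ _ _).trans ?_
  calc (n : ℝ) ^ 2 * (‖(1 : Fin n → ℝ)‖ * ‖mapF s lam Z‖ * ‖w‖)
      ≤ (n : ℝ) ^ 2 * (1 * ‖mapF s lam Z‖ * (2 / m * ‖mapF s lam Z‖)) := by
        gcongr; exact norm_one_le
    _ = _ := by ring

/-- Each part of `DF[ξ]` is almost orthogonal to the all-ones matrix: `ξ_C` exactly, the commutator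
because `e` is a two-sided eigenvector of `C`, and the Schur variation because it pairs to zero with
the vectors `Qx`, `Qy` near `e`. -/
lemma abs_sum_diffF_le {lam : Fin n → ℂ} {Z : Quad n} {m B : ℝ} (hm : 0 < m)
    (hZ : InRegion s m B Z) {p : Fin n} (hp : lam p = 1) (hps : 2 * s ≤ (p : ℕ))
    (hF : ‖mapF s lam Z‖ ≤ m / 2) {L : ℝ} (hL : 0 ≤ L) (ξ : tangent s Z)
    (hξ : ‖diffF s lam Z ξ‖ ≤ L * ‖(ξ : Quad n)‖) :
    |∑ i, ∑ j, diffF s lam Z ξ i j| ≤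
      (2 * (n : ℝ) ^ 3 + (n : ℝ) ^ 2 * (L + 1 + 2 * (B + m) * n) * (6 / m))
        * ‖mapF s lam Z‖ * ‖(ξ : Quad n)‖ := by
  obtain ⟨x, y, w, w', hw, hw', hy, hx, hQy, hQx, -⟩ := exists_schur_vectors hm hZ hp hps hF
  set F := mapF s lam Z
  set Q := qPart Z
  set C := cPart Z
  set x0 := ‖(ξ : Quad n)‖
  set N := diffT s lam Z ξ
  set G := Q * N * Qᵀ
  set Ω := qPart (ξ : Quad n) * Qᵀ
  set T := Q * schurT s lam Z * Qᵀ
  have hT : T = C - F := by simp [F, T, C, Q, mapF]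
  have hx00 : 0 ≤ x0 := norm_nonneg _
  have hB : 0 ≤ B := (norm_nonneg _).trans hZ.norm_le
  have hdiff : diffF s lam Z ξ = cPart (ξ : Quad n) + (T * Ω - Ω * T) - G := rfl
  have hΩ : ‖Ω‖ ≤ n * x0 := by
    refine (norm_mul_le _ _).trans ?_
    rw [Matrix.frobenius_norm_transpose, mul_comm]
    gcongr
    · exact norm_of_orthogonal hZ.mem.2.1
    · exact norm_qPart_le _
  have hTn : ‖T‖ ≤ B + m := by
    rw [hT]
    refine (norm_sub_le _ _).trans ?_
    have := (norm_cPart_le Z).trans hZ.norm_le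
    linarith
  have hG : ‖G‖ ≤ (L + 1 + 2 * (B + m) * n) * x0 := by
    have e : G = cPart (ξ : Quad n) + (T * Ω - Ω * T) - diffF s lam Z ξ := by
      rw [hdiff]; abel
    have e1 : ‖T * Ω‖ ≤ (B + m) * (n * x0) := (norm_mul_le _ _).trans (by gcongr)
    have e2 : ‖Ω * T‖ ≤ (B + m) * (n * x0) := by
      rw [mul_comm (B + m)]; exact (norm_mul_le _ _).trans (by gcongr)
    rw [e]
    calc _ ≤ ‖cPart (ξ : Quad n)‖ + (‖T * Ω‖ + ‖Ω * T‖) + ‖diffF s lam Z ξ‖ :=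
          (norm_sub_le _ _).trans (add_le_add ((norm_add_le _ _).trans
            (add_le_add le_rfl (norm_sub_le _ _))) le_rfl)
      _ ≤ x0 + ((B + m) * (n * x0) + (B + m) * (n * x0)) + L * x0 := by
          gcongr; exact norm_cPart_le _
      _ = _ := by ring
  have hε1 : 2 / m * ‖F‖ ≤ 1 := by
    rw [div_mul_eq_mul_div, div_le_one hm]; linarith
  -- This is `xᵀ N y`: `x` lives on indices `≥ p`, `y` on indices `≤ p`, and `N` vanishes on that
  -- corner.
  have hxy : (1 + w') ⬝ᵥ (G *ᵥ (1 + w)) = 0 := by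
    have e : Qᵀ *ᵥ (Q *ᵥ y) = y := by rw [Matrix.mulVec_mulVec, hZ.mem.2.1, Matrix.one_mulVec]
    have e' : (Q *ᵥ x) ⬝ᵥ (Q *ᵥ (N *ᵥ y)) = x ⬝ᵥ (N *ᵥ y) := by
      rw [Matrix.dotProduct_mulVec, Matrix.vecMul_mulVec, hZ.mem.2.1]
      simp
    rw [← hQy, ← hQx, ← Matrix.mulVec_mulVec, ← Matrix.mulVec_mulVec, e, e']
    refine Finset.sum_eq_zero fun i _ => ?_
    rcases lt_or_ge i p with hi | hi
    · rw [hx i hi, zero_mul]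
    · have hNy : (N *ᵥ y) i = 0 := by
        simp only [Matrix.mulVec, dotProduct]
        refine Finset.sum_eq_zero fun j _ => ?_
        rcases lt_or_ge p j with hj | hj
        · rw [hy j hj, mul_zero]
        · rw [show N i j = 0 from diffT_apply_eq_zero ξ.2 hps hi hj, zero_mul]
      rw [hNy, mul_zero]
  have hGsum : |(1 : Fin n → ℝ) ⬝ᵥ (G *ᵥ 1)| ≤
      (n : ℝ) ^ 2 * (L + 1 + 2 * (B + m) * n) * (6 / m) * ‖F‖ * x0 := by
    have e : (1 : Fin n → ℝ) ⬝ᵥ (G *ᵥ 1)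
        = -(w' ⬝ᵥ (G *ᵥ (1 + w)) + (1 : Fin n → ℝ) ⬝ᵥ (G *ᵥ w)) := by
      rw [add_dotProduct, Matrix.mulVec_add, dotProduct_add] at hxy
      rw [Matrix.mulVec_add]
      linarith
    have h1w : ‖1 + w‖ ≤ 2 := (norm_add_le _ _).trans (by linarith [norm_one_le (n := n)])
    rw [e, abs_neg]
    calc _ ≤ (n : ℝ) ^ 2 * (‖w'‖ * ‖G‖ * ‖1 + w‖) + (n : ℝ) ^ 2 * (‖(1 : Fin n → ℝ)‖ * ‖G‖ * ‖w‖) :=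
          (abs_add_le _ _).trans
            (add_le_add (abs_dotProduct_mulVec_le _ _ _) (abs_dotProduct_mulVec_le _ _ _))
      _ ≤ (n : ℝ) ^ 2 * ((2 / m * ‖F‖) * ((L + 1 + 2 * (B + m) * n) * x0) * 2) +
          (n : ℝ) ^ 2 * (1 * ((L + 1 + 2 * (B + m) * n) * x0) * (2 / m * ‖F‖)) := by
          gcongr; exact norm_one_le
      _ = _ := by ring
  -- In `T = C - F` the commutator with `C` has zero entry sum, so only the one with `F` survives.
  have hTsum : (1 : Fin n → ℝ) ⬝ᵥ ((T * Ω - Ω * T) *ᵥ 1)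
      = (1 : Fin n → ℝ) ⬝ᵥ ((Ω * F - F * Ω) *ᵥ 1) := by
    have hC : C ∈ DP n := hZ.mem.1
    rw [hT]
    simp only [sub_mul, mul_sub, Matrix.sub_mulVec, dotProduct_sub, ← Matrix.mulVec_mulVec,
      one_dotProduct_DP_mulVec hC, DP_mulVec_one hC]
    ring
  have hcsum : (1 : Fin n → ℝ) ⬝ᵥ (cPart (ξ : Quad n) *ᵥ 1) = 0 := by
    rw [← sum_sum_eq_dotProduct]
    exact Finset.sum_eq_zero fun i _ => ξ.2.1.1 i
  have hΩF : ‖Ω * F - F * Ω‖ ≤ 2 * n * ‖F‖ * x0 := by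
    have e1 : ‖Ω * F‖ ≤ (n * x0) * ‖F‖ := (norm_mul_le _ _).trans (by gcongr)
    have e2 : ‖F * Ω‖ ≤ ‖F‖ * (n * x0) := (norm_mul_le _ _).trans (by gcongr)
    refine (norm_sub_le _ _).trans ((add_le_add e1 e2).trans_eq ?_)
    ring
  rw [sum_sum_eq_dotProduct, hdiff, Matrix.sub_mulVec, Matrix.add_mulVec, dotProduct_sub,
    dotProduct_add, hcsum, zero_add, hTsum]
  calc _ ≤ (n : ℝ) ^ 2 * (1 * (2 * n * ‖F‖ * x0) * 1) +
        (n : ℝ) ^ 2 * (L + 1 + 2 * (B + m) * n) * (6 / m) * ‖F‖ * x0 := by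
        refine (abs_sub _ _).trans (add_le_add ((abs_dotProduct_mulVec_le _ _ _).trans ?_) hGsum)
        gcongr
        · exact norm_one_le
        · exact norm_one_le
    _ = _ := by ring

/-- The value `F(Z)` cannot be a nonzero multiple of the all-ones matrix. -/
lemma mapF_eq_zero_of_const {lam : Fin n → ℂ} {Z : Quad n} {m B : ℝ} (hm : 0 < m)
    (hZ : InRegion s m B Z) {p : Fin n} (hp : lam p = 1) (hps : 2 * s ≤ (p : ℕ)) {c : ℝ}
    (hF : ∀ i j, mapF s lam Z i j = c) : mapF s lam Z = 0 := by
  have hn' : (0 : ℝ) < n := by exact_mod_cast p.pos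
  obtain ⟨y, hy0, -, hy⟩ := exists_schurT_mulVec_eq hZ.mem hp hps
  set v := qPart Z *ᵥ y
  have hCF : cPart Z - mapF s lam Z = qPart Z * schurT s lam Z * (qPart Z)ᵀ := by
    simp [mapF]
  have hv0 : v ≠ 0 := mulVec_ne_zero_of_orthogonal hZ.mem.2.1 hy0
  have hv : cPart Z *ᵥ v - mapF s lam Z *ᵥ v = v := by
    rw [← Matrix.sub_mulVec, hCF]
    simp only [v]
    rw [Matrix.mulVec_mulVec, mul_assoc, hZ.mem.2.1, mul_one, ← Matrix.mulVec_mulVec, hy]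
  have hFv : mapF s lam Z *ᵥ v = (c * ∑ j, v j) • 1 := by
    ext i
    simp [Matrix.mulVec, dotProduct, hF, Finset.mul_sum]
  have h1 : c * ∑ j, v j = 0 := by
    have h := congrArg ((1 : Fin n → ℝ) ⬝ᵥ ·) hv
    simp only [dotProduct_sub, one_dotProduct_DP_mulVec hZ.mem.1, sub_eq_self, hFv,
      dotProduct_smul, smul_eq_mul] at h
    rcases mul_eq_zero.1 h with h | h
    · exact h
    · simp [dotProduct] at h
      exact absurd h (by have := p.pos; omega)
  have hc : c = 0 := by
    -- If `c ≠ 0` then `v` has zero sum, so `F v = 0` and `C v = v`, contradicting the gap of `C`.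
    by_contra hc
    have hs : ∑ j, v j = 0 := (mul_eq_zero.1 h1).resolve_left hc
    have h2 := norm_le_norm_mulVec_sub hZ.mem.1 hZ.c_ge hs
    rw [hFv, h1, zero_smul, sub_zero] at hv
    rw [hv, sub_self, norm_zero] at h2
    have h3 : 0 < n * m * ‖v‖ := by
      have := norm_pos_iff.2 hv0
      positivity
    linarith
  ext i j
  rw [hF, hc]
  rfl

/-! ### Bounds for the differential and its adjoint -/

lemma exists_bounded_preimage {E G : Type*} [NormedAddCommGroup E] [NormedSpace ℝ E]
    [NormedAddCommGroup G] [NormedSpace ℝ G] [FiniteDimensional ℝ G] (f : E →ₗ[ℝ] G) :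
    ∃ K > 0, ∀ y ∈ LinearMap.range f, ∃ x, f x = y ∧ ‖x‖ ≤ K * ‖y‖ := by
  obtain ⟨g, hg⟩ := f.rangeRestrict.exists_rightInverse_of_surjective f.range_rangeRestrict
  refine ⟨‖g.toContinuousLinearMap‖ + 1, by positivity, fun y hy => ⟨g ⟨y, hy⟩, ?_, ?_⟩⟩
  · have := LinearMap.congr_fun hg ⟨y, hy⟩
    exact congrArg Subtype.val this
  · refine (g.toContinuousLinearMap.le_opNorm ⟨y, hy⟩).trans ?_
    change _ * ‖y‖ ≤ _
    gcongr
    linarith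

/-- Norms on tangent spaces are comparable and the differential is bounded near a point. -/
lemma exists_tangent_bounds (lam : Fin n → ℂ) {Zs : Quad n} (hZs : Zs ∈ setZ n s) :
    ∃ K ≥ 1, ∀ᶠ Z in 𝓝 Zs, Z ∈ setZ n s → ∀ ξ : tangent s Z,
      ‖(ξ : Quad n)‖ ≤ K * mnorm s Z ξ ∧ mnorm s Z ξ ≤ K * ‖(ξ : Quad n)‖ ∧
      ‖diffF s lam Z ξ‖ ≤ K * ‖(ξ : Quad n)‖ := by
  obtain ⟨m, hm, B, hB, hreg⟩ := exists_inRegion hZs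
  obtain ⟨r, hr, K, hK, hquad⟩ := exists_quadratic_remainder (contDiffAt_mapF lam hZs)
  have h1 : 0 ≤ √(2 / m + 2) := Real.sqrt_nonneg _
  have h2 : 0 ≤ √B := Real.sqrt_nonneg _
  refine ⟨1 + √(2 / m + 2) + √B + K, by linarith, ?_⟩
  filter_upwards [hreg, Metric.ball_mem_nhds Zs hr] with Z hZr hZb hZ ξ
  refine ⟨(norm_le_mnorm hm hB (hZr hZ) ξ.2).trans ?_, (mnorm_le hm (hZr hZ) ξ).trans ?_, ?_⟩
  · exact mul_le_mul_of_nonneg_right (by linarith) (mnorm_nonneg _ _)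
  · exact mul_le_mul_of_nonneg_right (by linarith) (norm_nonneg _)
  · rw [diffF_eq_fderiv lam hZ]
    refine ((hquad Z hZb Z hZb).2.2.1 ξ).trans ?_
    exact mul_le_mul_of_nonneg_right (by linarith) (norm_nonneg _)

/-- Tangent vectors can be transported to nearby points. -/
lemma exists_transport (lam : Fin n → ℂ) {Zs : Quad n} (hZs : Zs ∈ setZ n s) :
    ∃ K ≥ 1, ∀ᶠ Z in 𝓝 Zs, Z ∈ setZ n s → ∀ ξ : tangent s Zs, ∃ ξ' : tangent s Z,
      ‖(ξ' : Quad n)‖ ≤ 2 * ‖(ξ : Quad n)‖ ∧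
      ‖diffF s lam Z ξ' - diffF s lam Zs ξ‖ ≤ K * ‖Z - Zs‖ * ‖(ξ : Quad n)‖ := by
  obtain ⟨r, hr, K, hK, hquad⟩ := exists_quadratic_remainder (contDiffAt_mapF lam hZs)
  refine ⟨K * n + K + 1, by have : 0 ≤ K * n := by positivity
                            linarith, ?_⟩
  have hr' : 0 < min r (1 / (n + 1)) := by positivity
  filter_upwards [Metric.ball_mem_nhds Zs hr'] with Z hZb hZ ξ
  have hZb1 : Z ∈ Metric.ball Zs r := Metric.ball_subset_ball (min_le_left _ _) hZb
  have hZn : ‖Z - Zs‖ ≤ 1 / (n + 1) := by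
    rw [Metric.mem_ball, dist_eq_norm] at hZb
    exact hZb.le.trans (min_le_right _ _)
  obtain ⟨K0, hK0, hξQ⟩ := ξ.2.2.1
  set x := (ξ : Quad n) with hx
  have hQQ : qPart Zs * (qPart Zs)ᵀ = 1 := mul_eq_one_comm.1 hZs.2.1
  -- Only the `Q`-component of the tangent space depends on the point; left multiplication by `Q
  -- Q_*ᵀ` keeps the same skew matrix.
  let x' : Quad n := (cPart x, qPart Z * (qPart Zs)ᵀ * qPart x, wPart x, vPart x)
  have hx' : x' ∈ tangent s Z := by
    refine ⟨ξ.2.1, ⟨K0, hK0, ?_⟩, ξ.2.2.2⟩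
    change qPart Z * (qPart Zs)ᵀ * qPart x = _
    rw [hξQ, mul_assoc, ← mul_assoc _ (qPart Zs), hZs.2.1, one_mul]
  have hdiff : ‖x' - x‖ ≤ n * ‖Z - Zs‖ * ‖x‖ := by
    have e : x' - x = (0, (qPart Z - qPart Zs) * (qPart Zs)ᵀ * qPart x, 0, 0) := by
      have e1 : (qPart Z - qPart Zs) * (qPart Zs)ᵀ * qPart x
          = qPart Z * (qPart Zs)ᵀ * qPart x - qPart x := by
        rw [sub_mul, sub_mul, hQQ, one_mul]
      rw [e1]
      exact Prod.ext (sub_self _) (Prod.ext rfl (Prod.ext (sub_self _) (sub_self _)))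
    have e2 : ‖(qPart Z - qPart Zs) * (qPart Zs)ᵀ * qPart x‖ ≤ n * ‖Z - Zs‖ * ‖x‖ := by
      refine (norm_mul_le _ _).trans (mul_le_mul ((norm_mul_le _ _).trans ?_) (norm_qPart_le x)
        (norm_nonneg _) (by positivity))
      rw [Matrix.frobenius_norm_transpose, mul_comm]
      gcongr
      · exact norm_of_orthogonal hZs.2.1
      · exact norm_qPart_le (Z - Zs)
    have e3 : 0 ≤ n * ‖Z - Zs‖ * ‖x‖ := by positivity
    rw [e]
    have e4 : ‖(0 : Mat n)‖ ≤ n * ‖Z - Zs‖ * ‖x‖ := by rwa [norm_zero]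
    exact norm_quad_le e4 e2 e4 e4
  refine ⟨⟨x', hx'⟩, ?_, ?_⟩
  · have h1 : n * ‖Z - Zs‖ ≤ 1 := by
      rw [le_div_iff₀ (by positivity)] at hZn
      nlinarith [norm_nonneg (Z - Zs)]
    calc ‖x'‖ = ‖x + (x' - x)‖ := by congr 1; abel
      _ ≤ ‖x‖ + 1 * ‖x‖ := (norm_add_le _ _).trans (by gcongr; exact hdiff.trans (by gcongr))
      _ = _ := by ring
  · rw [diffF_eq_fderiv lam hZ, diffF_eq_fderiv lam hZs]
    change ‖fderiv ℝ (mapF s lam) Z x' - fderiv ℝ (mapF s lam) Zs x‖ ≤ _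
    obtain ⟨-, -, h1, -⟩ := hquad Z hZb1 Z hZb1
    obtain ⟨-, -, -, h2⟩ := hquad Zs (Metric.mem_ball_self hr) Z hZb1
    calc _ = ‖fderiv ℝ (mapF s lam) Z (x' - x)
          + (fderiv ℝ (mapF s lam) Z x - fderiv ℝ (mapF s lam) Zs x)‖ := by
          rw [map_sub]; congr 1; abel
      _ ≤ K * (n * ‖Z - Zs‖ * ‖x‖) + K * ‖Z - Zs‖ * ‖x‖ :=
          (norm_add_le _ _).trans (add_le_add ((h1 _).trans (by gcongr)) (h2 x))
      _ = (K * n + K) * ‖Z - Zs‖ * ‖x‖ := by ring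
      _ ≤ _ := mul_le_mul_of_nonneg_right (mul_le_mul_of_nonneg_right (by linarith)
          (norm_nonneg _)) (norm_nonneg _)

lemma frob_diffF_le (lam : Fin n → ℂ) (Z : Pt n s) (Y : Mat n) (ξ : tangent s (Z : Quad n)) :
    frob Y (diffF s lam (Z : Quad n) ξ)
      ≤ mnorm s (Z : Quad n) (adjF lam Z Y) * mnorm s (Z : Quad n) ξ := by
  rw [← metric_adjF]
  exact (le_abs_self _).trans (abs_metric_le Z _ _)

lemma frob_diffF_adjF_self (lam : Fin n → ℂ) (Z : Pt n s) (Y : Mat n) :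
    frob Y (diffF s lam (Z : Quad n) (adjF lam Z Y))
      = mnorm s (Z : Quad n) (adjF lam Z Y) ^ 2 := by
  rw [← metric_adjF, mnorm_sq Z.2]

lemma mnorm_adjF_add_le (lam : Fin n → ℂ) (Z : Pt n s) (X Y : Mat n) :
    mnorm s (Z : Quad n) (adjF lam Z (X + Y))
      ≤ mnorm s (Z : Quad n) (adjF lam Z X) + mnorm s (Z : Quad n) (adjF lam Z Y) := by
  set a := mnorm s (Z : Quad n) (adjF lam Z (X + Y)) with ha
  have h := frob_diffF_adjF_self lam Z (X + Y)
  rw [frob_add_left, ← ha] at h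
  have h1 := frob_diffF_le lam Z X (adjF lam Z (X + Y))
  have h2 := frob_diffF_le lam Z Y (adjF lam Z (X + Y))
  rw [← ha] at h1 h2
  have ha0 : 0 ≤ a := mnorm_nonneg _ _
  have hb := mnorm_nonneg (s := s) (Z : Quad n) (adjF lam Z X)
  have hc := mnorm_nonneg (s := s) (Z : Quad n) (adjF lam Z Y)
  by_contra! hlt
  have : 0 < a := by linarith
  nlinarith

lemma mnorm_smul (Z ξ : Quad n) (c : ℝ) : mnorm s Z (c • ξ) = |c| * mnorm s Z ξ := by
  have h : metric s Z (c • ξ) (c • ξ) = c ^ 2 * metric s Z ξ ξ := by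
    simp only [metric, frob_eq_sum, ← Finset.sum_add_distrib, Finset.mul_sum]
    refine Finset.sum_congr rfl fun i _ => Finset.sum_congr rfl fun j _ => ?_
    simp only [cPart, qPart, wPart, vPart, Prod.smul_fst, Prod.smul_snd, Matrix.smul_apply,
      smul_eq_mul]
    split_ifs <;> ring
  rw [mnorm, h, Real.sqrt_mul (sq_nonneg c), Real.sqrt_sq_eq_abs, mnorm]

lemma mnorm_adjF_le {lam : Fin n → ℂ} {Z : Pt n s} {K : ℝ} (hK : 0 ≤ K)
    (h : ∀ ξ : tangent s (Z : Quad n), ‖(ξ : Quad n)‖ ≤ K * mnorm s (Z : Quad n) ξ ∧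
      mnorm s (Z : Quad n) ξ ≤ K * ‖(ξ : Quad n)‖ ∧
      ‖diffF s lam (Z : Quad n) ξ‖ ≤ K * ‖(ξ : Quad n)‖) (Y : Mat n) :
    mnorm s (Z : Quad n) (adjF lam Z Y) ≤ K * K * ‖Y‖ := by
  have h1 := frob_diffF_adjF_self lam Z Y
  obtain ⟨h2, -, h3⟩ := h (adjF lam Z Y)
  set a := mnorm s (Z : Quad n) (adjF lam Z Y)
  have ha0 : 0 ≤ a := mnorm_nonneg _ _
  have h4 : a ^ 2 ≤ ‖Y‖ * (K * (K * a)) := by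
    rw [← h1]
    refine (le_abs_self _).trans ((abs_frob_le _ _).trans ?_)
    gcongr
    exact h3.trans (by gcongr)
  rcases ha0.eq_or_lt with h0 | h0
  · rw [← h0]; positivity
  · nlinarith

/-- The all-ones matrix. -/
noncomputable def onesMat (n : ℕ) : Mat n := Matrix.of fun _ _ => 1

lemma frob_onesMat (Y : Mat n) : frob (onesMat n) Y = ∑ i, ∑ j, Y i j := by
  simp [frob_eq_sum, onesMat]

lemma norm_onesMat : ‖onesMat n‖ = n := by
  have h : ‖onesMat n‖ ^ 2 = (n : ℝ) ^ 2 := by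
    rw [← frob_self, frob_onesMat]
    simp [onesMat, sq]
  exact (sq_eq_sq₀ (norm_nonneg _) (by positivity)).1 h

/-- If the range of the differential contains all matrices with vanishing sum of entries, the
adjoint is bounded below on them, near the point. -/
lemma exists_adjF_coercive (lam : Fin n → ℂ) {Zs : Quad n} (hZs : Zs ∈ setZ n s)
    (hrange : ∀ Y : Mat n, ∑ i, ∑ j, Y i j = 0 → Y ∈ LinearMap.range (diffF s lam Zs)) :
    ∃ K ≥ 1, ∀ᶠ Z in 𝓝 Zs, ∀ hZ : Z ∈ setZ n s, ∀ Y : Mat n, ∑ i, ∑ j, Y i j = 0 →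
      ‖Y‖ ≤ K * mnorm s Z (adjF lam ⟨Z, hZ⟩ Y) := by
  obtain ⟨K0, hK0, hpre⟩ := exists_bounded_preimage (diffF s lam Zs)
  obtain ⟨K1, hK1, htr⟩ := exists_transport lam hZs
  obtain ⟨K2, hK2, htan⟩ := exists_tangent_bounds lam hZs
  -- In this ball a preimage of `Y` under `DF(Zs)`, transported to `Z`, is mapped to within `‖Y‖ /
  -- 2` of `Y`, so its pairing with `Y` is at least `‖Y‖² / 2`.
  have hr : 0 < 1 / (2 * K1 * K0) := by positivity
  refine ⟨4 * K2 * K0 + 1, by have : 0 ≤ 4 * K2 * K0 := by positivity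
                              linarith, ?_⟩
  filter_upwards [htr, htan, Metric.ball_mem_nhds Zs hr] with Z h1 h2 hZb hZ Y hY
  obtain ⟨ξ, hξ, hξn⟩ := hpre Y (hrange Y hY)
  obtain ⟨ξ', hξ'n, hξ'⟩ := h1 hZ ξ
  rw [hξ] at hξ'
  rw [Metric.mem_ball, dist_eq_norm, lt_div_iff₀ (by positivity)] at hZb
  have hn0 : 0 ≤ ‖Y‖ := norm_nonneg _
  have hξn' : ‖(ξ : Quad n)‖ ≤ K0 * ‖Y‖ := hξn
  have e1 : ‖diffF s lam Z ξ' - Y‖ ≤ ‖Y‖ / 2 := by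
    calc _ ≤ K1 * ‖Z - Zs‖ * (K0 * ‖Y‖) := hξ'.trans (by gcongr)
      _ = (‖Z - Zs‖ * (2 * K1 * K0)) * (‖Y‖ / 2) := by ring
      _ ≤ 1 * (‖Y‖ / 2) := by gcongr
      _ = _ := one_mul _
  have e2 : ‖Y‖ ^ 2 / 2 ≤ frob Y (diffF s lam Z ξ') := by
    have h3 : diffF s lam Z ξ' = Y + (diffF s lam Z ξ' - Y) := by abel
    have h4 := (abs_le.1 (abs_frob_le Y (diffF s lam Z ξ' - Y))).1
    rw [h3, frob_add_right, frob_self]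
    nlinarith
  have e3 := frob_diffF_le lam ⟨Z, hZ⟩ Y ξ'
  set a := mnorm s Z (adjF lam ⟨Z, hZ⟩ Y)
  have ha0 : 0 ≤ a := mnorm_nonneg _ _
  have e4 : mnorm s Z ξ' ≤ K2 * (2 * (K0 * ‖Y‖)) :=
    (h2 hZ ξ').2.1.trans (by gcongr; exact hξ'n.trans (by gcongr))
  have e5 : ‖Y‖ ^ 2 / 2 ≤ a * (K2 * (2 * (K0 * ‖Y‖))) :=
    e2.trans (e3.trans (by gcongr))
  rcases hn0.eq_or_lt with h0 | h0
  · rw [← h0]; positivity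
  · have : ‖Y‖ ≤ 4 * K2 * K0 * a := by nlinarith
    linarith

/-! ### The local Newton estimate -/

/-- With `Y = y + tJ`, the letters stand for `ε = ‖F‖`, `a = ‖y‖`, `T = |t|`, `D = ‖DF* Y‖`.
Inserting `h2` into `h1` and completing squares bounds `D`, the terms linear in `T` being absorbed
by `ε T²`; then `h3` bounds `ε T`, and `h2` bounds `ε a`. -/
lemma newton_real_bounds {K ε a T D : ℝ} (hK : 1 ≤ K) (hε0 : 0 ≤ ε) (hε1 : ε ≤ 1)
    (_hT : 0 ≤ T) (_hD : 0 ≤ D) (h1 : D ^ 2 + ε * T ^ 2 ≤ 2 * ε * a + K * T * ε ^ 2)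
    (h2 : a ≤ K * (D + T * ε)) (h3 : ε * T ≤ K * ε * D + K * ε ^ 2) :
    D ≤ 4 * K * ε ∧ ε * a ≤ 9 * K ^ 3 * ε ^ 2 ∧ ε * T ≤ 5 * K ^ 2 * ε ^ 2 := by
  have hD1 : D ≤ 4 * K * ε := by
    refine le_of_sq_le_sq ?_ (by positivity)
    have e1 : 2 * ε * a ≤ 2 * ε * (K * (D + T * ε)) := by gcongr
    have e2 : 0 ≤ ε * (T - 3 * K * ε) ^ 2 := by positivity
    have e3 : 0 ≤ (D - 2 * K * ε) ^ 2 := sq_nonneg _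
    have e4 : K ^ 2 * ε ^ 2 * ε ≤ K ^ 2 * ε ^ 2 * 1 := by gcongr
    have e5 : 0 ≤ ε * T ^ 2 := by positivity
    nlinarith
  have hT1 : ε * T ≤ 5 * K ^ 2 * ε ^ 2 := by
    have e1 : K * ε * D ≤ K * ε * (4 * K * ε) := by gcongr
    have e2 : K * ε ^ 2 ≤ K ^ 2 * ε ^ 2 := by
      gcongr; exact le_self_pow₀ hK two_ne_zero
    nlinarith
  refine ⟨hD1, ?_, hT1⟩
  have e1 : ε * a ≤ ε * (K * (D + T * ε)) := by gcongr
  have e2 : K * (ε * D) ≤ K * (ε * (4 * K * ε)) := by gcongr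
  have e3 : K * (ε * T * ε) ≤ K * (5 * K ^ 2 * ε ^ 2 * 1) := by gcongr
  have e4 : K ^ 2 * ε ^ 2 ≤ K ^ 3 * ε ^ 2 := by
    exact mul_le_mul_of_nonneg_right (pow_le_pow_right₀ hK (by norm_num)) (sq_nonneg ε)
  nlinarith

-- The energy estimate for the regularized equation when `DF ∘ DF*` degenerates along the all-ones
-- matrix. Near `Zs` the shift is `ε = ‖F‖`, and `DF[ξ] + F = R - εY` with `‖R‖ ≤ ε²`; the point is
-- that `ε ‖Y‖` is also of order `ε²`.
set_option maxHeartbeats 1000000 in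
lemma exists_newton_step {lam : Fin n → ℂ} {Zs : Quad n} (hZs : Zs ∈ setZ n s)
    (hrange : ∀ Y : Mat n, ∑ i, ∑ j, Y i j = 0 → Y ∈ LinearMap.range (diffF s lam Zs))
    (hFs : mapF s lam Zs = 0) {p : Fin n} (hp : lam p = 1) (hps : 2 * s ≤ (p : ℕ))
    {σmax : ℝ} (hσ : 0 < σmax) :
    ∃ K ≥ 1, ∀ᶠ Z in 𝓝 Zs, ∀ hZ : Z ∈ setZ n s, ∀ (ηk : ℝ) (Y : Mat n),
      IsInexactSolution lam σmax ηk ⟨Z, hZ⟩ Y →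
      ‖(adjF lam ⟨Z, hZ⟩ Y : Quad n)‖ ≤ K * ‖mapF s lam Z‖ ∧
      ‖diffF s lam Z (adjF lam ⟨Z, hZ⟩ Y) + mapF s lam Z‖ ≤ K * ‖mapF s lam Z‖ ^ 2 := by
  obtain ⟨m, hm, B, hB, hreg⟩ := exists_inRegion hZs
  obtain ⟨K1, hK1, hco⟩ := exists_adjF_coercive lam hZs hrange
  obtain ⟨K2, hK2, htan⟩ := exists_tangent_bounds lam hZs
  have hsmall : ∀ᶠ Z in 𝓝 Zs, ‖mapF s lam Z‖ < min (m / 2) (min σmax 1) := by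
    have h := (contDiffAt_mapF lam hZs).continuousAt.norm
    rw [ContinuousAt, hFs, norm_zero] at h
    exact h.eventually_lt_const (by positivity)
  have hn1 : (1 : ℝ) ≤ n := by exact_mod_cast p.pos
  set K3 := 2 * (n : ℝ) ^ 2 / m
  set K4 := 2 * (n : ℝ) ^ 3 + (n : ℝ) ^ 2 * (K2 + 1 + 2 * (B + m) * n) * (6 / m)
  have hK3 : 0 ≤ K3 := by positivity
  have hK4 : 0 ≤ K4 := by positivity
  set K := K1 * (K4 * K2) + K1 + K4 * K2 + n + K3 with hKdef
  have hKK : 1 ≤ K := by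
    have : 0 ≤ K1 * (K4 * K2) + K4 * K2 := by positivity
    linarith
  refine ⟨K2 * (4 * K) + (1 + 9 * K ^ 3 + n * (5 * K ^ 2)), by
    have : 0 ≤ K2 * (4 * K) + (9 * K ^ 3 + n * (5 * K ^ 2)) := by positivity
    linarith, ?_⟩
  filter_upwards [hreg, hco, htan, hsmall] with Z hZr hZco hZtan hZs hZ ηk Y hY
  specialize hZr hZ
  specialize hZco hZ
  specialize hZtan hZ
  have hF1 : ‖mapF s lam Z‖ ≤ m / 2 := hZs.le.trans (min_le_left _ _)
  have hF2 : ‖mapF s lam Z‖ ≤ σmax := hZs.le.trans ((min_le_right _ _).trans (min_le_left _ _))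
  have hF3 : ‖mapF s lam Z‖ ≤ 1 := hZs.le.trans ((min_le_right _ _).trans (min_le_right _ _))
  have hJF := abs_sum_mapF_le hm hZr hp hps hF1
  unfold IsInexactSolution at hY
  simp only [min_eq_right hF2] at hY
  set F := mapF s lam Z
  set ε := ‖F‖
  have hε0 : 0 ≤ ε := norm_nonneg _
  set A := adjF lam ⟨Z, hZ⟩
  set R := diffF s lam Z (A Y) + ε • Y + F with hR
  have hRn : ‖R‖ ≤ ε ^ 2 := hY.trans (by rw [sq]; gcongr; exact min_le_right _ _)
  have hM : diffF s lam Z (A Y) = R - F - ε • Y := by rw [hR]; abel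
  set t := (∑ i, ∑ j, Y i j) / (n : ℝ) ^ 2 with ht
  set J := onesMat n
  set y := Y - t • J with hy
  have hn0 : (n : ℝ) ≠ 0 := by positivity
  have hJJ : frob J J = (n : ℝ) ^ 2 := by rw [frob_self, norm_onesMat]
  have hJY : frob J Y = t * (n : ℝ) ^ 2 := by
    rw [frob_onesMat, ht]; field_simp
  have hJy : frob J y = 0 := by
    rw [hy, frob_sub_right, frob_smul_right, hJJ, hJY, sub_self]
  have hY' : Y = y + t • J := by rw [hy]; abel
  have hysum : ∑ i, ∑ j, y i j = 0 := by rw [← frob_onesMat]; exact hJy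
  set D := mnorm s Z (A Y)
  have hD0 : 0 ≤ D := mnorm_nonneg _ _
  -- the adjoint applied to the all-ones matrix
  have hAJ : mnorm s Z (A J) ≤ K4 * K2 * ε := by
    have h1 := frob_diffF_adjF_self lam ⟨Z, hZ⟩ J
    have h2 := abs_sum_diffF_le hm hZr hp hps hF1 (by linarith) (A J) (hZtan (A J)).2.2
    rw [← frob_onesMat] at h2
    have h3 := (hZtan (A J)).1
    set b := mnorm s Z (A J)
    have hb0 : 0 ≤ b := mnorm_nonneg _ _
    have h4 : b ^ 2 ≤ K4 * ε * (K2 * b) := by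
      refine h1.symm.le.trans ((le_abs_self _).trans (h2.trans ?_))
      gcongr
    rcases hb0.eq_or_lt with h0 | h0
    · rw [← h0]; positivity
    · nlinarith
  have hRF : |frob J (R - F)| ≤ (n + K3) * ε ^ 2 := by
    rw [frob_sub_right]
    have h1 := abs_frob_le J R
    rw [norm_onesMat] at h1
    rw [← frob_onesMat] at hJF
    calc _ ≤ _ := abs_sub _ _
      _ ≤ n * ε ^ 2 + K3 * ε ^ 2 := add_le_add (h1.trans (by gcongr)) hJF
      _ = _ := by ring
  have hRFn : ‖R - F‖ ≤ 2 * ε := by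
    refine (norm_sub_le _ _).trans ?_
    have : ε ^ 2 ≤ ε := by nlinarith
    linarith
  have hK3' : (n + K3) ≤ K := by
    have : 0 ≤ K1 * (K4 * K2) + K4 * K2 := by positivity
    linarith
  have hK4' : K4 * K2 ≤ K := by
    have : 0 ≤ K1 * (K4 * K2) := by positivity
    linarith
  -- Testing with `Y`. The component along `J` meets a right-hand side of order `ε²` only, since
  -- `⟨J, F⟩ = O(ε²)`.
  have h1 : D ^ 2 + ε * |t| ^ 2 ≤ 2 * ε * ‖y‖ + K * |t| * ε ^ 2 := by
    have e1 := frob_diffF_adjF_self lam ⟨Z, hZ⟩ Y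
    change frob Y (diffF s lam Z (A Y)) = D ^ 2 at e1
    have e2 : frob Y (R - F) = frob y (R - F) + t * frob J (R - F) := by
      conv_lhs => rw [hY', frob_add_left, frob_smul_left]
    have e3 : frob Y Y = ‖y‖ ^ 2 + t ^ 2 * (n : ℝ) ^ 2 := by
      have : frob y J = 0 := by rw [frob_comm]; exact hJy
      conv_lhs => rw [hY']
      rw [frob_add_left, frob_add_right, frob_add_right, frob_smul_left, frob_smul_left,
        frob_smul_right, frob_smul_right, hJJ, hJy, this, frob_self]
      ring
    rw [hM, frob_sub_right, frob_smul_right, e2, e3, mul_add] at e1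
    have e4 := (le_abs_self _).trans (abs_frob_le y (R - F))
    have e5 : t * frob J (R - F) ≤ |t| * ((n + K3) * ε ^ 2) := by
      refine (le_abs_self _).trans ?_
      rw [abs_mul]
      gcongr
    have e6 : |t| * ((n + K3) * ε ^ 2) ≤ |t| * (K * ε ^ 2) := by gcongr
    have e7 : ‖y‖ * ‖R - F‖ ≤ ‖y‖ * (2 * ε) := by gcongr
    have e8 : ε * |t| ^ 2 ≤ ε * (t ^ 2 * (n : ℝ) ^ 2) := by
      rw [sq_abs]
      gcongr
      exact le_mul_of_one_le_right (sq_nonneg t) (one_le_pow₀ hn1)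
    have e9 : 0 ≤ ε * ‖y‖ ^ 2 := by positivity
    linarith
  -- Coercivity on zero-sum matrices applied to `y = Y - tJ`, with `DF* J = O(ε)`.
  have h2 : ‖y‖ ≤ K * (D + |t| * ε) := by
    have e1 := hZco y hysum
    have e2 : mnorm s Z (A y) ≤ D + |t| * (K4 * K2 * ε) := by
      have h := mnorm_adjF_add_le lam ⟨Z, hZ⟩ Y ((-t) • J)
      rw [map_smul (adjF lam ⟨Z, hZ⟩), Submodule.coe_smul, mnorm_smul, abs_neg,
        show Y + -t • J = y by rw [hy]; module] at h
      exact h.trans (by gcongr)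
    calc ‖y‖ ≤ K1 * (D + |t| * (K4 * K2 * ε)) := e1.trans (by gcongr)
      _ = K1 * D + K1 * (K4 * K2) * (|t| * ε) := by ring
      _ ≤ K * D + K * (|t| * ε) := by
        have a1 : 0 ≤ K1 * (K4 * K2) + K4 * K2 := by positivity
        have a2 : 0 ≤ K4 * K2 := by positivity
        gcongr <;> linarith
      _ = _ := by ring
  -- Testing with `J`.
  have h3 : ε * |t| ≤ K * ε * D + K * ε ^ 2 := by
    have e1 : |frob J (diffF s lam Z (A Y))| ≤ (K4 * K2 * ε) * D := by
      have h := metric_adjF lam ⟨Z, hZ⟩ J (A Y)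
      rw [← h]
      refine (abs_metric_le ⟨Z, hZ⟩ _ _).trans ?_
      gcongr
    have e2 : ε * (t * (n : ℝ) ^ 2) = frob J (R - F) - frob J (diffF s lam Z (A Y)) := by
      rw [hM, frob_sub_right J (R - F), frob_smul_right, hJY]
      ring
    have e3 : ε * |t| * 1 ≤ |ε * (t * (n : ℝ) ^ 2)| := by
      rw [abs_mul, abs_mul, abs_of_nonneg hε0, abs_of_nonneg (sq_nonneg (n : ℝ)), ← mul_assoc]
      gcongr
      exact one_le_pow₀ hn1
    rw [mul_one, e2] at e3
    calc _ ≤ _ := e3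
      _ ≤ (n + K3) * ε ^ 2 + (K4 * K2 * ε) * D := (abs_sub _ _).trans (add_le_add hRF e1)
      _ ≤ K * ε ^ 2 + (K * ε) * D := by gcongr
      _ = _ := by ring
  obtain ⟨r1, r2, r3⟩ := newton_real_bounds hKK hε0 hF3 (abs_nonneg t) hD0 h1 h2 h3
  have hsum0 : 0 ≤ 1 + 9 * K ^ 3 + n * (5 * K ^ 2) := by positivity
  refine ⟨?_, ?_⟩
  · calc _ ≤ K2 * (4 * K * ε) := (hZtan (A Y)).1.trans (by gcongr)
      _ = K2 * (4 * K) * ε := by ring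
      _ ≤ _ := by gcongr; linarith
  · have e : diffF s lam Z (A Y) + F = R - ε • Y := by rw [hM]; abel
    have eY : ‖Y‖ ≤ ‖y‖ + |t| * n := by
      conv_lhs => rw [hY']
      refine (norm_add_le _ _).trans ?_
      rw [norm_smul, norm_onesMat, Real.norm_eq_abs]
    rw [e]
    calc _ ≤ ‖R‖ + ε * ‖Y‖ := (norm_sub_le _ _).trans (by
            rw [norm_smul, Real.norm_of_nonneg hε0])
      _ ≤ ε ^ 2 + ε * (‖y‖ + |t| * n) := by gcongr
      _ = ε ^ 2 + (ε * ‖y‖ + n * (ε * |t|)) := by ring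
      _ ≤ ε ^ 2 + (9 * K ^ 3 * ε ^ 2 + n * (5 * K ^ 2 * ε ^ 2)) := by gcongr
      _ = (1 + 9 * K ^ 3 + n * (5 * K ^ 2)) * ε ^ 2 := by ring
      _ ≤ _ := by
        have : 0 ≤ K2 * (4 * K) := by positivity
        exact mul_le_mul_of_nonneg_right (by linarith) (sq_nonneg ε)

/-! ### Local convergence -/

lemma halving_bounds {X : Type*} [PseudoMetricSpace X] {z : ℕ → X} {e : ℕ → ℝ} {K : ℝ}
    (hK : 0 ≤ K) {k N : ℕ} (h : ∀ j < N, e (k + j + 1) ≤ e (k + j) / 2 ∧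
      dist (z (k + j + 1)) (z (k + j)) ≤ K * e (k + j)) :
    ∀ j ≤ N, e (k + j) ≤ e k / 2 ^ j ∧ dist (z (k + j)) (z k) ≤ 2 * K * e k * (1 - 1 / 2 ^ j) := by
  intro j
  induction j with
  | zero => intro _; simp
  | succ j ih =>
    intro hj
    obtain ⟨i1, i2⟩ := ih (by omega)
    obtain ⟨h1, h2⟩ := h j (by omega)
    refine ⟨h1.trans ?_, ?_⟩
    · rw [pow_succ, ← div_div]
      linarith
    · have h3 := mul_le_mul_of_nonneg_left i1 hK
      calc dist (z (k + j + 1)) (z k) ≤ _ := dist_triangle _ (z (k + j)) _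
        _ ≤ K * (e k / 2 ^ j) + 2 * K * e k * (1 - 1 / 2 ^ j) := add_le_add (h2.trans h3) i2
        _ = _ := by rw [pow_succ]; field_simp; ring

/-- One iterate close to `x` starts a regime in which `e` at least halves and the total travel is at
most `2 K e`, so the sequence never leaves the ball. No lower bound of `e` by the distance is
assumed; along the sequence it follows from the summed steps. -/
lemma quadratic_convergence_of_local {X : Type*} [PseudoMetricSpace X] {z : ℕ → X} {x : X}
    {e : ℕ → ℝ} {r K : ℝ} (hr : 0 < r) (hK : 1 ≤ K) (he : ∀ k, 0 ≤ e k)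
    (h : ∀ k, dist (z k) x < r → e (k + 1) ≤ K * e k ^ 2 ∧ dist (z (k + 1)) (z k) ≤ K * e k ∧
      e k ≤ K * dist (z k) x) (hacc : MapClusterPt x Filter.atTop z) :
    Filter.Tendsto z Filter.atTop (𝓝 x) ∧
      ∀ᶠ k in Filter.atTop, dist (z (k + 1)) x ≤ 2 * K ^ 4 * dist (z k) x ^ 2 := by
  have hK0 : 0 < K := by linarith
  set r1 := min (r / (4 * K ^ 2)) (1 / (2 * K ^ 2)) with hr1
  have hr1p : 0 < r1 := by positivity
  have hr1a : K ^ 2 * r1 ≤ r / 4 := by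
    have : r1 ≤ r / (4 * K ^ 2) := min_le_left _ _
    rw [le_div_iff₀ (by positivity)] at this
    linarith
  have hr1b : K ^ 2 * r1 ≤ 1 / 2 := by
    have : r1 ≤ 1 / (2 * K ^ 2) := min_le_right _ _
    rw [le_div_iff₀ (by positivity)] at this
    linarith
  have hr1c : r1 ≤ r / 4 := by
    refine le_trans ?_ hr1a
    exact le_mul_of_one_le_left hr1p.le (one_le_pow₀ hK)
  have hfreq := mapClusterPt_iff_frequently.1 hacc
  obtain ⟨k0, hk0⟩ := (hfreq _ (Metric.ball_mem_nhds x hr1p)).exists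
  rw [Metric.mem_ball] at hk0
  have hek0 : K * e k0 ≤ K ^ 2 * r1 := by
    have h1 := (h k0 (by linarith)).2.2
    calc K * e k0 ≤ K * (K * r1) := by gcongr; exact h1.trans (by gcongr)
      _ = _ := by ring
  have key : ∀ j, dist (z (k0 + j)) x < r ∧ e (k0 + j + 1) ≤ e (k0 + j) / 2 ∧
      dist (z (k0 + j + 1)) (z (k0 + j)) ≤ K * e (k0 + j) := by
    intro j
    induction j using Nat.strong_induction_on with
    | _ j ih =>
      obtain ⟨b1, b2⟩ := halving_bounds hK0.le (fun i hi => (ih i hi).2) j le_rfl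
      have hp : (0 : ℝ) < 1 / 2 ^ j := by positivity
      have hpow : (1 : ℝ) ≤ 2 ^ j := one_le_pow₀ (by norm_num)
      have b2' : dist (z (k0 + j)) (z k0) ≤ 2 * (K * e k0) := by
        refine b2.trans ?_
        have := mul_nonneg hK0.le (he k0)
        nlinarith
      have b1' : e (k0 + j) ≤ e k0 := b1.trans (div_le_self (he k0) hpow)
      have hd : dist (z (k0 + j)) x < r := by
        have := dist_triangle (z (k0 + j)) (z k0) x
        linarith
      obtain ⟨c1, c2, -⟩ := h _ hd
      refine ⟨hd, c1.trans ?_, c2⟩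
      have h5 : K * e (k0 + j) ≤ 1 / 2 := by
        calc K * e (k0 + j) ≤ K * e k0 := by gcongr
          _ ≤ _ := hek0.trans hr1b
      have := mul_le_mul_of_nonneg_right h5 (he (k0 + j))
      nlinarith
  -- Compare with a later iterate arbitrarily close to `x`, which exists because `x` is a cluster
  -- point.
  have hdist : ∀ k, k0 ≤ k → dist (z k) x ≤ 2 * K * e k := by
    intro k hk
    refine le_of_forall_pos_lt_add fun ε hε => ?_
    obtain ⟨l, hl, hlk⟩ := ((hfreq _ (Metric.ball_mem_nhds x hε)).and_eventually
      (Filter.eventually_ge_atTop k)).exists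
    rw [Metric.mem_ball] at hl
    obtain ⟨j, rfl⟩ := Nat.exists_eq_add_of_le hlk
    obtain ⟨i, rfl⟩ := Nat.exists_eq_add_of_le hk
    have hb := (halving_bounds (k := k0 + i) (N := j) hK0.le (fun a _ => by
      have := (key (i + a)).2
      rwa [← add_assoc] at this) j le_rfl).2
    have hp : (0 : ℝ) < 1 / 2 ^ j := by positivity
    have hnn : 0 ≤ 2 * K * e (k0 + i) := mul_nonneg (by positivity) (he _)
    have := dist_triangle_left (z (k0 + i)) x (z (k0 + i + j))
    nlinarith
  constructor
  · rw [tendsto_iff_dist_tendsto_zero, ← Filter.tendsto_add_atTop_iff_nat k0]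
    have hlim : Filter.Tendsto (fun j : ℕ => 2 * K * (e k0 * (1 / 2) ^ j)) Filter.atTop (𝓝 0) := by
      have := ((tendsto_pow_atTop_nhds_zero_of_lt_one (r := (1 / 2 : ℝ)) (by norm_num)
        (by norm_num)).const_mul (e k0)).const_mul (2 * K)
      simpa using this
    refine squeeze_zero (fun _ => dist_nonneg) (fun j => ?_) hlim
    have hb := (halving_bounds (k := k0) (N := j) hK0.le (fun a _ => (key a).2) j le_rfl).1
    rw [add_comm j k0]
    refine (hdist _ (by omega)).trans ?_
    rw [one_div, inv_pow, ← div_eq_mul_inv]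
    gcongr
  · filter_upwards [Filter.eventually_ge_atTop k0] with k hk
    obtain ⟨j, rfl⟩ := Nat.exists_eq_add_of_le hk
    obtain ⟨c1, -, c3⟩ := h _ (key j).1
    calc _ ≤ 2 * K * e (k0 + j + 1) := hdist _ (by omega)
      _ ≤ 2 * K * (K * (K * dist (z (k0 + j)) x) ^ 2) := by
          gcongr
          refine c1.trans ?_
          have := he (k0 + j)
          gcongr
      _ = _ := by ring

/-- Near a regular zero of `F` full steps are taken, which reduce `‖F‖` quadratically. -/
lemma exists_local_step {lam : Fin n → ℂ} {Zs : Pt n s}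
    (hrange : ∀ Y : Mat n, ∑ i, ∑ j, Y i j = 0 →
      Y ∈ LinearMap.range (diffF s lam (Zs : Quad n)))
    (hFs : mapF s lam (Zs : Quad n) = 0) {p : Fin n} (hp : lam p = 1) (hps : 2 * s ≤ (p : ℕ))
    {τ ρ σmax δ : ℝ} (hτ : 0 < τ) (hσ : 0 < σmax) :
    ∃ r > 0, ∃ K ≥ 1, ∀ Z Z' : Pt n s, dist Z Zs < r → ∀ (ηk γk : ℝ) (Y : Mat n) (α : ℝ),
      IsInexactSolution lam σmax ηk Z Y → IsStepSize lam τ ρ δ γk Z (adjF lam Z Y) α →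
      (Z' : Quad n) = retr s (Z : Quad n) (α • adjF lam Z Y : tangent s (Z : Quad n)) →
      ‖mapF s lam (Z' : Quad n)‖ ≤ K * ‖mapF s lam (Z : Quad n)‖ ^ 2 ∧
      dist Z' Z ≤ K * ‖mapF s lam (Z : Quad n)‖ ∧
      ‖mapF s lam (Z : Quad n)‖ ≤ K * dist Z Zs := by
  obtain ⟨K1, hK1, hnewton⟩ := exists_newton_step Zs.2 hrange hFs hp hps hσ
  obtain ⟨r2, hr2, K2, hK2, hretr⟩ := exists_retr_expansion lam Zs.2
  obtain ⟨r3, hr3, K3, hK3, hquad⟩ := exists_quadratic_remainder (contDiffAt_mapF lam Zs.2)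
  set K := K1 + K2 * K1 ^ 2 with hK
  have hKp : 0 < K := by positivity
  have hsmall : ∀ᶠ Z in 𝓝 (Zs : Quad n), ‖mapF s lam Z‖ < min (r2 / K1) (τ / K) := by
    have h := (contDiffAt_mapF lam Zs.2).continuousAt.norm
    rw [ContinuousAt, hFs, norm_zero] at h
    exact h.eventually_lt_const (by positivity)
  obtain ⟨r, hr, hball⟩ := Metric.eventually_nhds_iff_ball.1 (hnewton.and (hretr.and
    (hsmall.and (Metric.ball_mem_nhds (Zs : Quad n) hr3))))
  refine ⟨r, hr, K + K2 * K1 + K3, by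
    have : 1 * 1 ≤ K2 * K1 := by gcongr
    linarith, fun Z Z' hZ ηk γk Y α hY hα hZ' => ?_⟩
  obtain ⟨h1, h2, h3, h4⟩ := hball (Z : Quad n) hZ
  obtain ⟨n1, n2⟩ := h1 Z.2 ηk Y hY
  set ξ := adjF lam Z Y
  change ‖(ξ : Quad n)‖ ≤ _ at n1
  change ‖diffF s lam (Z : Quad n) ξ + _‖ ≤ _ at n2
  set ε := ‖mapF s lam (Z : Quad n)‖
  have hε0 : 0 ≤ ε := norm_nonneg _
  have hε1 : ε * K1 ≤ r2 := by
    rw [← le_div_iff₀ (by positivity)]; exact h3.le.trans (min_le_left _ _)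
  have hε2 : ε * K ≤ τ := by
    rw [← le_div_iff₀ hKp]; exact h3.le.trans (min_le_right _ _)
  obtain ⟨e1, e2⟩ := h2 Z.2 ξ (n1.trans (by linarith))
  have hfull : ‖mapF s lam (retr s (Z : Quad n) ξ)‖ ≤ K * ε ^ 2 := by
    calc _ = ‖(mapF s lam (retr s (Z : Quad n) ξ) - mapF s lam (Z : Quad n)
          - diffF s lam (Z : Quad n) ξ) + (diffF s lam (Z : Quad n) ξ
          + mapF s lam (Z : Quad n))‖ := by congr 1; abel
      _ ≤ K2 * (K1 * ε) ^ 2 + K1 * ε ^ 2 :=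
          (norm_add_le _ _).trans (add_le_add (e2.trans (by gcongr)) n2)
      _ = K * ε ^ 2 := by rw [hK]; ring
  have hα1 : α = 1 := by
    rcases hα with ⟨-, h⟩ | ⟨h, -⟩
    · exact h
    · exfalso
      apply h
      refine hfull.trans ?_
      calc K * ε ^ 2 = (ε * K) * ε := by ring
        _ ≤ τ * ε := by gcongr
  rw [hα1, one_smul] at hZ'
  refine ⟨?_, ?_, ?_⟩
  · rw [hZ']
    refine hfull.trans (mul_le_mul_of_nonneg_right ?_ (sq_nonneg ε))
    have : 0 ≤ K2 * K1 := by positivity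
    linarith
  · rw [Subtype.dist_eq, dist_eq_norm, hZ']
    calc _ ≤ K2 * (K1 * ε) := e1.trans (by gcongr)
      _ = K2 * K1 * ε := by ring
      _ ≤ _ := mul_le_mul_of_nonneg_right (by linarith) hε0
  · have h5 := (hquad (Zs : Quad n) (Metric.mem_ball_self hr3) (Z : Quad n) h4).2.1
    rw [hFs, sub_zero] at h5
    rw [Subtype.dist_eq, dist_eq_norm]
    refine h5.trans (mul_le_mul_of_nonneg_right ?_ (norm_nonneg _))
    have : 0 ≤ K2 * K1 := by positivity
    linarith

/-! ### Global convergence -/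

/-- The factors `1 + γ k ≤ exp (γ k)` have bounded product, so `f ≤ B`; subtracting the accumulated
errors `B ∑ γ` then yields a decreasing sequence bounded below. -/
lemma exists_tendsto_of_quasi_antitone {f γ : ℕ → ℝ} (hf : ∀ k, 0 ≤ f k) (hγ : ∀ k, 0 ≤ γ k)
    (hs : Summable γ) (h : ∀ k, f (k + 1) ≤ (1 + γ k) * f k) :
    ∃ L, Filter.Tendsto f Filter.atTop (𝓝 L) := by
  have hb : ∀ k, f k ≤ f 0 * Real.exp (∑ i ∈ Finset.range k, γ i) := by
    intro k
    induction k with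
    | zero => simp
    | succ k ih =>
      rw [Finset.sum_range_succ, Real.exp_add]
      have h1 : 1 + γ k ≤ Real.exp (γ k) := by linarith [Real.add_one_le_exp (γ k)]
      calc f (k + 1) ≤ (1 + γ k) * f k := h k
        _ ≤ Real.exp (γ k) * (f 0 * Real.exp (∑ i ∈ Finset.range k, γ i)) := by
            have := hf k
            gcongr
        _ = _ := by ring
  set B := f 0 * Real.exp (∑' i, γ i) with hB
  have hfB : ∀ k, f k ≤ B := fun k => (hb k).trans (by
    have := hf 0
    rw [hB]
    gcongr
    exact hs.sum_le_tsum _ fun i _ => hγ i)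
  have hB0 : 0 ≤ B := (hf 0).trans (hfB 0)
  set g : ℕ → ℝ := fun k => f k - B * ∑ i ∈ Finset.range k, γ i with hg
  have hanti : Antitone g := by
    refine antitone_nat_of_succ_le fun k => ?_
    simp only [hg, Finset.sum_range_succ]
    have h1 := h k
    have h2 := mul_le_mul_of_nonneg_left (hfB k) (hγ k)
    linarith
  have hbdd : BddBelow (Set.range g) := by
    refine ⟨-(B * ∑' i, γ i), ?_⟩
    rintro _ ⟨k, rfl⟩
    have h1 : B * ∑ i ∈ Finset.range k, γ i ≤ B * ∑' i, γ i := by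
      gcongr
      exact hs.sum_le_tsum _ fun i _ => hγ i
    simp only [hg]
    linarith [hf k]
  have h1 := tendsto_atTop_ciInf hanti hbdd
  have h2 := h1.add (hs.hasSum.tendsto_sum_nat.const_mul B)
  refine ⟨_, h2.congr fun k => ?_⟩
  simp only [hg]
  ring

/-- If the gradient does not vanish at a point, it is bounded below nearby. -/
lemma exists_mnorm_gradf_ge (lam : Fin n → ℂ) {Zs : Quad n} (hZs : Zs ∈ setZ n s)
    (ξ : tangent s Zs) (hξ : 0 < frob (mapF s lam Zs) (diffF s lam Zs ξ)) :
    ∃ g > 0, ∀ᶠ Z in 𝓝 Zs, ∀ hZ : Z ∈ setZ n s,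
      g ≤ mnorm s Z (adjF lam ⟨Z, hZ⟩ (mapF s lam Z)) := by
  obtain ⟨K1, hK1, htr⟩ := exists_transport lam hZs
  obtain ⟨K2, hK2, htan⟩ := exists_tangent_bounds lam hZs
  obtain ⟨r3, hr3, K3, hK3, hquad⟩ := exists_quadratic_remainder (contDiffAt_mapF lam hZs)
  set x := ‖(ξ : Quad n)‖
  set q := frob (mapF s lam Zs) (diffF s lam Zs ξ)
  set Φ := ‖mapF s lam Zs‖
  have hx0 : 0 ≤ x := norm_nonneg _
  have hΦ0 : 0 ≤ Φ := norm_nonneg _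
  -- Within this radius transporting `ξ` and replacing `F(Zs)` by `F(Z)` changes the pairing `q` by
  -- at most `q / 2`.
  have hr : 0 < q / (2 * (K3 * (K2 * (2 * x)) + Φ * (K1 * x) + 1)) := by positivity
  refine ⟨q / 2 / (K2 * (2 * x) + 1), by positivity, ?_⟩
  filter_upwards [htr, htan, Metric.ball_mem_nhds Zs hr3, Metric.ball_mem_nhds Zs hr] with
    Z h1 h2 hZb hZb' hZ
  obtain ⟨ξ', hξ'n, hξ'⟩ := h1 hZ ξ
  obtain ⟨-, h3, h4⟩ := h2 hZ ξ'
  have h5 := (hquad Zs (Metric.mem_ball_self hr3) Z hZb).2.1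
  rw [Metric.mem_ball, dist_eq_norm, lt_div_iff₀ (by positivity)] at hZb'
  set d := ‖Z - Zs‖
  have hd0 : 0 ≤ d := norm_nonneg _
  have hlow : q / 2 ≤ frob (mapF s lam Z) (diffF s lam Z ξ') := by
    have e : frob (mapF s lam Z) (diffF s lam Z ξ') = q
        + frob (mapF s lam Z - mapF s lam Zs) (diffF s lam Z ξ')
        + frob (mapF s lam Zs) (diffF s lam Z ξ' - diffF s lam Zs ξ) := by
      rw [frob_sub_left, frob_sub_right]
      ring
    have e1 := (abs_le.1 (abs_frob_le (mapF s lam Z - mapF s lam Zs) (diffF s lam Z ξ'))).1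
    have e2 := (abs_le.1 (abs_frob_le (mapF s lam Zs) (diffF s lam Z ξ' - diffF s lam Zs ξ))).1
    have e3 : ‖mapF s lam Z - mapF s lam Zs‖ * ‖diffF s lam Z ξ'‖
        ≤ (K3 * d) * (K2 * (2 * x)) := by
      gcongr
      exact h4.trans (by gcongr)
    have e4 : Φ * ‖diffF s lam Z ξ' - diffF s lam Zs ξ‖ ≤ Φ * (K1 * d * x) := by gcongr
    rw [e]
    linarith
  have h6 := frob_diffF_le lam ⟨Z, hZ⟩ (mapF s lam Z) ξ'
  rw [div_le_iff₀ (by positivity)]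
  refine hlow.trans (h6.trans ?_)
  have hm := mnorm_nonneg (s := s) Z (adjF lam ⟨Z, hZ⟩ (mapF s lam Z))
  have h7 : mnorm s Z ξ' ≤ K2 * (2 * x) + 1 := by
    refine (h3.trans (mul_le_mul_of_nonneg_left hξ'n (by linarith))).trans (by linarith)
  exact mul_le_mul_of_nonneg_left h7 hm

/-- Bounds for inexact solutions of the regularized Newton equation away from critical points. -/
lemma inexact_solution_bounds {M : Mat n →ₗ[ℝ] Mat n} {Y F R : Mat n} {σ KM Φ μ σ0 η0 : ℝ}
    (hR : R = M Y + σ • Y + F) (hYM : 0 ≤ frob Y (M Y))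
    (hKM0 : 0 ≤ KM) (hσ0 : 0 < σ0) (hσ : σ0 ≤ σ) (hσ1 : σ ≤ 1) (hΦ : 0 < Φ) (hμ : 0 < μ)
    (hM : ∀ X : Mat n, ‖M X‖ ≤ KM * ‖X‖)
    (hFn : ‖F‖ ≤ Φ) (hMF : μ ≤ ‖M F‖)
    (hRn : ‖R‖ ≤ η0 * Φ) (hη1 : η0 ≤ 1) (hη2 : KM * (η0 * Φ) ≤ μ / 2)
    (hη3 : η0 * Φ ≤ μ / (2 * (KM + 1)) / 2) :
    frob F (M Y) ≤ -((μ / (2 * (KM + 1))) ^ 2 / 2) ∧ ‖Y‖ ≤ 2 * Φ / σ0 := by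
  have hR' : F = R - M Y - σ • Y := by rw [hR]; abel
  set ν := μ / (2 * (KM + 1)) with hν
  have hν0 : 0 < ν := by positivity
  -- Apply `M` to `F = R - MY - σY`: as `‖MF‖` is bounded below and `R` is small, `MY` cannot be
  -- small.
  have hMY : ν ≤ ‖M Y‖ := by
    have e1 : M F = M R - M (M Y) - σ • M Y := by
      conv_lhs => rw [hR', map_sub, map_sub, map_smul]
    have e2 : ‖M F‖ ≤ μ / 2 + KM * ‖M Y‖ + ‖M Y‖ := by
      rw [e1]
      refine (norm_sub_le _ _).trans (add_le_add ((norm_sub_le _ _).trans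
        (add_le_add ?_ (hM _))) ?_)
      · exact (hM R).trans ((mul_le_mul_of_nonneg_left hRn hKM0).trans hη2)
      · rw [norm_smul, Real.norm_of_nonneg (hσ0.le.trans hσ)]
        exact mul_le_of_le_one_left (norm_nonneg _) hσ1
    rw [hν, div_le_iff₀ (by positivity)]
    linarith
  constructor
  -- Descent: the last term is nonpositive because `M` is positive semidefinite, and `R` is at most
  -- `ν / 2`.
  · have e1 : frob F (M Y) = frob R (M Y) - ‖M Y‖ ^ 2 - σ * frob Y (M Y) := by
      conv_lhs => rw [hR']
      rw [frob_sub_left, frob_sub_left, frob_smul_left, frob_self]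
    have e2 := (le_abs_self _).trans (abs_frob_le R (M Y))
    have e3 : ‖R‖ * ‖M Y‖ ≤ (ν / 2) * ‖M Y‖ :=
      mul_le_mul_of_nonneg_right (hRn.trans hη3) (norm_nonneg _)
    have e4 : 0 ≤ σ * frob Y (M Y) := mul_nonneg (hσ0.le.trans hσ) hYM
    have e5 : ν * ν ≤ ‖M Y‖ * ν := mul_le_mul_of_nonneg_right hMY hν0.le
    have e6 : ν * ‖M Y‖ ≤ ‖M Y‖ * ‖M Y‖ := mul_le_mul_of_nonneg_right hMY (norm_nonneg _)
    linarith
  · have e1 : frob Y (R - F) = frob Y (M Y) + σ * ‖Y‖ ^ 2 := by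
      rw [show R - F = M Y + σ • Y by rw [hR]; abel, frob_add_right, frob_smul_right, frob_self]
    have e2 := (le_abs_self _).trans (abs_frob_le Y (R - F))
    have e3 : ‖R - F‖ ≤ 2 * Φ := by
      refine (norm_sub_le _ _).trans ?_
      have : η0 * Φ ≤ 1 * Φ := mul_le_mul_of_nonneg_right hη1 hΦ.le
      linarith
    have e4 : ‖Y‖ * (‖Y‖ * σ0) ≤ ‖Y‖ * (2 * Φ) := by
      have a1 : σ0 * ‖Y‖ ^ 2 ≤ σ * ‖Y‖ ^ 2 := mul_le_mul_of_nonneg_right hσ (sq_nonneg _)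
      have a2 : ‖Y‖ * ‖R - F‖ ≤ ‖Y‖ * (2 * Φ) := mul_le_mul_of_nonneg_left e3 (norm_nonneg _)
      linarith
    rw [le_div_iff₀ hσ0]
    rcases (norm_nonneg Y).eq_or_lt with h0 | h0
    · rw [← h0, zero_mul]; positivity
    · exact le_of_mul_le_mul_left e4 h0

lemma norm_sq_expansion_le {F G E : Mat n} {α g Φ A C : ℝ} (hα0 : 0 ≤ α) (hα1 : α ≤ 1)
    (hg : frob F G = g) (hF : ‖F‖ ≤ Φ) (hG : ‖G‖ ≤ A) (hE : ‖E‖ ≤ C * α ^ 2) (hC : 0 ≤ C) :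
    ‖F + α • G + E‖ ^ 2 - ‖F‖ ^ 2 ≤ 2 * α * g + ((A + C) ^ 2 + 2 * Φ * C) * α ^ 2 := by
  have hΦ : 0 ≤ Φ := (norm_nonneg _).trans hF
  have e : ‖F + α • G + E‖ ^ 2 = ‖F‖ ^ 2 + 2 * α * g + 2 * frob F E + ‖α • G + E‖ ^ 2 := by
    rw [add_assoc, ← frob_self, frob_add_left, frob_add_right, frob_add_right (α • G + E),
      frob_self, frob_self, frob_comm (α • G + E) F, frob_add_right, frob_smul_right, hg]
    ring
  have e1 : frob F E ≤ Φ * (C * α ^ 2) :=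
    (le_abs_self _).trans ((abs_frob_le F E).trans (by gcongr))
  have e2 : ‖α • G + E‖ ≤ (A + C) * α := by
    refine (norm_add_le _ _).trans ?_
    rw [norm_smul, Real.norm_of_nonneg hα0]
    have a1 : α * ‖G‖ ≤ α * A := by gcongr
    have a2 : C * α ^ 2 ≤ C * α := by
      gcongr
      nlinarith
    linarith
  have e3 : ‖α • G + E‖ ^ 2 ≤ ((A + C) * α) ^ 2 := by gcongr
  rw [e]
  linarith

/-- The linear decrease `α ν²` dominates all terms in `α²` once `α` is below a fixed threshold. -/
lemma line_search_real {α δ g G C ν e : ℝ} (hα : 0 ≤ α) (hδ1 : δ ≤ 1)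
    (hg : g ≤ -(ν ^ 2 / 2)) (hgG : |g| ≤ G) (hαc : α * (C + G + 1) ≤ ν ^ 2) (he : 0 ≤ e) :
    2 * α * g + C * α ^ 2 ≤ -δ * α ^ 2 * |g| + e := by
  have e1 : δ * |g| ≤ 1 * G := mul_le_mul hδ1 hgG (abs_nonneg _) zero_le_one
  have e2 : α * (2 * g) ≤ α * -ν ^ 2 := mul_le_mul_of_nonneg_left (by linarith) hα
  have e3 : α * (α * (C + G + 1)) ≤ α * ν ^ 2 := mul_le_mul_of_nonneg_left hαc hα
  have e5 : α ^ 2 * (δ * |g|) ≤ α ^ 2 * (1 * G) := mul_le_mul_of_nonneg_left e1 (sq_nonneg α)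
  linarith [sq_nonneg α]

/-- Near a noncritical point, the directional derivative along the inexact Newton direction is
bounded away from zero, and the line search accepts a step of fixed size. -/
lemma exists_sufficient_decrease (lam : Fin n → ℂ) {Zs : Quad n} (hZs : Zs ∈ setZ n s)
    (ξ : tangent s Zs) (hξ : 0 < frob (mapF s lam Zs) (diffF s lam Zs ξ))
    {ρ σmax δ : ℝ} (hρ : ρ ∈ Set.Ioo (0 : ℝ) 1) (hσ : σmax ∈ Set.Ioo (0 : ℝ) 1)
    (hδ : δ ∈ Set.Ioo (0 : ℝ) (1 / 2)) :
    ∃ c > 0, ∃ η0 > 0, ∃ l : ℕ, ∀ᶠ Z in 𝓝 Zs, ∀ hZ : Z ∈ setZ n s, ∀ (ηk γk : ℝ) (Y : Mat n),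
      0 ≤ γk → ηk ≤ η0 → IsInexactSolution lam σmax ηk ⟨Z, hZ⟩ Y →
      c ≤ |metric s Z (gradf lam ⟨Z, hZ⟩) (adjF lam ⟨Z, hZ⟩ Y)| ∧
      LineSearch lam δ γk ⟨Z, hZ⟩ (adjF lam ⟨Z, hZ⟩ Y) (ρ ^ l) := by
  obtain ⟨K2, hK2, htan⟩ := exists_tangent_bounds lam hZs
  obtain ⟨r, hr, K, hK, hretr⟩ := exists_retr_expansion lam hZs
  obtain ⟨g0, hg0, hgrad⟩ := exists_mnorm_gradf_ge lam hZs ξ hξ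
  have hF0 : mapF s lam Zs ≠ 0 := by
    intro h
    rw [h] at hξ
    simp [frob] at hξ
  have hφ : 0 < ‖mapF s lam Zs‖ := norm_pos_iff.2 hF0
  have hcont := (contDiffAt_mapF lam hZs).continuousAt.norm
  have hF1 : ∀ᶠ Z in 𝓝 Zs, ‖mapF s lam Zs‖ / 2 < ‖mapF s lam Z‖ :=
    hcont.eventually_const_lt (by linarith)
  have hF2 : ∀ᶠ Z in 𝓝 Zs, ‖mapF s lam Z‖ < ‖mapF s lam Zs‖ + 1 :=
    hcont.eventually_lt_const (by linarith)
  set Φ := ‖mapF s lam Zs‖ + 1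
  have hΦ : 0 < Φ := by positivity
  -- A floor for the shift near a point where `F` does not vanish; it bounds `Y`, and thus the
  -- direction.
  set σ0 := min σmax (‖mapF s lam Zs‖ / 2)
  have hσ0 : 0 < σ0 := lt_min hσ.1 (by positivity)
  set KM := K2 * (K2 * (K2 * K2)) with hKM
  have hKM0 : 0 ≤ KM := by positivity
  set μ := g0 ^ 2 / Φ
  have hμ : 0 < μ := by positivity
  set ν := μ / (2 * (KM + 1)) with hν
  have hν0 : 0 < ν := by positivity
  set η0 := min 1 (min (μ / 2 / ((KM + 1) * Φ)) (ν / 2 / Φ)) with hη0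
  have hη0p : 0 < η0 := by positivity
  have hη1 : η0 ≤ 1 := min_le_left _ _
  have hη2 : KM * (η0 * Φ) ≤ μ / 2 := by
    have h : η0 ≤ μ / 2 / ((KM + 1) * Φ) := (min_le_right _ _).trans (min_le_left _ _)
    rw [le_div_iff₀ (by positivity)] at h
    nlinarith [mul_pos hη0p hΦ]
  have hη3 : η0 * Φ ≤ ν / 2 := by
    have h : η0 ≤ ν / 2 / Φ := (min_le_right _ _).trans (min_le_right _ _)
    rwa [le_div_iff₀ hΦ] at h
  set KA := K2 * (K2 * K2 * (2 * Φ / σ0)) with hKA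
  have hKA0 : 0 < KA := by positivity
  set C' := (K2 * KA + K * KA ^ 2) ^ 2 + 2 * Φ * (K * KA ^ 2)
  have hC' : 0 ≤ C' := by positivity
  set G := Φ * (K2 * KA)
  have hG : 0 ≤ G := by positivity
  -- The exponent depends only on the neighbourhood: `ρ ^ l` times the direction stays in the range
  -- of the retraction expansion and satisfies `line_search_real`.
  obtain ⟨l, hl⟩ := exists_pow_lt_of_lt_one
    (show 0 < min (r / KA) (ν ^ 2 / (C' + G + 1)) by positivity) hρ.2
  have hα0 : 0 < ρ ^ l := pow_pos hρ.1 l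
  have hα1 : ρ ^ l ≤ 1 := pow_le_one₀ hρ.1.le hρ.2.le
  have hαr : ρ ^ l * KA ≤ r := by
    rw [← le_div_iff₀ hKA0]; exact hl.le.trans (min_le_left _ _)
  have hαc : ρ ^ l * (C' + G + 1) ≤ ν ^ 2 := by
    rw [← le_div_iff₀ (by positivity)]; exact hl.le.trans (min_le_right _ _)
  refine ⟨ν ^ 2 / 2, by positivity, η0, hη0p, l, ?_⟩
  filter_upwards [htan, hretr, hgrad, hF1, hF2] with Z htan hretr hgrad hF1 hF2 hZ ηk γk Y hγ hη hY
  specialize htan hZ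
  specialize hgrad hZ
  have hadj : ∀ X, ‖(adjF lam ⟨Z, hZ⟩ X : Quad n)‖ ≤ K2 * (K2 * K2 * ‖X‖) := fun X =>
    (htan _).1.trans (by gcongr; exact mnorm_adjF_le (Z := ⟨Z, hZ⟩) (by linarith) htan X)
  have hM : ∀ X, ‖diffF s lam Z (adjF lam ⟨Z, hZ⟩ X)‖ ≤ KM * ‖X‖ := fun X =>
    (htan _).2.2.trans ((mul_le_mul_of_nonneg_left (hadj X) (by linarith)).trans_eq
      (by rw [hKM]; ring))
  have hMF : μ ≤ ‖diffF s lam Z (adjF lam ⟨Z, hZ⟩ (mapF s lam Z))‖ := by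
    have h1 := frob_diffF_adjF_self lam ⟨Z, hZ⟩ (mapF s lam Z)
    have h2 := (le_abs_self _).trans
      (abs_frob_le (mapF s lam Z) (diffF s lam Z (adjF lam ⟨Z, hZ⟩ (mapF s lam Z))))
    have h3 : g0 ^ 2 ≤ mnorm s Z (adjF lam ⟨Z, hZ⟩ (mapF s lam Z)) ^ 2 := by gcongr
    rw [div_le_iff₀ hΦ]
    calc g0 ^ 2 ≤ _ := h3
      _ = _ := h1.symm
      _ ≤ _ := h2
      _ ≤ Φ * _ := by gcongr
      _ = _ := mul_comm _ _
  obtain ⟨b1, b2⟩ := inexact_solution_bounds (M := diffF s lam Z ∘ₗ adjF lam ⟨Z, hZ⟩) (Y := Y)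
    (F := mapF s lam Z) (σ := min σmax ‖mapF s lam Z‖) (η0 := η0) rfl (by
      change 0 ≤ frob Y (diffF s lam Z (adjF lam ⟨Z, hZ⟩ Y))
      have h1 := frob_diffF_adjF_self lam ⟨Z, hZ⟩ Y
      exact (sq_nonneg _).trans_eq h1.symm) hKM0 hσ0 (min_le_min le_rfl hF1.le)
    ((min_le_left _ _).trans hσ.2.le) hΦ hμ hM hF2.le hMF (hY.trans (by
      gcongr
      exact (min_le_left _ _).trans hη)) hη1 hη2 hη3
  have hgm : metric s Z (gradf lam ⟨Z, hZ⟩) (adjF lam ⟨Z, hZ⟩ Y)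
      = frob (mapF s lam Z) (diffF s lam Z (adjF lam ⟨Z, hZ⟩ Y)) :=
    metric_adjF lam ⟨Z, hZ⟩ (mapF s lam Z) (adjF lam ⟨Z, hZ⟩ Y)
  have hAn : ‖(adjF lam ⟨Z, hZ⟩ Y : Quad n)‖ ≤ KA := (hadj Y).trans (by rw [hKA]; gcongr)
  have hMn : ‖diffF s lam Z (adjF lam ⟨Z, hZ⟩ Y)‖ ≤ K2 * KA :=
    (htan _).2.2.trans (mul_le_mul_of_nonneg_left hAn (by linarith))
  have hgG : |frob (mapF s lam Z) (diffF s lam Z (adjF lam ⟨Z, hZ⟩ Y))| ≤ G :=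
    (abs_frob_le _ _).trans (mul_le_mul hF2.le hMn (norm_nonneg _) hΦ.le)
  change frob (mapF s lam Z) (diffF s lam Z (adjF lam ⟨Z, hZ⟩ Y)) ≤ -(ν ^ 2 / 2) at b1
  refine ⟨?_, ?_⟩
  · rw [hgm, abs_of_nonpos (by linarith [sq_nonneg ν])]
    linarith
  · set α := ρ ^ l
    set ζ := adjF lam ⟨Z, hZ⟩ Y
    have hαn : ‖((α • ζ : tangent s Z) : Quad n)‖ ≤ α * KA := by
      rw [Submodule.coe_smul, norm_smul, Real.norm_of_nonneg hα0.le]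
      gcongr
    obtain ⟨-, h2⟩ := hretr hZ (α • ζ) (hαn.trans hαr)
    have h3 := norm_sq_expansion_le (F := mapF s lam Z) (G := diffF s lam Z ζ)
      (E := mapF s lam (retr s Z (α • ζ : tangent s Z)) - mapF s lam Z
        - diffF s lam Z (α • ζ)) (C := K * KA ^ 2) hα0.le hα1 rfl hF2.le hMn
      (h2.trans (by
        calc K * _ ^ 2 ≤ K * (α * KA) ^ 2 := by gcongr
          _ = _ := by ring)) (by positivity)
    rw [map_smul, show mapF s lam Z + α • diffF s lam Z ζ
      + (mapF s lam (retr s Z (α • ζ : tangent s Z)) - mapF s lam Z - α • diffF s lam Z ζ)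
      = mapF s lam (retr s Z (α • ζ : tangent s Z)) by abel] at h3
    unfold LineSearch
    change _ ≤ -δ * α ^ 2 * |metric s Z (gradf lam ⟨Z, hZ⟩) ζ| + γk * ‖mapF s lam Z‖ ^ 2
    rw [hgm]
    refine h3.trans ?_
    have hδ1 : δ ≤ 1 := by linarith [hδ.2]
    exact line_search_real hα0.le hδ1 b1 hgG hαc (mul_nonneg hγ (sq_nonneg _))

/-- The alternative that governs one step, in terms of the squared residual. -/
lemma residual_step {lam : Fin n → ℂ} {τ ρ σmax δ : ℝ} {η γ : ℕ → ℝ}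
    {Z : ℕ → Pt n s} (hZ : IsIterates lam τ ρ σmax δ η γ Z) (k : ℕ) :
    ∃ (Y : Mat n) (a : ℝ) (α : ℝ), IsInexactSolution lam σmax (η k) (Z k) Y ∧
      a = |metric s (Z k : Quad n) (gradf lam (Z k)) (adjF lam (Z k) Y)| ∧
      (‖mapF s lam (Z (k + 1) : Quad n)‖ ≤ τ * ‖mapF s lam (Z k : Quad n)‖ ∨
        (‖mapF s lam (Z (k + 1) : Quad n)‖ ^ 2 - ‖mapF s lam (Z k : Quad n)‖ ^ 2
          ≤ -δ * α ^ 2 * a + γ k * ‖mapF s lam (Z k : Quad n)‖ ^ 2 ∧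
        ∀ l : ℕ, LineSearch lam δ (γ k) (Z k) (adjF lam (Z k) Y) (ρ ^ l) → ρ ^ l ≤ α)) := by
  obtain ⟨Y, α, hY, hα, hnext⟩ := hZ k
  refine ⟨Y, _, α, hY, rfl, ?_⟩
  rw [hnext]
  rcases hα with ⟨h1, rfl⟩ | ⟨-, h1, h2⟩
  · left
    rw [one_smul]
    exact h1
  · right
    exact ⟨h1.2, fun l hl => h2 ⟨⟨l, rfl⟩, hl⟩⟩

lemma eventually_sufficient_decrease {lam : Fin n → ℂ} {Zs : Pt n s}
    (ξ : tangent s (Zs : Quad n))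
    (hξ : 0 < frob (mapF s lam (Zs : Quad n)) (diffF s lam (Zs : Quad n) ξ))
    {ρ σmax δ : ℝ} (hρ : ρ ∈ Set.Ioo (0 : ℝ) 1) (hσ : σmax ∈ Set.Ioo (0 : ℝ) 1)
    (hδ : δ ∈ Set.Ioo (0 : ℝ) (1 / 2)) :
    ∃ c > 0, ∃ η0 > 0, ∃ l : ℕ, ∃ φ > 0, ∀ᶠ W : Pt n s in 𝓝 Zs, φ < ‖mapF s lam (W : Quad n)‖ ∧
      ∀ (ηk γk : ℝ) (Y : Mat n), 0 ≤ γk → ηk ≤ η0 → IsInexactSolution lam σmax ηk W Y →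
      c ≤ |metric s (W : Quad n) (gradf lam W) (adjF lam W Y)| ∧
      LineSearch lam δ γk W (adjF lam W Y) (ρ ^ l) := by
  obtain ⟨c, hc, η0, hη0, l, hdec⟩ := exists_sufficient_decrease lam Zs.2 ξ hξ hρ hσ hδ
  have hF0 : mapF s lam (Zs : Quad n) ≠ 0 := by
    intro h
    rw [h] at hξ
    simp [frob] at hξ
  have hφ : 0 < ‖mapF s lam (Zs : Quad n)‖ := norm_pos_iff.2 hF0
  have hF1 : ∀ᶠ Y in 𝓝 (Zs : Quad n),
      ‖mapF s lam (Zs : Quad n)‖ / 2 < ‖mapF s lam Y‖ :=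
    (contDiffAt_mapF lam Zs.2).continuousAt.norm.eventually_const_lt (by linarith)
  refine ⟨c, hc, η0, hη0, l, _, half_pos hφ, ?_⟩
  have hcont : ContinuousAt (fun W : Pt n s => (W : Quad n)) Zs :=
    continuous_subtype_val.continuousAt
  filter_upwards [hcont.eventually (hF1.and hdec)] with W hW
  obtain ⟨W, hWZ⟩ := W
  exact ⟨hW.1, hW.2 hWZ⟩

lemma quasi_antitone_real {x y τ δ α a g : ℝ} (hx : 0 ≤ x) (hy : 0 ≤ y) (hτ : τ ≤ 1) (hδ : 0 ≤ δ)
    (ha : 0 ≤ a) (hg : 0 ≤ g)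
    (h : y ≤ τ * x ∨ y ^ 2 - x ^ 2 ≤ -δ * α ^ 2 * a + g * x ^ 2) :
    y ^ 2 ≤ (1 + g) * x ^ 2 := by
  have h0 : 0 ≤ g * x ^ 2 := mul_nonneg hg (sq_nonneg x)
  rcases h with h | h
  · have : y ≤ x := h.trans (mul_le_of_le_one_left hx hτ)
    have : y ^ 2 ≤ x ^ 2 := by gcongr
    linarith
  · have h3 : 0 ≤ δ * α ^ 2 * a := by positivity
    linarith

/-- A step accepted by the `τ` test lowers the squared residual by at least `(1 - τ²) φ²`; one found
by the line search by `δ β² c`, as the chosen `α` is at least the admissible `β`, apart from the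
nonmonotone allowance. -/
lemma decrease_real {x y τ δ α β a c g φ d : ℝ} (hy : 0 ≤ y) (hφ : 0 ≤ φ) (hφx : φ < x)
    (hτ0 : 0 ≤ τ) (hτ : τ ≤ 1) (hδ : 0 ≤ δ) (hβ : 0 ≤ β) (hc : 0 ≤ c) (hca : c ≤ a) (hg : 0 ≤ g)
    (hd1 : d ≤ (1 - τ ^ 2) * φ ^ 2) (hd2 : d ≤ δ * β ^ 2 * c)
    (h : y ≤ τ * x ∨ y ^ 2 - x ^ 2 ≤ -δ * α ^ 2 * a + g * x ^ 2 ∧ β ≤ α) :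
    y ^ 2 - x ^ 2 - g * x ^ 2 ≤ -d := by
  have h0 : 0 ≤ g * x ^ 2 := mul_nonneg hg (sq_nonneg x)
  rcases h with h | ⟨h, hα⟩
  · have h2 : y ^ 2 ≤ (τ * x) ^ 2 := by gcongr
    have h3 : (1 - τ ^ 2) * φ ^ 2 ≤ (1 - τ ^ 2) * x ^ 2 := by
      have : 0 ≤ 1 - τ ^ 2 := by nlinarith
      gcongr
    linarith
  · have h5 : δ * β ^ 2 * c ≤ δ * α ^ 2 * a := by gcongr
    linarith

/-- An accumulation point of the method is critical: `F(Zs)` is orthogonal to the range of the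
differential. -/
lemma frob_diffF_nonpos_of_accumulation {lam : Fin n → ℂ} {τ ρ σmax δ : ℝ} {η γ : ℕ → ℝ}
    (hpar : IsAdmissible τ ρ σmax δ η γ) {Z : ℕ → Pt n s}
    (hZ : IsIterates lam τ ρ σmax δ η γ Z) {Zs : Pt n s} (hacc : MapClusterPt Zs Filter.atTop Z)
    (ξ : tangent s (Zs : Quad n)) :
    frob (mapF s lam (Zs : Quad n)) (diffF s lam (Zs : Quad n) ξ) ≤ 0 := by
  by_contra! hpos
  obtain ⟨c, hc, η0, hη0, l, φ, hφ, hdec⟩ := eventually_sufficient_decrease ξ hpos hpar.rho_mem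
    hpar.sigma_mem hpar.delta_mem
  obtain ⟨hτ0, hτ1⟩ := hpar.tau_mem
  have hδ := hpar.delta_mem.1
  have hρ := hpar.rho_mem.1
  choose Y a α hY ha hstep using residual_step hZ
  have ha0 : ∀ k, 0 ≤ a k := fun k => (ha k).symm ▸ abs_nonneg _
  obtain ⟨f, hf⟩ : ∃ f : ℕ → ℝ, ∀ k, f k = ‖mapF s lam (Z k : Quad n)‖ := ⟨_, fun _ => rfl⟩
  have hf0 : ∀ k, 0 ≤ f k := fun k => (hf k).symm ▸ norm_nonneg _
  simp only [← hf] at hstep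
  obtain ⟨L, hL⟩ := exists_tendsto_of_quasi_antitone (f := fun k => f k ^ 2)
    (fun k => sq_nonneg _) (fun k => (hpar.gamma_pos k).le) hpar.gamma_summable
    (fun k => quasi_antitone_real (hf0 k) (hf0 (k + 1)) hτ1.le hδ.le (ha0 k)
      (hpar.gamma_pos k).le ((hstep k).imp id And.left))
  obtain ⟨d, hd⟩ : ∃ d, d = min ((1 - τ ^ 2) * φ ^ 2) (δ * (ρ ^ l) ^ 2 * c) := ⟨_, rfl⟩
  have hd0 : 0 < d := by
    have h1 : 0 < 1 - τ ^ 2 := by nlinarith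
    rw [hd]
    positivity
  -- Convergence of the squared residuals contradicts a decrease by `d` at infinitely many visits
  -- near `Zs`.
  have hlim : Filter.Tendsto (fun k => f (k + 1) ^ 2 - f k ^ 2 - γ k * f k ^ 2)
      Filter.atTop (𝓝 0) := by
    have h1 := (((Filter.tendsto_add_atTop_iff_nat 1).2 hL).sub hL).sub
      (hpar.gamma_summable.tendsto_atTop_zero.mul hL)
    simpa using h1
  have hev1 := hlim.eventually_const_lt (neg_lt_zero.2 hd0)
  have hev2 : ∀ᶠ k in Filter.atTop, η k < η0 := hpar.eta_tendsto.eventually_lt_const hη0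
  obtain ⟨k, ⟨hk1, hk2⟩, hk3, hk4⟩ := ((mapClusterPt_iff_frequently.1 hacc _ hdec).and_eventually
    (hev1.and hev2)).exists
  obtain ⟨g1, g2⟩ := hk2 (η k) (γ k) (Y k) (hpar.gamma_pos k).le hk4.le (hY k)
  rw [← ha k] at g1
  rw [← hf k] at hk1
  have := decrease_real (hf0 (k + 1)) hφ.le hk1 hτ0.le hτ1.le hδ.le (pow_nonneg hρ.le l) hc.le
    g1 (hpar.gamma_pos k).le (hd.trans_le (min_le_left _ _)) (hd.trans_le (min_le_right _ _))
    ((hstep k).imp id fun h => ⟨h.1, h.2 l g2⟩)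
  exact absurd hk3 this.not_gt

/-- Criticality tested with a preimage of the zero-sum part of `F` shows that this part vanishes;
the remaining multiple of the all-ones matrix is excluded by the eigenvalue `1`. -/
lemma mapF_eq_zero_of_accumulation {lam : Fin n → ℂ} {τ ρ σmax δ : ℝ} {η γ : ℕ → ℝ}
    (hpar : IsAdmissible τ ρ σmax δ η γ) {Z : ℕ → Pt n s}
    (hZ : IsIterates lam τ ρ σmax δ η γ Z) {Zs : Pt n s} (hacc : MapClusterPt Zs Filter.atTop Z)
    (hrange : ∀ Y : Mat n, ∑ i, ∑ j, Y i j = 0 →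
      Y ∈ LinearMap.range (diffF s lam (Zs : Quad n)))
    {p : Fin n} (hp : lam p = 1) (hps : 2 * s ≤ (p : ℕ)) :
    mapF s lam (Zs : Quad n) = 0 := by
  obtain ⟨m, hm, B, hB, hreg⟩ := exists_inRegion Zs.2
  have hZr : InRegion s m B (Zs : Quad n) := hreg.self_of_nhds Zs.2
  have hn0 : (n : ℝ) ≠ 0 := by exact_mod_cast p.pos.ne'
  set F := mapF s lam (Zs : Quad n) with hF
  set t := (∑ i, ∑ j, F i j) / (n : ℝ) ^ 2 with ht
  have hJJ : frob (onesMat n) (onesMat n) = (n : ℝ) ^ 2 := by rw [frob_self, norm_onesMat]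
  have hJh : frob (onesMat n) (F - t • onesMat n) = 0 := by
    rw [frob_sub_right, frob_smul_right, hJJ, frob_onesMat, ht]
    field_simp
    ring
  obtain ⟨ξ, hξ⟩ := hrange (F - t • onesMat n) (by rw [← frob_onesMat]; exact hJh)
  have h1 := frob_diffF_nonpos_of_accumulation hpar hZ hacc ξ
  rw [hξ, ← hF] at h1
  have h2 : frob F (F - t • onesMat n) = ‖F - t • onesMat n‖ ^ 2 := by
    conv_lhs => rw [show F = (F - t • onesMat n) + t • onesMat n by abel]
    rw [add_sub_cancel_right, frob_add_left, frob_smul_left, hJh, frob_self]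
    ring
  have h3 : F - t • onesMat n = 0 := by
    rw [h2] at h1
    have := sq_nonneg ‖F - t • onesMat n‖
    exact norm_eq_zero.1 (pow_eq_zero_iff two_ne_zero |>.1 (le_antisymm h1 this))
  refine mapF_eq_zero_of_const hm hZr hp hps (c := t) fun i j => ?_
  have h4 := congrFun (congrFun (sub_eq_zero.1 h3) i) j
  rw [← hF, h4]
  simp [onesMat]

/-! ### The Riemannian distance -/

lemma ofReal_abs_sub_le_lintegral {g g' φ : ℝ → ℝ}
    (hg : ∀ t ∈ Set.Icc (0 : ℝ) 1, HasDerivAt g (g' t) t)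
    (hg' : ContinuousOn g' (Set.Icc (0 : ℝ) 1)) (hφ : ∀ t ∈ Set.Icc (0 : ℝ) 1, |g' t| ≤ φ t) :
    ENNReal.ofReal |g 1 - g 0| ≤ ∫⁻ t in Set.Icc (0 : ℝ) 1, ENNReal.ofReal (φ t) := by
  have h1 : ∫ t in (0 : ℝ)..1, g' t = g 1 - g 0 :=
    intervalIntegral.integral_eq_sub_of_hasDerivAt
      (by rwa [Set.uIcc_of_le zero_le_one])
      (ContinuousOn.intervalIntegrable (by rwa [Set.uIcc_of_le zero_le_one]))
  rw [← h1, intervalIntegral.integral_of_le zero_le_one, MeasureTheory.restrict_Ioc_eq_restrict_Icc,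
    ← Real.enorm_eq_ofReal_abs]
  refine (MeasureTheory.enorm_integral_le_lintegral_enorm _).trans
    (MeasureTheory.setLIntegral_mono' measurableSet_Icc fun t ht => ?_)
  rw [Real.enorm_eq_ofReal_abs]
  exact ENNReal.ofReal_le_ofReal (hφ t ht)

-- Entries of a doubly stochastic matrix are at most `1`, so the Fisher metric dominates the
-- Euclidean one there. Entries of `W` have no such bound along a curve, hence the weight stays.
open Classical in
lemma sq_apply_le_metric {Z : Quad n} (hZ : Z ∈ setZ n s) (ξ : Quad n) (i j : Fin n) :
    cPart ξ i j ^ 2 ≤ metric s Z ξ ξ ∧ qPart ξ i j ^ 2 ≤ metric s Z ξ ξ ∧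
    (InI2 s i j → wPart ξ i j ^ 2 / wPart Z i j ≤ metric s Z ξ ξ) ∧
    vPart ξ i j ^ 2 ≤ metric s Z ξ ξ := by
  obtain ⟨hC, hQ, hW, hV⟩ := hZ
  have hc1 : ∀ i j, cPart Z i j ≤ 1 := fun i j => by
    rw [← hC.2.1 i]
    exact Finset.single_le_sum (f := fun j => cPart Z i j) (fun j _ => (hC.1 i j).le)
      (Finset.mem_univ j)
  have n1 : ∀ i j, 0 ≤ cPart ξ i j * cPart ξ i j / cPart Z i j := fun i j =>
    div_nonneg (mul_self_nonneg _) (hC.1 i j).le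
  have n3 : ∀ i j, 0 ≤ if InI2 s i j then wPart ξ i j * wPart ξ i j / wPart Z i j else 0 := by
    intro i j
    split_ifs with h
    · exact div_nonneg (mul_self_nonneg _) (hW.2 i j h).le
    · exact le_rfl
  set T : Fin n → Fin n → ℝ := fun i j => cPart ξ i j * cPart ξ i j / cPart Z i j +
    qPart ξ i j * qPart ξ i j +
    (if InI2 s i j then wPart ξ i j * wPart ξ i j / wPart Z i j else 0) +
    vPart ξ i j * vPart ξ i j with hT
  have hT0 : ∀ i j, 0 ≤ T i j := fun i j =>
    add_nonneg (add_nonneg (add_nonneg (n1 i j) (mul_self_nonneg _)) (n3 i j)) (mul_self_nonneg _)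
  have hle : T i j ≤ metric s Z ξ ξ := by
    have e : metric s Z ξ ξ = ∑ i, ∑ j, T i j := by
      simp only [metric, frob_eq_sum, ← Finset.sum_add_distrib, hT]
    rw [e]
    exact (Finset.single_le_sum (f := fun j => T i j) (fun j _ => hT0 i j)
      (Finset.mem_univ j)).trans (Finset.single_le_sum (f := fun i => ∑ j, T i j)
      (fun i _ => Finset.sum_nonneg fun j _ => hT0 i j) (Finset.mem_univ i))
  have m2 := mul_self_nonneg (qPart ξ i j)
  have m4 := mul_self_nonneg (vPart ξ i j)
  have m1 := n1 i j
  have m3 := n3 i j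
  have hcc : cPart ξ i j * cPart ξ i j ≤ cPart ξ i j * cPart ξ i j / cPart Z i j := by
    rw [le_div_iff₀ (hC.1 i j)]
    exact mul_le_of_le_one_right (mul_self_nonneg _) (hc1 i j)
  simp only [hT] at hle
  refine ⟨?_, ?_, fun h => ?_, ?_⟩
  · rw [sq]; linarith
  · rw [sq]; linarith
  · rw [if_pos h] at hle m3
    rw [sq]; linarith
  · rw [sq]; linarith

/-- A linear coordinate that is bounded by the metric changes along a curve by at most the length
of the curve. -/
lemma ofReal_abs_sub_le_curveLength {γ : ℝ → Quad n} (hγ : ContDiff ℝ 1 γ) (L : Quad n →ₗ[ℝ] ℝ)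
    (hL : ∀ t ∈ Set.Icc (0 : ℝ) 1, L (deriv γ t) ^ 2 ≤ metric s (γ t) (deriv γ t) (deriv γ t)) :
    ENNReal.ofReal |L (γ 1) - L (γ 0)| ≤ curveLength s γ := by
  have hd := contDiff_one_iff_deriv.1 hγ
  exact ofReal_abs_sub_le_lintegral (g := fun t => L (γ t)) (g' := fun t => L (deriv γ t))
    (fun t _ => L.toContinuousLinearMap.hasFDerivAt.comp_hasDerivAt t (hd.1 t).hasDerivAt)
    (L.continuous_of_finiteDimensional.comp hd.2).continuousOn
    (fun t ht => Real.abs_le_sqrt (hL t ht))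

/-- Since `d√w = dw / (2√w)`, the square root is a Lipschitz coordinate for the metric `dw² / w`,
even on curves that travel far. -/
lemma ofReal_abs_sqrt_sub_le_curveLength {γ : ℝ → Quad n} (hγ : ContDiff ℝ 1 γ)
    (L : Quad n →ₗ[ℝ] ℝ) (hpos : ∀ t ∈ Set.Icc (0 : ℝ) 1, 0 < L (γ t))
    (hL : ∀ t ∈ Set.Icc (0 : ℝ) 1,
      L (deriv γ t) ^ 2 / L (γ t) ≤ metric s (γ t) (deriv γ t) (deriv γ t)) :
    ENNReal.ofReal |√(L (γ 1)) - √(L (γ 0))| ≤ curveLength s γ := by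
  have hd := contDiff_one_iff_deriv.1 hγ
  have hLc : Continuous L := L.continuous_of_finiteDimensional
  refine ofReal_abs_sub_le_lintegral (g := fun t => √(L (γ t)))
    (g' := fun t => L (deriv γ t) / (2 * √(L (γ t))))
    (fun t ht => (L.toContinuousLinearMap.hasFDerivAt.comp_hasDerivAt t
      (hd.1 t).hasDerivAt).sqrt (hpos t ht).ne') ?_ (fun t ht => Real.abs_le_sqrt ?_)
  · refine (hLc.comp hd.2).continuousOn.div
      (continuous_const.mul (hLc.comp hγ.continuous).sqrt).continuousOn fun t ht => ?_
    have := Real.sqrt_pos.2 (hpos t ht)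
    positivity
  · refine le_trans ?_ (hL t ht)
    rw [div_pow, mul_pow, Real.sq_sqrt (hpos t ht).le]
    have := hpos t ht
    gcongr
    linarith

/-- Near a point of `𝒵` the Riemannian distance dominates the distance in the norm. -/
lemma exists_dist_le_riemDist (Zs : Pt n s) :
    ∃ K : ℝ, 0 < K ∧ ∀ᶠ Z in 𝓝 (Zs : Quad n), ∀ hZ : Z ∈ setZ n s,
      ENNReal.ofReal ‖Z - Zs‖ ≤ ENNReal.ofReal K * riemDist ⟨Z, hZ⟩ Zs := by
  obtain ⟨m, hm, B, hB, hreg⟩ := exists_inRegion Zs.2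
  have hZs := hreg.self_of_nhds Zs.2
  have hB0 : 0 ≤ B := by linarith
  refine ⟨n * (1 + 2 * √B) + 1, by positivity, ?_⟩
  filter_upwards [hreg] with Z hZr hZ
  specialize hZr hZ
  set c : ℝ := 1 + 2 * √B with hc
  have hc1 : 1 ≤ c := by have := Real.sqrt_nonneg B; linarith
  have hK : 0 < ENNReal.ofReal (n * c + 1) := ENNReal.ofReal_pos.2 (by positivity)
  have key : ∀ (γ : ℝ → Quad n), ContDiff ℝ 1 γ → (∀ t ∈ Set.Icc (0 : ℝ) 1, γ t ∈ setZ n s) →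
      γ 0 = Z → γ 1 = Zs →
      ENNReal.ofReal ‖Z - Zs‖ ≤ ENNReal.ofReal (n * c + 1) * curveLength s γ := by
    intro γ hγ hγZ h0 h1
    rcases eq_top_or_lt_top (curveLength s γ) with htop | hfin
    · rw [htop, ENNReal.mul_top hK.ne']
      exact le_top
    set ℓ := (curveLength s γ).toReal with hℓ
    have hℓ0 : 0 ≤ ℓ := ENNReal.toReal_nonneg
    have hlen : curveLength s γ = ENNReal.ofReal ℓ := (ENNReal.ofReal_toReal hfin.ne).symm
    rw [hlen, ← ENNReal.ofReal_mul (by positivity)]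
    refine ENNReal.ofReal_le_ofReal ?_
    have lin : ∀ L : Quad n →ₗ[ℝ] ℝ, (∀ t ∈ Set.Icc (0 : ℝ) 1,
        L (deriv γ t) ^ 2 ≤ metric s (γ t) (deriv γ t) (deriv γ t)) →
        |L Z - L Zs| ≤ c * ℓ := by
      intro L hL
      have h := ofReal_abs_sub_le_curveLength hγ L hL
      rw [hlen, ENNReal.ofReal_le_ofReal_iff hℓ0, h0, h1, abs_sub_comm] at h
      exact h.trans (le_mul_of_one_le_left hℓ0 hc1)
    let E : Fin n → Fin n → Mat n →ₗ[ℝ] ℝ := fun i j => Matrix.entryLinearMap ℝ ℝ i j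
    have hcℓ : 0 ≤ c * ℓ := by positivity
    have hC : ‖cPart (Z - (Zs : Quad n))‖ ≤ n * (c * ℓ) := norm_le_of_abs_apply_le hcℓ fun i j =>
      lin (E i j ∘ₗ LinearMap.fst ℝ _ _)
        (fun t ht => (sq_apply_le_metric (hγZ t ht) _ i j).1)
    have hQ : ‖qPart (Z - (Zs : Quad n))‖ ≤ n * (c * ℓ) := norm_le_of_abs_apply_le hcℓ fun i j =>
      lin (E i j ∘ₗ LinearMap.fst ℝ _ _ ∘ₗ LinearMap.snd ℝ _ _)
        (fun t ht => (sq_apply_le_metric (hγZ t ht) _ i j).2.1)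
    have hV : ‖vPart (Z - (Zs : Quad n))‖ ≤ n * (c * ℓ) := norm_le_of_abs_apply_le hcℓ fun i j =>
      lin (E i j ∘ₗ LinearMap.snd ℝ _ _ ∘ₗ LinearMap.snd ℝ _ _ ∘ₗ LinearMap.snd ℝ _ _)
        (fun t ht => (sq_apply_le_metric (hγZ t ht) _ i j).2.2.2)
    have hW : ‖wPart (Z - (Zs : Quad n))‖ ≤ n * (c * ℓ) := norm_le_of_abs_apply_le hcℓ fun i j => by
      change |wPart Z i j - wPart (Zs : Quad n) i j| ≤ _
      by_cases hI : InI2 s i j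
      · have h := ofReal_abs_sqrt_sub_le_curveLength (s := s) hγ
          (E i j ∘ₗ LinearMap.fst ℝ _ _ ∘ₗ LinearMap.snd ℝ _ _ ∘ₗ LinearMap.snd ℝ _ _)
          (fun t ht => (hγZ t ht).2.2.1.2 i j hI)
          (fun t ht => (sq_apply_le_metric (hγZ t ht) _ i j).2.2.1 hI)
        rw [hlen, ENNReal.ofReal_le_ofReal_iff hℓ0, h0, h1, abs_sub_comm] at h
        change |√(wPart Z i j) - √(wPart (Zs : Quad n) i j)| ≤ ℓ at h
        have p1 : 0 < wPart Z i j := hm.trans_le (hZr.w_ge i j hI)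
        have p2 : 0 < wPart (Zs : Quad n) i j := hm.trans_le (hZs.w_ge i j hI)
        have q1 : √(wPart Z i j) ≤ √B := Real.sqrt_le_sqrt
          ((le_abs_self _).trans ((abs_apply_le _ i j).trans ((norm_wPart_le Z).trans hZr.norm_le)))
        have q2 : √(wPart (Zs : Quad n) i j) ≤ √B := Real.sqrt_le_sqrt
          ((le_abs_self _).trans ((abs_apply_le _ i j).trans
            ((norm_wPart_le _).trans hZs.norm_le)))
        have e : wPart Z i j - wPart (Zs : Quad n) i j
            = (√(wPart Z i j) + √(wPart (Zs : Quad n) i j)) *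
              (√(wPart Z i j) - √(wPart (Zs : Quad n) i j)) := by
          rw [← sq_sub_sq, Real.sq_sqrt p1.le, Real.sq_sqrt p2.le]
        rw [e, abs_mul, abs_of_nonneg (by positivity)]
        exact mul_le_mul (by linarith) h (abs_nonneg _) (by linarith)
      · rw [hZ.2.2.1.1 i j hI, Zs.2.2.2.1.1 i j hI]
        simpa using hcℓ
    refine (norm_quad_le hC hQ hW hV).trans ?_
    rw [← mul_assoc]
    exact mul_le_mul_of_nonneg_right (by linarith) hℓ0
  -- The constant moves to the left, so that the claim becomes a lower bound for an infimum over
  -- curves.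
  rw [mul_comm, ← ENNReal.div_le_iff hK.ne' ENNReal.ofReal_ne_top]
  refine le_iInf fun γ => le_iInf fun hγ => le_iInf fun hγZ => le_iInf fun h0 => le_iInf fun h1 => ?_
  rw [ENNReal.div_le_iff hK.ne' ENNReal.ofReal_ne_top, mul_comm]
  exact key γ hγ hγZ h0 h1

/-- Near the identity every orthogonal matrix is the exponential of a small skew matrix. -/
lemma exists_skew_log : ∃ r > 0, ∀ U : Mat n, Uᵀ * U = 1 → ‖U - 1‖ < r →
    ∃ K : Mat n, Kᵀ = -K ∧ NormedSpace.exp K = U ∧ ‖K‖ ≤ 2 * ‖U - 1‖ := by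
  have hd : HasStrictFDerivAt (𝕜 := ℝ) (NormedSpace.exp : Mat n → Mat n)
      ((ContinuousLinearEquiv.refl ℝ (Mat n) : Mat n ≃L[ℝ] Mat n) : Mat n →L[ℝ] Mat n) 0 :=
    hasStrictFDerivAt_exp_zero
  obtain ⟨S, hS, hlin⟩ := hd.approximates_deriv_on_nhds (c := 1 / 2) (Or.inr (by norm_num))
  obtain ⟨ε, hε, hball⟩ := Metric.mem_nhds_iff.1 hS
  have hnear : ∀ x y : Mat n, ‖x‖ < ε → ‖y‖ < ε →
      ‖x - y‖ ≤ 2 * ‖NormedSpace.exp x - NormedSpace.exp y‖ := by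
    intro x y hx hy
    have h := hlin x (hball (mem_ball_zero_iff.2 hx)) y (hball (mem_ball_zero_iff.2 hy))
    change ‖NormedSpace.exp x - NormedSpace.exp y - (x - y)‖ ≤ ((1 / 2 : ℝ≥0) : ℝ) * ‖x - y‖ at h
    have h2 := norm_sub_norm_le (x - y) (NormedSpace.exp x - NormedSpace.exp y)
    rw [norm_sub_rev (x - y)] at h2
    push_cast at h
    linarith
  have hmap := hd.map_nhds_eq_of_equiv
  rw [NormedSpace.exp_zero] at hmap
  have himg : NormedSpace.exp '' Metric.ball (0 : Mat n) ε ∈ 𝓝 (1 : Mat n) := by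
    have h := Filter.image_mem_map (m := NormedSpace.exp) (Metric.ball_mem_nhds (0 : Mat n) hε)
    rw [hmap] at h
    exact h
  obtain ⟨r, hr, hrb⟩ := Metric.mem_nhds_iff.1 himg
  refine ⟨r, hr, fun U hU hUr => ?_⟩
  obtain ⟨K, hK, rfl⟩ := hrb (by rwa [Metric.mem_ball, dist_eq_norm] : U ∈ Metric.ball 1 r)
  rw [mem_ball_zero_iff] at hK
  refine ⟨K, ?_, rfl, ?_⟩
  -- Both sides equal `U⁻¹ = Uᵀ`; injectivity of `exp` near `0` makes `K` skew.
  · have h1 : NormedSpace.exp Kᵀ = NormedSpace.exp (-K) := by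
      rw [Matrix.exp_transpose, Matrix.exp_neg, Matrix.inv_eq_left_inv hU]
    have h2 := hnear Kᵀ (-K) (by rwa [Matrix.frobenius_norm_transpose]) (by rwa [norm_neg])
    rw [h1, sub_self, norm_zero, mul_zero] at h2
    exact sub_eq_zero.1 (norm_eq_zero.1 (le_antisymm h2 (norm_nonneg _)))
  · have h := hnear K 0 hK (by rwa [norm_zero])
    rwa [sub_zero, NormedSpace.exp_zero] at h

lemma norm_orthogonal_mul_le {Q : Mat n} (hQ : Qᵀ * Q = 1) (A : Mat n) : ‖Q * A‖ ≤ n * ‖A‖ :=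
  (Matrix.frobenius_norm_mul Q A).trans
    (mul_le_mul_of_nonneg_right (norm_of_orthogonal hQ) (norm_nonneg _))

lemma exp_smul_orthogonal {K : Mat n} (hK : Kᵀ = -K) (t : ℝ) :
    (NormedSpace.exp (t • K))ᵀ * NormedSpace.exp (t • K) = 1 := by
  rw [← Matrix.exp_transpose, Matrix.transpose_smul, hK, smul_neg,
    ← Matrix.exp_add_of_commute _ _ (Commute.refl (t • K)).neg_left, neg_add_cancel,
    NormedSpace.exp_zero]

/-- Near a point of `𝒵` the Riemannian distance is dominated by the distance in the norm. -/
lemma exists_riemDist_le_dist (Zs : Pt n s) :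
    ∃ K : ℝ, 0 < K ∧ ∀ᶠ Z in 𝓝 (Zs : Quad n), ∀ hZ : Z ∈ setZ n s,
      riemDist ⟨Z, hZ⟩ Zs ≤ ENNReal.ofReal (K * ‖Z - Zs‖) := by
  obtain ⟨m, hm, B, hB, hreg⟩ := exists_inRegion Zs.2
  have hZs := hreg.self_of_nhds Zs.2
  obtain ⟨r, hr, hlog⟩ := exists_skew_log (n := n)
  have hnear : ∀ᶠ Z in 𝓝 (Zs : Quad n), n * ‖Z - (Zs : Quad n)‖ < r := by
    have hc : ContinuousAt (fun Z : Quad n => n * ‖Z - (Zs : Quad n)‖) Zs := by fun_prop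
    exact hc.eventually_lt_const (by simpa using hr)
  refine ⟨√(2 / m + 2) * (1 + 2 * n ^ 2), by positivity, ?_⟩
  filter_upwards [hreg, hnear] with Z hZr hZn hZ
  specialize hZr hZ
  set d := ‖Z - Zs‖ with hd
  have hQ : (qPart Z)ᵀ * qPart Z = 1 := hZ.2.1
  have hQs : (qPart (Zs : Quad n))ᵀ * qPart (Zs : Quad n) = 1 := Zs.2.2.1
  have hQ2 : qPart Z * (qPart Z)ᵀ = 1 := mul_eq_one_comm.1 hQ
  have hQT : (qPart Z)ᵀᵀ * (qPart Z)ᵀ = 1 := by rwa [Matrix.transpose_transpose]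
  have hU1 : ‖(qPart Z)ᵀ * qPart (Zs : Quad n) - 1‖ ≤ n * d := by
    rw [← hQ, ← mul_sub]
    refine (norm_orthogonal_mul_le hQT _).trans ?_
    gcongr
    rw [hd, norm_sub_rev]
    exact norm_qPart_le (Z - (Zs : Quad n))
  obtain ⟨K, hK, hexp, hKn⟩ := hlog ((qPart Z)ᵀ * qPart (Zs : Quad n)) (by
    rw [Matrix.transpose_mul, Matrix.transpose_transpose, mul_assoc, ← mul_assoc (qPart Z), hQ2,
      one_mul, hQs]) (hU1.trans_lt hZn)
  -- Straight lines in the convex factors and a one-parameter group in `O(n)`; the lower bound `m`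
  -- on positive entries persists, so the metric is uniformly bounded on the curve.
  set γ : ℝ → Quad n := fun t => (cPart Z + t • (cPart (Zs : Quad n) - cPart Z),
    qPart Z * NormedSpace.exp (t • K), wPart Z + t • (wPart (Zs : Quad n) - wPart Z),
    vPart Z + t • (vPart (Zs : Quad n) - vPart Z)) with hγ
  set γ' : ℝ → Quad n := fun t => (cPart (Zs : Quad n) - cPart Z,
    qPart Z * (NormedSpace.exp (t • K) * K), wPart (Zs : Quad n) - wPart Z,
    vPart (Zs : Quad n) - vPart Z) with hγ'
  have hline : ∀ (A A' : Mat n) (t : ℝ), HasDerivAt (fun t : ℝ => A + t • (A' - A)) (A' - A) t := by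
    intro A A' t
    have h := ((hasDerivAt_id t).smul_const (A' - A)).const_add A
    rw [one_smul] at h
    exact h
  have hder : ∀ t, HasDerivAt γ (γ' t) t := fun t =>
    (hline _ _ t).prodMk ((((hasDerivAt_exp_smul_const K t).const_mul (qPart Z))).prodMk
      ((hline _ _ t).prodMk (hline _ _ t)))
  have hexpc : Continuous fun t : ℝ => NormedSpace.exp (t • K) :=
    continuous_iff_continuousAt.2 fun t => (hasDerivAt_exp_smul_const K t).continuousAt
  have hder' : deriv γ = γ' := funext fun t => (hder t).deriv
  have hγ1 : ContDiff ℝ 1 γ := by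
    refine contDiff_one_iff_deriv.2 ⟨fun t => (hder t).differentiableAt, ?_⟩
    have h : Continuous γ' := by
      rw [hγ']
      fun_prop
    rw [← hder'] at h
    exact h
  have horth : ∀ t : ℝ, (qPart Z * NormedSpace.exp (t • K))ᵀ * (qPart Z * NormedSpace.exp (t • K))
      = 1 := by
    intro t
    rw [Matrix.transpose_mul, mul_assoc, ← mul_assoc (qPart Z)ᵀ, hQ, one_mul,
      exp_smul_orthogonal hK]
  have hconv : ∀ {a b t : ℝ}, t ∈ Set.Icc (0 : ℝ) 1 → m ≤ a → m ≤ b → m ≤ a + t * (b - a) := by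
    intro a b t ht ha hb
    nlinarith [mul_nonneg ht.1 (sub_nonneg.2 hb), mul_nonneg (sub_nonneg.2 ht.2) (sub_nonneg.2 ha)]
  have hcm : ∀ t ∈ Set.Icc (0 : ℝ) 1, ∀ i j, m ≤ cPart (γ t) i j := fun t ht i j =>
    hconv ht (hZr.c_ge i j) (hZs.c_ge i j)
  have hwm : ∀ t ∈ Set.Icc (0 : ℝ) 1, ∀ i j, InI2 s i j → m ≤ wPart (γ t) i j :=
    fun t ht i j hI => hconv ht (hZr.w_ge i j hI) (hZs.w_ge i j hI)
  have hmem : ∀ t ∈ Set.Icc (0 : ℝ) 1, γ t ∈ setZ n s := by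
    intro t ht
    refine ⟨⟨fun i j => hm.trans_le (hcm t ht i j), fun i => ?_, fun j => ?_⟩, horth t,
      ⟨fun i j hI => ?_, fun i j hI => hm.trans_le (hwm t ht i j hI)⟩, fun i j hI => ?_⟩
    · change ∑ j, (cPart Z i j + t * (cPart (Zs : Quad n) i j - cPart Z i j)) = 1
      rw [Finset.sum_add_distrib, ← Finset.mul_sum, Finset.sum_sub_distrib, hZ.1.2.1 i,
        Zs.2.1.2.1 i, sub_self, mul_zero, add_zero]
    · change ∑ i, (cPart Z i j + t * (cPart (Zs : Quad n) i j - cPart Z i j)) = 1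
      rw [Finset.sum_add_distrib, ← Finset.mul_sum, Finset.sum_sub_distrib, hZ.1.2.2 j,
        Zs.2.1.2.2 j, sub_self, mul_zero, add_zero]
    · change wPart Z i j + t * (wPart (Zs : Quad n) i j - wPart Z i j) = 0
      rw [hZ.2.2.1.1 i j hI, Zs.2.2.2.1.1 i j hI, sub_self, mul_zero, add_zero]
    · change vPart Z i j + t * (vPart (Zs : Quad n) i j - vPart Z i j) = 0
      rw [hZ.2.2.2 i j hI, Zs.2.2.2.2 i j hI, sub_self, mul_zero, add_zero]
  have hnorm : ∀ t, ‖γ' t‖ ≤ (1 + 2 * n ^ 2) * d := by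
    intro t
    have hd0 : 0 ≤ d := norm_nonneg _
    have hdle : d ≤ (1 + 2 * n ^ 2) * d :=
      le_mul_of_one_le_left hd0 (by have := sq_nonneg (n : ℝ); linarith)
    have hsub : d = ‖(Zs : Quad n) - Z‖ := norm_sub_rev _ _
    refine norm_quad_le ?_ ?_ ?_ ?_
    · exact ((norm_cPart_le ((Zs : Quad n) - Z)).trans_eq hsub.symm).trans hdle
    · change ‖qPart Z * (NormedSpace.exp (t • K) * K)‖ ≤ _
      rw [← mul_assoc]
      calc _ ≤ n * ‖K‖ := norm_orthogonal_mul_le (horth t) K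
        _ ≤ n * (2 * (n * d)) := by gcongr; exact hKn.trans (by gcongr)
        _ ≤ _ := by linarith
    · exact ((norm_wPart_le ((Zs : Quad n) - Z)).trans_eq hsub.symm).trans hdle
    · exact ((norm_vPart_le ((Zs : Quad n) - Z)).trans_eq hsub.symm).trans hdle
  have hlen : curveLength s γ ≤ ENNReal.ofReal (√(2 / m + 2) * (1 + 2 * n ^ 2) * d) := by
    unfold curveLength
    calc _ ≤ ∫⁻ _ in Set.Icc (0 : ℝ) 1, ENNReal.ofReal (√(2 / m + 2) * (1 + 2 * n ^ 2) * d) := by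
          refine MeasureTheory.setLIntegral_mono' measurableSet_Icc fun t ht => ?_
          refine ENNReal.ofReal_le_ofReal ?_
          rw [hder', mul_assoc]
          exact (mnorm_le hm ⟨hmem t ht, hcm t ht, hwm t ht, le_refl ‖γ t‖⟩ (γ' t)).trans
            (mul_le_mul_of_nonneg_left (hnorm t) (Real.sqrt_nonneg _))
      _ = _ := by simp
  refine le_trans ?_ hlen
  refine iInf_le_of_le γ (iInf_le_of_le hγ1 (iInf_le_of_le hmem
    (iInf_le_of_le ?_ (iInf_le_of_le ?_ le_rfl))))
  · simp only [hγ, zero_smul, add_zero, NormedSpace.exp_zero, mul_one]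
  · simp only [hγ, one_smul, add_sub_cancel, hexp]
    rw [← mul_assoc, hQ2, one_mul]

/-- Quadratic convergence in the norm implies quadratic convergence in the Riemannian distance. -/
lemma convergesQuadratically_of_dist {Z : ℕ → Pt n s} {Zs : Pt n s}
    (hlim : Filter.Tendsto Z Filter.atTop (𝓝 Zs)) {c : ℝ} (hc : 0 ≤ c)
    (hquad : ∀ᶠ k in Filter.atTop, dist (Z (k + 1)) Zs ≤ c * dist (Z k) Zs ^ 2) :
    ConvergesQuadratically Z Zs := by
  obtain ⟨K1, hK1, h1⟩ := exists_dist_le_riemDist Zs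
  obtain ⟨K2, hK2, h2⟩ := exists_riemDist_le_dist Zs
  have hlim' : Filter.Tendsto (fun k => (Z k : Quad n)) Filter.atTop (𝓝 (Zs : Quad n)) :=
    (continuous_subtype_val.tendsto Zs).comp hlim
  refine ⟨hlim, (K2 * c * K1 ^ 2).toNNReal, ?_⟩
  filter_upwards [hlim'.eventually h1, (Filter.tendsto_add_atTop_iff_nat 1).2 hlim' |>.eventually h2,
    hquad] with k h1 h2 h3
  specialize h1 (Z k).2
  specialize h2 (Z (k + 1)).2
  change dist (Z (k + 1) : Quad n) Zs ≤ c * dist (Z k : Quad n) Zs ^ 2 at h3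
  rw [dist_eq_norm, dist_eq_norm] at h3
  calc riemDist (Z (k + 1)) Zs ≤ ENNReal.ofReal (K2 * ‖(Z (k + 1) : Quad n) - Zs‖) := h2
    _ ≤ ENNReal.ofReal (K2 * c * ‖(Z k : Quad n) - Zs‖ ^ 2) := by
        refine ENNReal.ofReal_le_ofReal ?_
        rw [mul_assoc]
        gcongr
    _ = ENNReal.ofReal (K2 * c) * ENNReal.ofReal ‖(Z k : Quad n) - Zs‖ ^ 2 := by
        rw [ENNReal.ofReal_mul (by positivity), ENNReal.ofReal_pow (norm_nonneg _)]
    _ ≤ ENNReal.ofReal (K2 * c) * (ENNReal.ofReal K1 * riemDist (Z k) Zs) ^ 2 := by gcongr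
    _ = _ := by
        rw [mul_pow, ← mul_assoc, ← ENNReal.ofReal_pow hK1.le,
          ← ENNReal.ofReal_mul (by positivity)]
        rfl

end PDStIEP

/-! ### Quadratic convergence of the method -/

theorem mainTheorem3 {n s : ℕ} (lam : Fin n → ℂ)
    (hlam : PDStIEP.IsOrderedSpectrum s lam) (hreal : PDStIEP.IsRealizable lam)
    (τ ρ σmax δ : ℝ) (η γ : ℕ → ℝ) (hpar : PDStIEP.IsAdmissible τ ρ σmax δ η γ)
    (Z : ℕ → PDStIEP.Pt n s) (hZ : PDStIEP.IsIterates lam τ ρ σmax δ η γ Z)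
    (Zstar : PDStIEP.Pt n s) (hacc : MapClusterPt Zstar Filter.atTop Z)
    (hrange : ∀ Y : PDStIEP.Mat n, ∑ i, ∑ j, Y i j = 0 →
      Y ∈ LinearMap.range (PDStIEP.diffF s lam (Zstar : PDStIEP.Quad n))) :
    PDStIEP.ConvergesQuadratically Z Zstar := by
  -- For `n = 0` there is no eigenvalue `1`, but `𝒵` has at most one point.
  rcases Nat.eq_zero_or_pos n with rfl | hn
  · have hsub : ∀ Y, Y = Zstar := fun Y => Subtype.ext (Subsingleton.elim _ _)
    refine PDStIEP.convergesQuadratically_of_dist (c := 0) ?_ le_rfl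
      (Filter.Eventually.of_forall fun k => ?_)
    · rw [funext fun k => hsub (Z k)]
      exact tendsto_const_nhds
    · rw [hsub (Z (k + 1)), dist_self, zero_mul]
  obtain ⟨p, hp⟩ := PDStIEP.exists_lam_eq_one hn hreal
  have hps := PDStIEP.two_mul_le_of_lam_eq_one hlam hp
  have hFs := PDStIEP.mapF_eq_zero_of_accumulation hpar hZ hacc hrange hp hps
  obtain ⟨r, hr, K, hK, hloc⟩ := PDStIEP.exists_local_step hrange hFs hp hps (ρ := ρ) (δ := δ)
    hpar.tau_mem.1 hpar.sigma_mem.1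
  obtain ⟨h1, h2⟩ := PDStIEP.quadratic_convergence_of_local hr hK
    (e := fun k => ‖PDStIEP.mapF s lam (Z k : PDStIEP.Quad n)‖) (fun k => norm_nonneg _)
    (fun k hk => by
      obtain ⟨Y, α, hY, hα, hnext⟩ := hZ k
      exact hloc (Z k) (Z (k + 1)) hk (η k) (γ k) Y α hY hα hnext) hacc
  exact PDStIEP.convergesQuadratically_of_dist h1 (by positivity) h2
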